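/- **Setting.** Let $\mathcal H_{\mathcal S},\mathcal H_{\mathcal E}$ be non-zero finite-dimensional Hilbert spaces, $h_{\mathcal S}$ a self-adjoint operator on $\mathcal H_{\mathcal S}$, $\tau>0$, $\lambda\in\mathbb R$, and let $s\mapsto h_{\mathcal E}(s)$ (self-adjoint on $\mathcal H_{\mathcal E}$), $s\mapsto\beta(s)\in\mathbb R$ and $s\mapsto v(s)$ (self-adjoint on $\mathcal H_{\mathcal S}\otimes\mathcal H_{\mathcal E}$) be $C^2$ on $[0,1]$ (an adiabatic repeated interaction system, ADRIS). Put $$U(s)=\exp\!\big(-\mathrm i\tau(h_{\mathcal S}\otimes\mathrm{Id}+\mathrm{Id}\otimes h_{\mathcal E}(s)+\lambda v(s))\big),\quad \xi(s)=\frac{e^{-\beta(s)h_{\mathcal E}(s)}}{\operatorname{Tr}e^{-\beta(s)h_{\mathcal E}(s)}},\quad \mathcal L(s)(\rho)=\operatorname{Tr}_{\mathcal E}\big(U(s)(\rho\otimes\xi(s))U(s)^*\big).$$ A state is a non-negative operator of trace one. $\|\cdot\|_1$ is the trace norm, and $\|\cdot\|$ is the operator norm (for maps such as $\mathcal L(s)$: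 with respect to $\|\cdot\|_1$). Let $P(s)$ be the spectral projector of $\mathcal L(s)$ on its peripheral spectrum $\{z\in\mathrm{sp}\,\mathcal L(s):|z|=1\}$, $Q(s)=\mathrm{Id}-P(s)$, and $P^1(s)$ the spectral projector of $\mathcal L(s)$ for the eigenvalue $1$; write $P^1_0=P^1(0)$, $Q_0=Q(0)$. Assume that for every $s\in[0,1]$ the map $\mathcal L(s)$ is irreducible (the only orthogonal projections $p$ with $\mathcal L(s)(p\mathcal B(\mathcal H_{\mathcal S})p)\subset p\mathcal B(\mathcal H_{\mathcal S})p$ are $0$ and $\mathrm{Id}$), and that (H4) $\ell:=\sup_{s\in[0,1]}\|\mathcal L(s)Q(s)\|<1$. Then each $\mathcal L(s)$ has a unique invariant state, the continuous branches $e^j(s)$, $s\in[0,1]$, of peripheral eigenvalues of $\mathcal L(s)$ and their spectral projectors $P^j(s)$ are $C^2$ on $[0,1]$, and there is a constant $c_P$ such that for all $j$, all $s\in[0,1]$ and $\alpha=1,2$, $$\Big\|\frac{\mathrm d^\alpha P^j(s)}{\mathrm ds^\alpha}\Big\|\le c_P,\qquad \Big|\frac{\mathrm d^\alpha e^j(s)}{\mathrm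 ds^\alpha}\Big|\le c_P. \tag{1}$$ **Notation.** Let $\rho^{\mathrm i}$ be an initial state with $(P^1_0+Q_0)\rho^{\mathrm i}=\rho^{\mathrm i}$. For integers $1\le k\le T$, a subscript ${}_{k,T}$ means evaluation at $s=k/T$; $\rho^{\mathrm{inv}}_{k,T}$ is the invariant state of $\mathcal L_{k,T}$; $\rho_{k,T}=\mathcal L_{k,T}\cdots\mathcal L_{1,T}\rho^{\mathrm i}$ and $\rho_{0,T}=\rho^{\mathrm i}$; and $$\sigma_{k,T}=S\big(U_{k,T}(\rho_{k-1,T}\otimes\xi_{k,T})U_{k,T}^*\,\big|\,\mathcal L_{k,T}(\rho_{k-1,T})\otimes\xi_{k,T}\big),\qquad S(\eta|\nu)=\operatorname{Tr}\big(\eta(\log\eta-\log\nu)\big)\ \ (0\log0=0),$$ $$\eta_{k,T}=\rho^{\mathrm{inv}}_{k,T}\otimes\xi_{k,T},\qquad \delta_{k,T}=\tfrac1{16}\inf\mathrm{sp}\,\eta_{k,T},\qquad X_{k,T}=U_{k,T}\,\eta_{k,T}\,U_{k,T}^*-\eta_{k,T},$$ $$D_{k,T}=\mathcal L_{k,T}(\rho_{k-1,T}-\rho^{\mathrm{inv}}_{k,T})\otimes\xi_{k,T}-U_{k,T}\big((\rho_{k-1,T}-\rho^{\mathrm{inv}}_{k,T})\otimes\xi_{k,T}\big)U_{k,T}^*.$$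 For a positive definite $\eta=\sum_i\mu_ip_i$ (spectral decomposition, distinct $\mu_i$), let $$F_\eta(A)=\sum_i\frac{\operatorname{Tr}(Ap_iAp_i)}{2\mu_i}+\sum_{i<j}\operatorname{Tr}(Ap_jAp_i)\,\frac{\log\mu_i-\log\mu_j}{\mu_i-\mu_j}.$$ **Claim.** There are $T_0>0$ and $C^P>0$ depending only on $c_P$, and $C^P_{\eta_{k,T}}>0$ depending only on $c_P$ and $\inf\mathrm{sp}\,\eta_{k,T}$, such that for every system as above, every $c_P$ satisfying (1), every such $\rho^{\mathrm i}$ and all $1\le k\le T$: if $$T\ge\max\big(T_0,\;C^P(\delta_{k,T}(1-\ell))^{-1}\big),\qquad \|Q_0\rho^{\mathrm i}\|_1\,\ell^k\le\delta_{k,T},\qquad \|X_{k,T}\|\le\delta_{k,T},$$ then $$\big|\sigma_{k,T}-F_{\eta_{k,T}}(X_{k,T}-D_{k,T})\big|\le C^P_{\eta_{k,T}}\Big(\|X_{k,T}\|_1+\|Q_0\rho^{\mathrm i}\|_1\,\ell^{k-1}+(T(1-\ell))^{-1}\Big)^3,$$ where $\ell^{0}=1$, also for $\ell=0$. -/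

import Mathlib

/- Operators on a finite-dimensional Hilbert space are complex matrices indexed by an orthonormal
basis; operators on the tensor product `H_S ⊗ H_E` are matrices indexed by `S × E`.
The norm `‖A‖` of a matrix is its operator norm on the Euclidean space `ℂⁿ`. -/
open scoped Matrix.Norms.L2Operator Kronecker ComplexOrder
open Matrix Set

noncomputable section

namespace RIS

section Basic

variable {n : Type*} [Fintype n] [DecidableEq n]

/-- Linear maps on the space of (trace-class) operators. -/
abbrev SuperOp (n : Type*) := Module.End ℂ (Matrix n n ℂ)

/-- A state: a nonnegative operator of trace one. -/
def IsState (ρ : Matrix n n ℂ) : Prop := ρ.PosSemidef ∧ ρ.trace = 1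

/-- The trace norm `‖A‖₁ = Tr √(A* A)`. -/
def traceNorm (A : Matrix n n ℂ) : ℝ := (trace (cfc Real.sqrt (Aᴴ * A))).re

/-- The operator norm of a linear map on the space of operators equipped with the trace norm. -/
def superNorm (Φ : SuperOp n) : ℝ := sSup {r | ∃ A, traceNorm A ≤ 1 ∧ r = traceNorm (Φ A)}

/-- The relative entropy `S(η|ν) = Tr (η (log η - log ν))`. -/
def relEntropy (η ν : Matrix n n ℂ) : ℝ := (trace (η * (cfc Real.log η - cfc Real.log ν))).re

/-- The smallest element of the spectrum of a self-adjoint operator. -/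
def infSpec (η : Matrix n n ℂ) : ℝ := sInf (spectrum ℝ η)

/-- The Gibbs state `exp (-β h) / Tr (exp (-β h))`. -/
def gibbs (β : ℝ) (h : Matrix n n ℂ) : Matrix n n ℂ :=
  (trace (NormedSpace.exp (-(β : ℂ) • h)))⁻¹ • NormedSpace.exp (-(β : ℂ) • h)

/-- The (finite) set of real eigenvalues of `η`. -/
def eigs (η : Matrix n n ℂ) : Finset ℝ := (Matrix.finite_real_spectrum (A := η)).toFinset

/-- The spectral projection of a self-adjoint `η` for the eigenvalue `μ`. -/
def eigProj (η : Matrix n n ℂ) (μ : ℝ) : Matrix n n ℂ := cfc (fun x : ℝ => if x = μ then 1 else 0) η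

/-- The bilinear form
`F_η(A, B) = ∑ᵢ Tr(A pᵢ B pᵢ) / (2 μᵢ) + ∑_{i<j} Tr(A pⱼ B pᵢ) (log μᵢ - log μⱼ) / (μᵢ - μⱼ)`,
where `η = ∑ᵢ μᵢ pᵢ` is the spectral decomposition (distinct `μᵢ`, in increasing order). -/
def entropyForm₂ (η A B : Matrix n n ℂ) : ℂ :=
  ∑ μ ∈ eigs η, trace (A * eigProj η μ * B * eigProj η μ) * ((1 / (2 * μ) : ℝ) : ℂ) +
  ∑ μ ∈ eigs η, ∑ ν ∈ (eigs η).filter (fun ν => μ < ν),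
    trace (A * eigProj η ν * B * eigProj η μ) *
      (((Real.log μ - Real.log ν) / (μ - ν) : ℝ) : ℂ)

/-- The quadratic form `F_η(A) = F_η(A, A)`. -/
def entropyForm (η A : Matrix n n ℂ) : ℂ := entropyForm₂ η A A

/-- A linear map `Φ` on operators is irreducible if the only self-adjoint projections `p` with
`Φ (p X p) ⊆ p X p` (`X` the space of all operators) are `0` and `1`. -/
def Irred (Φ : SuperOp n) : Prop :=
  ∀ p : Matrix n n ℂ, p.IsHermitian → p * p = p →
    (∀ A : Matrix n n ℂ, ∃ B : Matrix n n ℂ, Φ (p * A * p) = p * B * p) → p = 0 ∨ p = 1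

end Basic

section Spectral

variable {V : Type*} [AddCommGroup V] [Module ℂ V] [FiniteDimensional ℂ V]

theorem isCompl_genEigenspaces (Φ : Module.End ℂ V) (M : Set ℂ) :
    IsCompl (⨆ μ ∈ M, Φ.maxGenEigenspace μ) (⨆ μ ∈ Mᶜ, Φ.maxGenEigenspace μ) := by
  constructor
  · exact (Module.End.independent_maxGenEigenspace Φ).disjoint_biSup_biSup disjoint_compl_right
  · rw [codisjoint_iff, eq_top_iff, ← Module.End.iSup_maxGenEigenspace_eq_top Φ]
    refine iSup_le fun μ => ?_
    by_cases h : μ ∈ M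
    · exact le_sup_of_le_left (le_biSup (fun μ => Φ.maxGenEigenspace μ) h)
    · exact le_sup_of_le_right (le_biSup (fun μ => Φ.maxGenEigenspace μ) h)

/-- The spectral projector of `Φ` on the part of its spectrum in `M`: the projection onto the sum
of the generalized eigenspaces of the eigenvalues in `M`, along the sum of all the others. -/
def specProj (Φ : Module.End ℂ V) (M : Set ℂ) : Module.End ℂ V :=
  Submodule.projection _ _ (isCompl_genEigenspaces Φ M)

/-- The peripheral spectral projector `P`, for the eigenvalues on the unit circle. -/
def periProj (Φ : Module.End ℂ V) : Module.End ℂ V := specProj Φ {z | ‖z‖ = 1}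

/-- The complementary projector `Q = Id - P`. -/
def contrProj (Φ : Module.End ℂ V) : Module.End ℂ V := 1 - periProj Φ

end Spectral

section Families

variable {n : Type*} [Fintype n] [DecidableEq n]

/-- A continuous branch `s ↦ e(s)`, `s ∈ [0,1]`, of peripheral eigenvalues of `Φ(s)`. -/
def IsPeriBranch (Φ : ℝ → SuperOp n) (e : ℝ → ℂ) : Prop :=
  ContinuousOn e (Icc 0 1) ∧ ∀ s ∈ Icc (0 : ℝ) 1, (Φ s).HasEigenvalue (e s) ∧ ‖e s‖ = 1

/-- `c` bounds the first two derivatives on `[0,1]` of all peripheral eigenvalues `eʲ(s)` of `Φ(s)`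
and of their spectral projectors `Pʲ(s)` (all of which are `C²`), the latter in the operator norm
coming from the trace norm. -/
def IsPeriBound (Φ : ℝ → SuperOp n) (c : ℝ) : Prop :=
  ∀ e : ℝ → ℂ, IsPeriBranch Φ e →
    ContDiffOn ℝ 2 e (Icc 0 1) ∧
    (∀ A, ContDiffOn ℝ 2 (fun t => specProj (Φ t) {e t} A) (Icc 0 1)) ∧
    ∀ s ∈ Icc (0 : ℝ) 1, ∀ α : ℕ, α = 1 ∨ α = 2 →
      ‖iteratedDerivWithin α e (Icc 0 1) s‖ ≤ c ∧
      ∀ A, traceNorm (iteratedDerivWithin α (fun t => specProj (Φ t) {e t} A) (Icc 0 1) s)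
        ≤ c * traceNorm A

/-- `ℓ = sup_{s ∈ [0,1]} ‖Φ(s) Q(s)‖` and `ℓ < 1`. -/
def H4 (Φ : ℝ → SuperOp n) (ℓ : ℝ) : Prop :=
  IsLUB ((fun s => superNorm (Φ s * contrProj (Φ s))) '' Icc 0 1) ℓ ∧ ℓ < 1

end Families

variable {S E : Type*} [Fintype S] [DecidableEq S] [Fintype E] [DecidableEq E]

/-- The partial trace over `H_E`. -/
def ptrace (M : Matrix (S × E) (S × E) ℂ) : Matrix S S ℂ :=
  Matrix.of fun i j => ∑ e, M (i, e) (j, e)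

/-- The linear map `ρ ↦ Tr_E (U (ρ ⊗ ξ) U*)`. -/
def reduced (U : Matrix (S × E) (S × E) ℂ) (ξ : Matrix E E ℂ) : SuperOp S where
  toFun ρ := ptrace (U * (ρ ⊗ₖ ξ) * Uᴴ)
  map_add' ρ ρ' := by
    ext i j
    simp [ptrace, Matrix.add_kronecker, Matrix.mul_add, Matrix.add_mul, Finset.sum_add_distrib]
  map_smul' a ρ := by
    ext i j
    simp [ptrace, Matrix.smul_kronecker, Finset.mul_sum]

/-- The data of an adiabatic repeated interaction system: system Hamiltonian, probe Hamiltonian,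
inverse temperature and interaction potential (the last three are `C²` on `[0,1]`), interaction
time and coupling strength. -/
structure ADRIS (S E : Type*) [Fintype S] [DecidableEq S] [Fintype E] [DecidableEq E] where
  hS : Matrix S S ℂ
  hE : ℝ → Matrix E E ℂ
  β : ℝ → ℝ
  v : ℝ → Matrix (S × E) (S × E) ℂ
  τ : ℝ
  lam : ℝ
  hS_sa : hS.IsHermitian
  hE_sa : ∀ s ∈ Icc (0 : ℝ) 1, (hE s).IsHermitian
  v_sa : ∀ s ∈ Icc (0 : ℝ) 1, (v s).IsHermitian
  τ_pos : 0 < τ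
  hE_smooth : ContDiffOn ℝ 2 hE (Icc 0 1)
  β_smooth : ContDiffOn ℝ 2 β (Icc 0 1)
  v_smooth : ContDiffOn ℝ 2 v (Icc 0 1)

namespace ADRIS

variable (R : ADRIS S E)

/-- `U(s) = exp (-i τ (h_S ⊗ 1 + 1 ⊗ h_E(s) + lam v(s)))`. -/
def U (s : ℝ) : Matrix (S × E) (S × E) ℂ :=
  NormedSpace.exp (-(Complex.I * (R.τ : ℂ)) •
    (R.hS ⊗ₖ (1 : Matrix E E ℂ) + (1 : Matrix S S ℂ) ⊗ₖ R.hE s + (R.lam : ℂ) • R.v s))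

/-- The probe state `ξ(s)`. -/
def ξ (s : ℝ) : Matrix E E ℂ := gibbs (R.β s) (R.hE s)

/-- The reduced dynamics `L(s)`. -/
def L (s : ℝ) : SuperOp S := reduced (R.U s) (R.ξ s)

/-- The system state `ρ_{k,T} = L(k/T) ⋯ L(1/T) ρⁱ` after `k` interactions. -/
def state (ρi : Matrix S S ℂ) (T : ℕ) : ℕ → Matrix S S ℂ
  | 0 => ρi
  | k + 1 => R.L (((k + 1 : ℕ) : ℝ) / T) (state ρi T k)

/-- The entropy production of a step with parameter `s` that starts in the system state `ρ`. -/
def stepEntropy (s : ℝ) (ρ : Matrix S S ℂ) : ℝ :=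
  relEntropy (R.U s * (ρ ⊗ₖ R.ξ s) * (R.U s)ᴴ) (R.L s ρ ⊗ₖ R.ξ s)

/-- The entropy production `σ_{k,T}` of the `k`-th step, `1 ≤ k ≤ T`. -/
def σ (ρi : Matrix S S ℂ) (T k : ℕ) : ℝ := R.stepEntropy ((k : ℝ) / T) (R.state ρi T (k - 1))

/-- `X = U (ρinv ⊗ ξ) U* - ρinv ⊗ ξ`, at parameter `s`. -/
def X (s : ℝ) (ρinv : Matrix S S ℂ) : Matrix (S × E) (S × E) ℂ :=
  R.U s * (ρinv ⊗ₖ R.ξ s) * (R.U s)ᴴ - ρinv ⊗ₖ R.ξ s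

/-- `D = L(ρ - ρinv) ⊗ ξ - U ((ρ - ρinv) ⊗ ξ) U*`, at parameter `s`. -/
def D (s : ℝ) (ρ ρinv : Matrix S S ℂ) : Matrix (S × E) (S × E) ℂ :=
  R.L s (ρ - ρinv) ⊗ₖ R.ξ s - R.U s * ((ρ - ρinv) ⊗ₖ R.ξ s) * (R.U s)ᴴ

end ADRIS

end RIS

end

/-! Write ω = U(ρ ⊗ ξ)U*, ν = L(ρ) ⊗ ξ and η = ρ^inv ⊗ ξ for one step started in ρ. Invariance of
ρ^inv gives X − D = ω − ν. So the claim compares S(ω|ν) with F_η(ω − ν), with an error cubic in the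
distance of ω and ν from η.

Entropy. If A, B are positive definite with equal trace, then S(A|B) is the integral over t > 0 of
Tr(A(A+t)⁻² (A−B) (B+t)⁻¹ (A−B)). Replacing A and B by η in the two resolvent factors, but not in A
− B, gives F_η(A − B) (`relEntropy_eq_integral`, `entropyForm_eq_integral`). The integrand is
already quadratic in A − B, and Lipschitz bounds on the resolvent factors supply the third power
(`norm_relEntropy_sub_entropyForm_le`). This works when ω and ν are within m/2 of η, where m = inf
sp η. Farther away, both quantities are bounded by a function of m and the cube absorbs that bound;
the entropy bound must not see the spectrum of the marginal of ω, which may be arbitrarily close to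
0 (`abs_relEntropy_ptrace_le`). Dimensions never enter the constants, because m · dim ≤ Tr η = 1.

Distance to η. It is controlled by X and by ρ_{k-1} − ρ^inv, which is an adiabatic estimate
(`IsIrredFamily.traceNorm_sub_invariant_le`). Each L(s) has a Kraus form, so Perron–Frobenius theory
applies. The invariant state is unique and faithful, each peripheral eigenvalue e carries a unitary
a with aK = eKa for all Kraus operators K, its spectral projector is A ↦ Tr(aA) a*ρ^inv, and e is a
root of unity of order bounded by the dimension. Hence continuous branches are constant, the gap
makes the whole peripheral spectrum independent of s, and 1 − e is bounded below for e ≠ 1.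

Split ρ_k − ρ^inv_k into its Q-part and its components for e ≠ 1. The Q-part contracts by ℓ up to
O(1/T) per step. The e-component is driven by (P_{k+1} − P_k)ρ_k, which is only O(1/T) per step and
could add up to O(1). Since e ≠ 1, subtracting e/(1−e) · (P_{k+1} − P_k)ρ^inv_k cancels the main
source by discrete summation by parts. What remains is a second difference of order T⁻² and a
multiple of T⁻¹ ‖ρ_k − ρ^inv_k‖₁. A discrete Gronwall inequality over at most T steps concludes
(`adiabatic_recursion`). -/

set_option linter.unusedSectionVars false

noncomputable section

namespace RIS

/-! ### Functional calculus of Hermitian matrices in an eigenbasis -/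

section FunctionalCalculus

variable {n : Type*} [Fintype n] [DecidableEq n]

/-- The diagonal complex matrix with real entries `a`. -/
def realDiag (a : n → ℝ) : Matrix n n ℂ := Matrix.diagonal fun i => (a i : ℂ)

theorem realDiag_isHermitian {n : Type*} [DecidableEq n] (a : n → ℝ) : (realDiag a).IsHermitian := by
  simp only [realDiag, Matrix.IsHermitian, Matrix.diagonal_conjTranspose]
  congr 1
  ext i
  simp

theorem exists_realDiag {A : Matrix n n ℂ} (hA : A.IsHermitian) :
    ∃ (V : Matrix n n ℂ) (a : n → ℝ), Vᴴ * V = 1 ∧ V * Vᴴ = 1 ∧ A = V * realDiag a * Vᴴ ∧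
      (∀ i, a i ∈ spectrum ℝ A) ∧
      ∀ f : ℝ → ℝ, cfc f A = V * realDiag (fun i => f (a i)) * Vᴴ := by
  refine ⟨hA.eigenvectorUnitary, hA.eigenvalues, ?_, ?_, ?_, hA.eigenvalues_mem_spectrum_real,
    fun f => ?_⟩
  · exact Unitary.coe_star_mul_self hA.eigenvectorUnitary
  · exact Unitary.coe_mul_star_self hA.eigenvectorUnitary
  · exact hA.spectral_theorem
  · rw [hA.cfc_eq]; rfl

theorem conj_realDiag_isHermitian (V : Matrix n n ℂ) (a : n → ℝ) :
    (V * realDiag a * Vᴴ).IsHermitian :=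
  Matrix.isHermitian_mul_mul_conjTranspose V (realDiag_isHermitian a)

/-- The functional calculus may be computed in any orthonormal eigenbasis. -/
theorem cfc_conj_realDiag {V : Matrix n n ℂ} (hV : Vᴴ * V = 1) (a : n → ℝ) (f : ℝ → ℝ) :
    cfc f (V * realDiag a * Vᴴ) = V * realDiag (fun i => f (a i)) * Vᴴ := by
  have hV' : V * Vᴴ = 1 := mul_eq_one_comm.mp hV
  obtain ⟨W, b, hW, hW', hA, -, hf⟩ := exists_realDiag (conj_realDiag_isHermitian V a)
  rw [hf]
  have h : realDiag b * (Wᴴ * V) = (Wᴴ * V) * realDiag a := by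
    calc realDiag b * (Wᴴ * V) = (Wᴴ * W) * realDiag b * (Wᴴ * V) := by rw [hW, one_mul]
      _ = Wᴴ * (W * realDiag b * Wᴴ) * V := by simp only [mul_assoc]
      _ = Wᴴ * (V * realDiag a * Vᴴ) * V := by rw [← hA]
      _ = (Wᴴ * V) * realDiag a * (Vᴴ * V) := by simp only [mul_assoc]
      _ = _ := by rw [hV, mul_one]
  -- Entrywise, the intertwining relation says that entry (i, j) of Wᴴ V vanishes unless b i = a j,
  -- so it persists after applying any f.
  have h' : realDiag (fun i => f (b i)) * (Wᴴ * V) = (Wᴴ * V) * realDiag (fun i => f (a i)) := by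
    ext i j
    have hij := congrFun (congrFun h i) j
    simp only [realDiag, Matrix.diagonal_mul, Matrix.mul_diagonal] at hij ⊢
    by_cases h0 : (Wᴴ * V) i j = 0
    · simp [h0]
    · rw [mul_comm] at hij
      have := mul_left_cancel₀ h0 hij
      rw [mul_comm, Complex.ofReal_injective this]
  calc W * realDiag (fun i => f (b i)) * Wᴴ
      = W * (realDiag (fun i => f (b i)) * (Wᴴ * V)) * Vᴴ := by
        simp only [mul_assoc, hV', mul_one]
    _ = (W * Wᴴ) * V * realDiag (fun i => f (a i)) * Vᴴ := by rw [h']; simp only [mul_assoc]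
    _ = _ := by rw [hW', one_mul]

theorem continuousOn_real_spectrum (A : Matrix n n ℂ) (f : ℝ → ℝ) :
    ContinuousOn f (spectrum ℝ A) :=
  A.finite_real_spectrum.continuousOn f

theorem cfc_mul_cfc (A : Matrix n n ℂ) (f g : ℝ → ℝ) :
    cfc f A * cfc g A = cfc (fun x => f x * g x) A :=
  (cfc_mul f g A (continuousOn_real_spectrum A f) (continuousOn_real_spectrum A g)).symm

theorem cfc_mul_self {A : Matrix n n ℂ} (hA : A.IsHermitian) (f : ℝ → ℝ) :
    cfc f A * A = cfc (fun x => f x * x) A := by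
  rw [← cfc_mul_cfc, cfc_id' ℝ A hA.isSelfAdjoint]

theorem self_mul_cfc {A : Matrix n n ℂ} (hA : A.IsHermitian) (f : ℝ → ℝ) :
    A * cfc f A = cfc (fun x => x * f x) A := by
  rw [← cfc_mul_cfc, cfc_id' ℝ A hA.isSelfAdjoint]

theorem cfc_isHermitian (f : ℝ → ℝ) (A : Matrix n n ℂ) : (cfc f A).IsHermitian :=
  cfc_predicate f A

theorem cfc_one_sub {A : Matrix n n ℂ} (hA : A.IsHermitian) (f : ℝ → ℝ) :
    1 - cfc f A = cfc (fun x => 1 - f x) A := by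
  rw [cfc_sub (fun _ => (1 : ℝ)) f A (continuousOn_real_spectrum A _)
    (continuousOn_real_spectrum A _), cfc_const_one ℝ A hA.isSelfAdjoint]

theorem spectrum_nonneg_of_posSemidef {A : Matrix n n ℂ} (hA : A.PosSemidef) {x : ℝ}
    (hx : x ∈ spectrum ℝ A) : 0 ≤ x := by
  rw [hA.1.spectrum_real_eq_range_eigenvalues] at hx
  obtain ⟨i, rfl⟩ := hx
  exact hA.eigenvalues_nonneg i

theorem norm_cfc_matrix_le {A : Matrix n n ℂ} {f : ℝ → ℝ} {c : ℝ} (hc : 0 ≤ c)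
    (h : ∀ x ∈ spectrum ℝ A, |f x| ≤ c) : ‖cfc f A‖ ≤ c :=
  norm_cfc_le hc h

theorem cfc_posSemidef {A : Matrix n n ℂ} {f : ℝ → ℝ}
    (h : ∀ x ∈ spectrum ℝ A, 0 ≤ f x) : (cfc f A).PosSemidef := by
  have hsq : cfc f A = (cfc (fun x => √(f x)) A)ᴴ * cfc (fun x => √(f x)) A := by
    rw [(cfc_isHermitian _ A).eq, cfc_mul_cfc]
    exact cfc_congr fun x hx => (Real.mul_self_sqrt (h x hx)).symm
  rw [hsq]
  exact Matrix.posSemidef_conjTranspose_mul_self _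

end FunctionalCalculus

/-! ### Trace norm, polar decomposition and duality with the operator norm -/

section TraceNorm

variable {n : Type*} [Fintype n] [DecidableEq n]

theorem norm_le_one_of_unitary {V : Matrix n n ℂ} (hV : Vᴴ * V = 1) : ‖V‖ ≤ 1 := by
  have h := Matrix.l2_opNorm_conjTranspose_mul_self V
  have h1 : ‖(1 : Matrix n n ℂ)‖ ≤ 1 := by
    rw [← Matrix.diagonal_one, Matrix.l2_opNorm_diagonal]
    exact (pi_norm_le_iff_of_nonneg zero_le_one).2 fun i => by simp
  rw [hV] at h
  nlinarith [norm_nonneg V]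

theorem norm_entry_le (A : Matrix n n ℂ) (i j : n) : ‖A i j‖ ≤ ‖A‖ := by
  have h := Matrix.l2_opNorm_mulVec A (EuclideanSpace.single j 1)
  have h2 := PiLp.norm_apply_le (WithLp.toLp 2 (A *ᵥ (EuclideanSpace.single j (1 : ℂ)).ofLp)) i
  have h3 : (A *ᵥ (EuclideanSpace.single j (1 : ℂ)).ofLp) i = A i j := by
    simp
  simp only [h3] at h2
  simpa using h2.trans h

theorem norm_trace_le (A : Matrix n n ℂ) : ‖A.trace‖ ≤ Fintype.card n * ‖A‖ := by
  calc ‖A.trace‖ ≤ ∑ i, ‖A i i‖ := norm_sum_le _ _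
    _ ≤ ∑ _i : n, ‖A‖ := Finset.sum_le_sum fun i _ => norm_entry_le A i i
    _ = _ := by simp

theorem norm_conj_unitary_le {V : Matrix n n ℂ} (hV : Vᴴ * V = 1) (A : Matrix n n ℂ) :
    ‖V * A * Vᴴ‖ ≤ ‖A‖ := by
  have h1 := norm_le_one_of_unitary hV
  have h2 : ‖Vᴴ‖ ≤ 1 := by rwa [Matrix.l2_opNorm_conjTranspose]
  calc ‖V * A * Vᴴ‖ ≤ ‖V * A‖ * ‖Vᴴ‖ := norm_mul_le _ _
    _ ≤ (‖V‖ * ‖A‖) * 1 := by gcongr; exact norm_mul_le _ _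
    _ ≤ (1 * ‖A‖) * 1 := by gcongr
    _ = ‖A‖ := by ring

theorem norm_trace_mul_posSemidef_le (B : Matrix n n ℂ) {H : Matrix n n ℂ} (hH : H.PosSemidef) :
    ‖(B * H).trace‖ ≤ ‖B‖ * H.trace.re := by
  obtain ⟨V, a, hV, hV', hA, ha, -⟩ := exists_realDiag hH.1
  replace ha : ∀ i, 0 ≤ a i := fun i => spectrum_nonneg_of_posSemidef hH (ha i)
  have htr : H.trace = ((∑ i, a i : ℝ) : ℂ) := by
    rw [hA, Matrix.trace_mul_cycle, hV, one_mul]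
    simp [realDiag, Matrix.trace]
  have hB : (B * H).trace = ∑ i, (Vᴴ * B * V) i i * (a i : ℂ) := by
    rw [hA]
    have : (B * (V * realDiag a * Vᴴ)).trace = ((Vᴴ * B * V) * realDiag a).trace := by
      rw [← mul_assoc, ← mul_assoc, Matrix.trace_mul_comm]
      simp only [mul_assoc]
    rw [this]
    simp [realDiag, Matrix.trace, Matrix.mul_diagonal]
  rw [hB, htr, Complex.ofReal_re, Finset.mul_sum]
  refine (norm_sum_le _ _).trans (Finset.sum_le_sum fun i _ => ?_)
  rw [norm_mul, Complex.norm_real, Real.norm_of_nonneg (ha i)]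
  refine mul_le_mul_of_nonneg_right ((norm_entry_le _ i i).trans ?_) (ha i)
  have := norm_conj_unitary_le (V := Vᴴ) (by rwa [Matrix.conjTranspose_conjTranspose]) B
  rwa [Matrix.conjTranspose_conjTranspose] at this

theorem sqrt_cfc_posSemidef (A : Matrix n n ℂ) : (cfc Real.sqrt (Aᴴ * A)).PosSemidef :=
  cfc_posSemidef fun _ _ => Real.sqrt_nonneg _

theorem trace_sqrt_eq (A : Matrix n n ℂ) :
    (cfc Real.sqrt (Aᴴ * A)).trace = (traceNorm A : ℂ) := by
  have h := (sqrt_cfc_posSemidef A).trace_nonneg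
  rw [traceNorm]
  exact (Complex.eq_re_of_ofReal_le (r := 0) (by simpa using h))

theorem traceNorm_nonneg (A : Matrix n n ℂ) : 0 ≤ traceNorm A :=
  (Complex.nonneg_iff.1 (sqrt_cfc_posSemidef A).trace_nonneg).1

/-- Polar decomposition. -/
theorem exists_polar (A : Matrix n n ℂ) :
    ∃ W : Matrix n n ℂ, ‖W‖ ≤ 1 ∧ W * A = cfc Real.sqrt (Aᴴ * A) ∧
      A = Wᴴ * cfc Real.sqrt (Aᴴ * A) := by
  set H := Aᴴ * A with hHdef
  have hHp : H.PosSemidef := Matrix.posSemidef_conjTranspose_mul_self A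
  have hH : H.IsHermitian := hHp.1
  -- With 0⁻¹ = 0 this is the pseudo-inverse of |A|, so F Aᴴ is the adjoint partial isometry even
  -- when A is singular.
  set F := cfc (fun x : ℝ => (√x)⁻¹) H with hF
  have hFh : Fᴴ = F := (cfc_isHermitian _ H).eq
  refine ⟨F * Aᴴ, ?_, ?_, ?_⟩
  · have h := Matrix.l2_opNorm_conjTranspose_mul_self (F * Aᴴ)ᴴ
    rw [Matrix.l2_opNorm_conjTranspose] at h
    have h1 : (F * Aᴴ)ᴴᴴ * (F * Aᴴ)ᴴ = cfc (fun x : ℝ => (√x)⁻¹ * x * (√x)⁻¹) H := by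
      rw [Matrix.conjTranspose_conjTranspose, Matrix.conjTranspose_mul,
        Matrix.conjTranspose_conjTranspose, hFh]
      calc F * Aᴴ * (A * F) = F * H * F := by simp only [hHdef, mul_assoc]
        _ = _ := by rw [hF, cfc_mul_self hH, cfc_mul_cfc]
    rw [h1] at h
    have h2 : ‖cfc (fun x : ℝ => (√x)⁻¹ * x * (√x)⁻¹) H‖ ≤ 1 := by
      refine norm_cfc_matrix_le zero_le_one fun x hx => ?_
      have hx0 := spectrum_nonneg_of_posSemidef hHp hx
      rcases hx0.eq_or_lt with rfl | hx1
      · simp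
      · have := Real.sqrt_pos.2 hx1
        have h3 : (√x)⁻¹ * x * (√x)⁻¹ = 1 := by
          field_simp
          exact (Real.sq_sqrt hx0).symm
        rw [h3, abs_one]
    nlinarith [norm_nonneg (F * Aᴴ)]
  · rw [mul_assoc, ← hHdef, hF, cfc_mul_self hH]
    refine cfc_congr fun x hx => ?_
    have hx0 := spectrum_nonneg_of_posSemidef hHp hx
    rcases hx0.eq_or_lt with rfl | hx1
    · simp
    · have := Real.sqrt_pos.2 hx1
      field_simp
      exact (Real.sq_sqrt hx0).symm
  · rw [Matrix.conjTranspose_mul, Matrix.conjTranspose_conjTranspose, hFh, mul_assoc, hF,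
      cfc_mul_cfc]
    -- P is the support projection of |A|; the square of A(1 − P) vanishes, whence A = AP.
    set P := cfc (fun x : ℝ => (√x)⁻¹ * √x) H with hP
    have hPh : Pᴴ = P := (cfc_isHermitian _ H).eq
    have hz : (A * (1 - P))ᴴ * (A * (1 - P)) = 0 := by
      rw [Matrix.conjTranspose_mul, Matrix.conjTranspose_sub, Matrix.conjTranspose_one, hPh]
      calc (1 - P) * Aᴴ * (A * (1 - P)) = (1 - P) * H * (1 - P) := by
            simp only [hHdef, mul_assoc]
        _ = cfc (fun _ : ℝ => (0 : ℝ)) H := by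
          rw [hP, cfc_one_sub hH, cfc_mul_self hH, cfc_mul_cfc]
          refine cfc_congr fun x hx => ?_
          have hx0 := spectrum_nonneg_of_posSemidef hHp hx
          rcases hx0.eq_or_lt with rfl | hx1
          · simp
          · have := (Real.sqrt_pos.2 hx1).ne'
            simp [inv_mul_cancel₀ this]
        _ = 0 := cfc_const_zero ℝ H
    have hz' := Matrix.conjTranspose_mul_self_eq_zero.1 hz
    rw [mul_sub, mul_one, sub_eq_zero] at hz'
    exact hz'

theorem norm_trace_mul_le (B A : Matrix n n ℂ) : ‖(B * A).trace‖ ≤ ‖B‖ * traceNorm A := by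
  obtain ⟨W, hW, -, hA⟩ := exists_polar A
  calc ‖(B * A).trace‖ = ‖(B * Wᴴ * cfc Real.sqrt (Aᴴ * A)).trace‖ := by
        conv_lhs => rw [hA, ← mul_assoc]
    _ ≤ ‖B * Wᴴ‖ * traceNorm A := norm_trace_mul_posSemidef_le _ (sqrt_cfc_posSemidef A)
    _ ≤ ‖B‖ * traceNorm A := by
      refine mul_le_mul_of_nonneg_right ?_ (traceNorm_nonneg A)
      calc ‖B * Wᴴ‖ ≤ ‖B‖ * ‖Wᴴ‖ := norm_mul_le _ _
        _ ≤ ‖B‖ * 1 := by rw [Matrix.l2_opNorm_conjTranspose]; gcongr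
        _ = _ := mul_one _

theorem exists_trace_mul_eq (A : Matrix n n ℂ) :
    ∃ W : Matrix n n ℂ, ‖W‖ ≤ 1 ∧ (W * A).trace = (traceNorm A : ℂ) := by
  obtain ⟨W, hW, h, -⟩ := exists_polar A
  exact ⟨W, hW, by rw [h, trace_sqrt_eq]⟩

/-- The polar factor attains the dual pairing, so every trace-norm inequality reduces to a scalar
one tested against contractions W. The triangle inequality and the finite-difference bounds are
obtained this way. -/
theorem traceNorm_le_of_forall {A : Matrix n n ℂ} {c : ℝ}
    (h : ∀ W : Matrix n n ℂ, ‖W‖ ≤ 1 → ‖(W * A).trace‖ ≤ c) : traceNorm A ≤ c := by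
  obtain ⟨W, hW, hA⟩ := exists_trace_mul_eq A
  have := h W hW
  rwa [hA, Complex.norm_real, Real.norm_of_nonneg (traceNorm_nonneg A)] at this

theorem norm_trace_mul_le_of_norm_le_one {W : Matrix n n ℂ} (hW : ‖W‖ ≤ 1) (A : Matrix n n ℂ) :
    ‖(W * A).trace‖ ≤ traceNorm A :=
  (norm_trace_mul_le W A).trans (mul_le_of_le_one_left (traceNorm_nonneg A) hW)

theorem traceNorm_add_le (A B : Matrix n n ℂ) :
    traceNorm (A + B) ≤ traceNorm A + traceNorm B :=
  traceNorm_le_of_forall fun W hW => by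
    rw [mul_add, Matrix.trace_add]
    exact (norm_add_le _ _).trans (add_le_add (norm_trace_mul_le_of_norm_le_one hW A)
      (norm_trace_mul_le_of_norm_le_one hW B))

theorem traceNorm_zero : traceNorm (0 : Matrix n n ℂ) = 0 :=
  le_antisymm (traceNorm_le_of_forall fun W _ => by simp) (traceNorm_nonneg _)

theorem traceNorm_smul_le (z : ℂ) (A : Matrix n n ℂ) : traceNorm (z • A) ≤ ‖z‖ * traceNorm A :=
  traceNorm_le_of_forall fun W hW => by
    rw [Matrix.mul_smul, Matrix.trace_smul, norm_smul]
    exact mul_le_mul_of_nonneg_left (norm_trace_mul_le_of_norm_le_one hW A) (norm_nonneg _)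

theorem traceNorm_smul (z : ℂ) (A : Matrix n n ℂ) : traceNorm (z • A) = ‖z‖ * traceNorm A := by
  rcases eq_or_ne z 0 with rfl | hz
  · simp [traceNorm_zero]
  · refine le_antisymm (traceNorm_smul_le z A) ?_
    have h := traceNorm_smul_le z⁻¹ (z • A)
    rw [smul_smul, inv_mul_cancel₀ hz, one_smul, norm_inv] at h
    rwa [← le_inv_mul_iff₀ (norm_pos_iff.2 hz)]

theorem traceNorm_sum_le {ι : Type*} (s : Finset ι) (f : ι → Matrix n n ℂ) :
    traceNorm (∑ i ∈ s, f i) ≤ ∑ i ∈ s, traceNorm (f i) := by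
  classical
  induction s using Finset.induction_on with
  | empty => simp [traceNorm_zero]
  | insert a s ha ih =>
    rw [Finset.sum_insert ha, Finset.sum_insert ha]
    exact (traceNorm_add_le _ _).trans (by gcongr)

theorem traceNorm_neg (A : Matrix n n ℂ) : traceNorm (-A) = traceNorm A := by
  rw [← neg_one_smul ℂ A, traceNorm_smul]; simp

theorem traceNorm_sub_le (A B : Matrix n n ℂ) :
    traceNorm (A - B) ≤ traceNorm A + traceNorm B := by
  rw [sub_eq_add_neg]
  exact (traceNorm_add_le _ _).trans (by rw [traceNorm_neg])

theorem traceNorm_mul_le (B A : Matrix n n ℂ) : traceNorm (B * A) ≤ ‖B‖ * traceNorm A :=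
  traceNorm_le_of_forall fun W hW => by
    rw [← mul_assoc]
    refine (norm_trace_mul_le _ _).trans (mul_le_mul_of_nonneg_right ?_ (traceNorm_nonneg A))
    exact (norm_mul_le _ _).trans (mul_le_of_le_one_left (norm_nonneg _) hW)

theorem traceNorm_le_card_mul_norm (A : Matrix n n ℂ) : traceNorm A ≤ Fintype.card n * ‖A‖ :=
  traceNorm_le_of_forall fun W hW => (norm_trace_le _).trans (by
    gcongr
    exact (norm_mul_le _ _).trans (mul_le_of_le_one_left (norm_nonneg _) hW))

theorem traceNorm_of_posSemidef {A : Matrix n n ℂ} (hA : A.PosSemidef) :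
    traceNorm A = A.trace.re := by
  rw [traceNorm]
  congr 2
  rw [hA.1.eq]
  conv_lhs => rw [show A * A = cfc (fun x : ℝ => x * x) A by
    rw [← self_mul_cfc hA.1, cfc_id' ℝ A hA.1.isSelfAdjoint]]
  rw [← cfc_comp' Real.sqrt (fun x : ℝ => x * x) A
    ((A.finite_real_spectrum.image _).continuousOn _) (continuousOn_real_spectrum _ _) hA.1.isSelfAdjoint]
  conv_rhs => rw [← cfc_id' ℝ A hA.1.isSelfAdjoint]
  exact cfc_congr fun x hx => Real.sqrt_mul_self (spectrum_nonneg_of_posSemidef hA hx)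

theorem norm_le_traceNorm (A : Matrix n n ℂ) : ‖A‖ ≤ traceNorm A := by
  have hp := sqrt_cfc_posSemidef A
  obtain ⟨W, hW, -, hA⟩ := exists_polar A
  have h1 : ‖A‖ ≤ ‖cfc Real.sqrt (Aᴴ * A)‖ := by
    conv_lhs => rw [hA]
    refine (norm_mul_le _ _).trans (mul_le_of_le_one_left (norm_nonneg _) ?_)
    rwa [Matrix.l2_opNorm_conjTranspose]
  refine h1.trans ?_
  obtain ⟨V, a, hV, hV', hH, ha, -⟩ := exists_realDiag hp.1
  replace ha : ∀ i, 0 ≤ a i := fun i => spectrum_nonneg_of_posSemidef hp (ha i)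
  have htr : traceNorm A = ∑ i, a i := by
    have h := trace_sqrt_eq A
    rw [hH, Matrix.trace_mul_cycle, hV, one_mul] at h
    have h2 : ((∑ i, a i : ℝ) : ℂ) = traceNorm A := by
      rw [← h]; simp [realDiag, Matrix.trace]
    exact_mod_cast h2.symm
  rw [hH, htr]
  refine (norm_conj_unitary_le hV _).trans ?_
  rw [realDiag, Matrix.l2_opNorm_diagonal, pi_norm_le_iff_of_nonneg (Finset.sum_nonneg fun i _ => ha i)]
  intro i
  rw [Complex.norm_real, Real.norm_of_nonneg (ha i)]
  exact Finset.single_le_sum (fun i _ => ha i) (Finset.mem_univ i)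

theorem traceNorm_eq_zero_iff {A : Matrix n n ℂ} : traceNorm A = 0 ↔ A = 0 := by
  refine ⟨fun h => ?_, fun h => by rw [h, traceNorm_zero]⟩
  have := norm_le_traceNorm A
  rw [h] at this
  exact norm_le_zero_iff.1 this

theorem norm_le_one_of_isState {ρ : Matrix n n ℂ} (hρ : IsState ρ) : ‖ρ‖ ≤ 1 := by
  have h := norm_le_traceNorm ρ
  rwa [traceNorm_of_posSemidef hρ.1, hρ.2, Complex.one_re] at h

theorem traceNorm_of_isState {ρ : Matrix n n ℂ} (hρ : IsState ρ) : traceNorm ρ = 1 := by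
  rw [traceNorm_of_posSemidef hρ.1, hρ.2, Complex.one_re]

end TraceNorm

/-! ### Integral formula for the scalar kernel of the relative entropy -/

section EntropyKernel

open MeasureTheory Filter Topology

/-- The kernel `(a (log a - log b) - (a - b)) / (a - b)²`, extended to the diagonal by
continuity. -/
def entropyKernel (a b : ℝ) : ℝ :=
  if a = b then 1 / (2 * a) else (a * (Real.log a - Real.log b) - (a - b)) / (a - b) ^ 2

theorem tendsto_inv_const_add_atTop (a : ℝ) :
    Tendsto (fun t : ℝ => (a + t)⁻¹) atTop (𝓝 0) :=
  tendsto_inv_atTop_zero.comp (tendsto_atTop_add_const_left _ a tendsto_id)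

theorem hasDerivAt_inv_const_add {a t : ℝ} (h : a + t ≠ 0) :
    HasDerivAt (fun t : ℝ => (a + t)⁻¹) (-((a + t) ^ 2)⁻¹) t :=
  (((hasDerivAt_id t).const_add a).inv h).congr_deriv (by simp [neg_div])

theorem integral_inv_sq_const_add {a : ℝ} (ha : 0 < a) :
    IntegrableOn (fun t : ℝ => ((a + t) ^ 2)⁻¹) (Ioi 0) ∧
      ∫ t in Ioi (0 : ℝ), ((a + t) ^ 2)⁻¹ = a⁻¹ := by
  have hd : ∀ t ∈ Ici (0 : ℝ),
      HasDerivAt (fun t : ℝ => -(a + t)⁻¹) (((a + t) ^ 2)⁻¹) t := by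
    intro t ht
    have h0 : a + t ≠ 0 := by have : (0 : ℝ) ≤ t := ht; positivity
    exact (hasDerivAt_inv_const_add h0).neg.congr_deriv (neg_neg _)
  have hl : Tendsto (fun t : ℝ => -(a + t)⁻¹) atTop (𝓝 0) := by
    simpa using (tendsto_inv_const_add_atTop a).neg
  have hp : ∀ t ∈ Ioi (0 : ℝ), 0 ≤ ((a + t) ^ 2)⁻¹ := fun t _ => by positivity
  refine ⟨integrableOn_Ioi_deriv_of_nonneg' hd hp hl, ?_⟩
  rw [integral_Ioi_of_hasDerivAt_of_nonneg' hd hp hl]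
  simp

theorem integral_inv_cube_const_add {a : ℝ} (ha : 0 < a) :
    IntegrableOn (fun t : ℝ => ((a + t) ^ 3)⁻¹) (Ioi 0) ∧
      ∫ t in Ioi (0 : ℝ), ((a + t) ^ 3)⁻¹ = (2 * a ^ 2)⁻¹ := by
  have hd : ∀ t ∈ Ici (0 : ℝ),
      HasDerivAt (fun t : ℝ => -(1 / 2 * ((a + t)⁻¹) ^ 2)) (((a + t) ^ 3)⁻¹) t := by
    intro t ht
    have h0 : a + t ≠ 0 := by have : (0 : ℝ) ≤ t := ht; positivity
    refine (((hasDerivAt_inv_const_add h0).pow 2).const_mul (1 / 2)).neg.congr_deriv ?_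
    field_simp
    norm_num
    rw [mul_assoc, mul_inv_cancel₀ h0, mul_one]
  have hl : Tendsto (fun t : ℝ => -(1 / 2 * ((a + t)⁻¹) ^ 2)) atTop (𝓝 0) := by
    simpa using (((tendsto_inv_const_add_atTop a).pow 2).const_mul (1 / 2 : ℝ)).neg
  have hp : ∀ t ∈ Ioi (0 : ℝ), 0 ≤ ((a + t) ^ 3)⁻¹ := fun t ht => by
    have : (0 : ℝ) < t := ht
    positivity
  refine ⟨integrableOn_Ioi_deriv_of_nonneg' hd hp hl, ?_⟩
  rw [integral_Ioi_of_hasDerivAt_of_nonneg' hd hp hl]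
  simp only [add_zero, inv_pow, mul_inv]
  ring

theorem integral_entropyKernel {a b : ℝ} (ha : 0 < a) (hb : 0 < b) :
    IntegrableOn (fun t : ℝ => a / (a + t) ^ 2 * (b + t)⁻¹) (Ioi 0) ∧
      ∫ t in Ioi (0 : ℝ), a / (a + t) ^ 2 * (b + t)⁻¹ = entropyKernel a b := by
  rcases eq_or_ne a b with rfl | hab
  · have h := integral_inv_cube_const_add ha
    have he : (fun t : ℝ => a / (a + t) ^ 2 * (a + t)⁻¹) = fun t => a * ((a + t) ^ 3)⁻¹ := by
      ext t
      rw [div_eq_mul_inv, mul_assoc, ← mul_inv, ← pow_succ]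
    rw [he]
    refine ⟨h.1.const_mul a, ?_⟩
    rw [integral_const_mul, h.2, entropyKernel, if_pos rfl]
    field_simp
  · have hba : b - a ≠ 0 := sub_ne_zero.2 hab.symm
    -- Antiderivative from partial fractions in t. Writing the logarithm as that of the quotient
    -- (a+t)/(b+t) makes it vanish at infinity.
    have hd : ∀ t ∈ Ici (0 : ℝ),
        HasDerivAt (fun t : ℝ => a * (-((b - a)⁻¹ * (a + t)⁻¹) -
          ((b - a) ^ 2)⁻¹ * (Real.log ((a + t) * (b + t)⁻¹))))
          (a / (a + t) ^ 2 * (b + t)⁻¹) t := by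
      intro t ht
      have ht' : (0 : ℝ) ≤ t := ht
      have h0 : a + t ≠ 0 := by positivity
      have h1 : b + t ≠ 0 := by positivity
      have h2 : HasDerivAt (fun t : ℝ => (a + t) * (b + t)⁻¹)
          (1 * (b + t)⁻¹ + (a + t) * -((b + t) ^ 2)⁻¹) t :=
        ((hasDerivAt_id t).const_add a).mul (hasDerivAt_inv_const_add h1)
      refine ((((hasDerivAt_inv_const_add h0).const_mul (b - a)⁻¹).neg.sub
        ((h2.log (by positivity)).const_mul ((b - a) ^ 2)⁻¹)).const_mul a).congr_deriv ?_
      field_simp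
      ring
    have hq : Tendsto (fun t : ℝ => (a + t) * (b + t)⁻¹) atTop (𝓝 1) := by
      have h := (((tendsto_inv_const_add_atTop b).const_mul (a - b)).const_add 1)
      rw [mul_zero, add_zero] at h
      refine h.congr' ?_
      filter_upwards [eventually_gt_atTop 0] with t ht
      have h1 : b + t ≠ 0 := by positivity
      field_simp
      ring
    have hl : Tendsto (fun t : ℝ => a * (-((b - a)⁻¹ * (a + t)⁻¹) -
          ((b - a) ^ 2)⁻¹ * (Real.log ((a + t) * (b + t)⁻¹)))) atTop (𝓝 0) := by
      have h1 := ((tendsto_inv_const_add_atTop a).const_mul (b - a)⁻¹).neg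
      have h2 := (hq.log one_ne_zero).const_mul ((b - a) ^ 2)⁻¹
      simpa using (h1.sub h2).const_mul a
    have hp : ∀ t ∈ Ioi (0 : ℝ), 0 ≤ a / (a + t) ^ 2 * (b + t)⁻¹ := fun t ht => by
      have : (0 : ℝ) < t := ht
      positivity
    refine ⟨integrableOn_Ioi_deriv_of_nonneg' hd hp hl, ?_⟩
    rw [integral_Ioi_of_hasDerivAt_of_nonneg' hd hp hl, entropyKernel, if_neg hab]
    simp only [add_zero]
    rw [← div_eq_mul_inv a b, Real.log_div ha.ne' hb.ne']
    have hab' : a - b ≠ 0 := sub_ne_zero.2 hab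
    rw [show (a - b) ^ 2 = (b - a) ^ 2 by ring]
    field_simp
    ring

/-- This form needs no case split, since both sides vanish on the diagonal. -/
theorem entropyKernel_mul_sq (a b : ℝ) :
    entropyKernel a b * (a - b) ^ 2 = a * (Real.log a - Real.log b) - (a - b) := by
  rw [entropyKernel]
  split_ifs with h
  · simp [h]
  · exact div_mul_cancel₀ _ (pow_ne_zero 2 (sub_ne_zero.2 h))

/-- The rational parts cancel under symmetrization, leaving the logarithmic difference quotient in
the off-diagonal terms of F_η. -/
theorem entropyKernel_add_swap {a b : ℝ} (h : a ≠ b) :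
    entropyKernel a b + entropyKernel b a = (Real.log a - Real.log b) / (a - b) := by
  have h1 : a - b ≠ 0 := sub_ne_zero.2 h
  rw [entropyKernel, entropyKernel, if_neg h, if_neg h.symm,
    show (b - a) ^ 2 = (a - b) ^ 2 by ring]
  field_simp
  ring

end EntropyKernel

/-! ### Resolvent representations of the relative entropy and of F_η -/

section SpectralSums

open MeasureTheory

variable {n : Type*} [Fintype n] [DecidableEq n]

theorem trace_realDiag_form (V W X : Matrix n n ℂ) (f g : n → ℝ) :
    ((V * realDiag f * Vᴴ) * X * (W * realDiag g * Wᴴ) * Xᴴ).trace =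
      ((∑ i, ∑ j, f i * g j * ‖(Vᴴ * X * W) i j‖ ^ 2 : ℝ) : ℂ) := by
  have h1 : ((V * realDiag f * Vᴴ) * X * (W * realDiag g * Wᴴ) * Xᴴ).trace =
      (realDiag f * (Vᴴ * X * W) * realDiag g * (Vᴴ * X * W)ᴴ).trace := by
    simp only [Matrix.conjTranspose_mul, Matrix.conjTranspose_conjTranspose]
    rw [show V * realDiag f * Vᴴ * X * (W * realDiag g * Wᴴ) * Xᴴ =
      V * (realDiag f * Vᴴ * X * (W * realDiag g * Wᴴ) * Xᴴ) by simp only [mul_assoc],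
      Matrix.trace_mul_comm]
    simp only [mul_assoc]
  rw [h1, Matrix.trace]
  push_cast
  refine Finset.sum_congr rfl fun i _ => ?_
  rw [Matrix.diag_apply, Matrix.mul_apply]
  refine Finset.sum_congr rfl fun j _ => ?_
  rw [realDiag, realDiag, Matrix.mul_diagonal, Matrix.diagonal_mul, Matrix.conjTranspose_apply,
    ← Complex.mul_conj']
  simp only [RCLike.star_def]
  ring

/-- The integrand of the resolvent representation of the relative entropy. -/
def resolventForm (A B X : Matrix n n ℂ) (t : ℝ) : ℂ :=
  (cfc (fun x : ℝ => x / (x + t) ^ 2) A * X * cfc (fun x : ℝ => (x + t)⁻¹) B * Xᴴ).trace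

/-- In eigenbases of the two matrices the integrand is a finite double sum, and the scalar integral
applies to each term. -/
theorem integral_resolventForm {V W : Matrix n n ℂ} (hV : Vᴴ * V = 1) (hW : Wᴴ * W = 1)
    {a b : n → ℝ} (ha : ∀ i, 0 < a i) (hb : ∀ i, 0 < b i) (X : Matrix n n ℂ) :
    IntegrableOn (resolventForm (V * realDiag a * Vᴴ) (W * realDiag b * Wᴴ) X) (Ioi 0) ∧
      ∫ t in Ioi (0 : ℝ), resolventForm (V * realDiag a * Vᴴ) (W * realDiag b * Wᴴ) X t =
        ((∑ i, ∑ j, entropyKernel (a i) (b j) * ‖(Vᴴ * X * W) i j‖ ^ 2 : ℝ) : ℂ) := by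
  have h : ∀ t, resolventForm (V * realDiag a * Vᴴ) (W * realDiag b * Wᴴ) X t =
      ((∑ i, ∑ j, (a i / (a i + t) ^ 2 * (b j + t)⁻¹) * ‖(Vᴴ * X * W) i j‖ ^ 2 : ℝ) : ℂ) := by
    intro t
    rw [resolventForm, cfc_conj_realDiag hV, cfc_conj_realDiag hW, trace_realDiag_form]
  have hi : ∀ i j, IntegrableOn
      (fun t => (a i / (a i + t) ^ 2 * (b j + t)⁻¹) * ‖(Vᴴ * X * W) i j‖ ^ 2) (Ioi 0) :=
    fun i j => (integral_entropyKernel (ha i) (hb j)).1.mul_const _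
  have hi' : ∀ i, IntegrableOn
      (fun t => ∑ j, (a i / (a i + t) ^ 2 * (b j + t)⁻¹) * ‖(Vᴴ * X * W) i j‖ ^ 2) (Ioi 0) :=
    fun i => integrable_finsetSum _ fun j _ => hi i j
  simp only [funext h]
  refine ⟨(integrable_finsetSum _ fun i _ => hi' i).ofReal, ?_⟩
  rw [integral_complex_ofReal, integral_finsetSum _ fun i _ => hi' i]
  congr 1
  refine Finset.sum_congr rfl fun i _ => ?_
  rw [integral_finsetSum _ fun j _ => hi i j]
  refine Finset.sum_congr rfl fun j _ => ?_
  rw [integral_mul_const, (integral_entropyKernel (ha i) (hb j)).2]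

theorem spectrum_pos_of_posDef {M : Matrix n n ℂ} (hM : M.PosDef) {x : ℝ}
    (hx : x ∈ spectrum ℝ M) : 0 < x := by
  rw [hM.1.spectrum_real_eq_range_eigenvalues] at hx
  obtain ⟨i, rfl⟩ := hx
  exact hM.eigenvalues_pos i

theorem integrable_resolventForm {A B : Matrix n n ℂ} (hA : A.PosDef) (hB : B.PosDef)
    (X : Matrix n n ℂ) : IntegrableOn (resolventForm A B X) (Ioi 0) := by
  obtain ⟨V, a, hV, -, hAV, ha, -⟩ := exists_realDiag hA.1
  obtain ⟨W, b, hW, -, hBW, hb, -⟩ := exists_realDiag hB.1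
  rw [hAV, hBW]
  exact (integral_resolventForm hV hW (fun i => spectrum_pos_of_posDef hA (ha i))
    (fun i => spectrum_pos_of_posDef hB (hb i)) X).1

/-- Resolvent representation of the relative entropy. -/
theorem relEntropy_eq_integral {A B : Matrix n n ℂ} (hA : A.PosDef) (hB : B.PosDef)
    (htr : A.trace = B.trace) :
    (relEntropy A B : ℂ) = ∫ t in Ioi (0 : ℝ), resolventForm A B (A - B) t := by
  obtain ⟨V, a, hV, hV', hAV, ha, hfa⟩ := exists_realDiag hA.1
  obtain ⟨W, b, hW, hW', hBW, hb, hfb⟩ := exists_realDiag hB.1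
  -- Between eigenvectors of A and B, the matrix element of A − B is (a − b) times the overlap; its
  -- square cancels the denominator of the kernel.
  have hN : ∀ i j, (Vᴴ * (A - B) * W) i j = ((a i - b j : ℝ) : ℂ) * (Vᴴ * (1 : Matrix n n ℂ) * W) i j := by
    intro i j
    have h1 : Vᴴ * (A - B) * W = realDiag a * (Vᴴ * W) - (Vᴴ * W) * realDiag b := by
      rw [hAV, hBW]
      calc _ = (Vᴴ * V) * realDiag a * (Vᴴ * W) - (Vᴴ * W) * realDiag b * (Wᴴ * W) := by
            simp only [mul_sub, sub_mul, mul_assoc]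
        _ = _ := by rw [hV, hW, one_mul, mul_one]
    rw [h1, mul_one, Matrix.sub_apply, realDiag, realDiag, Matrix.diagonal_mul,
      Matrix.mul_diagonal]
    push_cast
    ring
  have hform : ∀ f g : ℝ → ℝ, (cfc f A * cfc g B).trace =
      ((∑ i, ∑ j, f (a i) * g (b j) * ‖(Vᴴ * (1 : Matrix n n ℂ) * W) i j‖ ^ 2 : ℝ) : ℂ) := by
    intro f g
    rw [hfa, hfb, ← trace_realDiag_form, mul_one, Matrix.conjTranspose_one, mul_one]
  have hA1 : cfc (fun x : ℝ => x) A = A := cfc_id' ℝ A hA.1.isSelfAdjoint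
  have hB1 : cfc (fun x : ℝ => x) B = B := cfc_id' ℝ B hB.1.isSelfAdjoint
  have hAone : cfc (fun _ : ℝ => (1 : ℝ)) A = 1 := cfc_const_one ℝ A hA.1.isSelfAdjoint
  have hBone : cfc (fun _ : ℝ => (1 : ℝ)) B = 1 := cfc_const_one ℝ B hB.1.isSelfAdjoint
  have e1 := hform (fun x => x * Real.log x) (fun _ => 1)
  have e2 := hform (fun x => x) Real.log
  have e3 := hform (fun x => x) (fun _ => 1)
  have e4 := hform (fun _ => 1) (fun x => x)
  rw [hBone, mul_one, ← self_mul_cfc hA.1] at e1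
  rw [hA1] at e2
  rw [hA1, hBone, mul_one] at e3
  rw [hB1, hAone, one_mul] at e4
  rw [e3, e4] at htr
  replace htr := Complex.ofReal_injective htr
  have hint := (integral_resolventForm hV hW (fun i => spectrum_pos_of_posDef hA (ha i))
    (fun i => spectrum_pos_of_posDef hB (hb i)) (A - B)).2
  rw [← hAV, ← hBW] at hint
  rw [hint, relEntropy, mul_sub, Matrix.trace_sub, e1, e2, ← Complex.ofReal_sub,
    Complex.ofReal_re]
  congr 1
  -- The kernel produces the entropy plus the linear term −(a − b), whose total is Tr B − Tr A = 0.
  have hkey : ∀ i j, entropyKernel (a i) (b j) * ‖(Vᴴ * (A - B) * W) i j‖ ^ 2 =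
      a i * Real.log (a i) * 1 * ‖(Vᴴ * (1 : Matrix n n ℂ) * W) i j‖ ^ 2 -
      a i * Real.log (b j) * ‖(Vᴴ * (1 : Matrix n n ℂ) * W) i j‖ ^ 2 -
      (a i * 1 * ‖(Vᴴ * (1 : Matrix n n ℂ) * W) i j‖ ^ 2 - 1 * b j * ‖(Vᴴ * (1 : Matrix n n ℂ) * W) i j‖ ^ 2) := by
    intro i j
    rw [hN, norm_mul, Complex.norm_real, mul_pow, Real.norm_eq_abs, sq_abs, ← mul_assoc,
      entropyKernel_mul_sq]
    ring
  simp only [hkey, Finset.sum_sub_distrib]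
  rw [htr]
  ring

/-- Resolvent representation of the quadratic form `F_η`. -/
theorem entropyForm_eq_integral {η Y : Matrix n n ℂ} (hη : η.PosDef) (hY : Y.IsHermitian) :
    entropyForm η Y = ∫ t in Ioi (0 : ℝ), resolventForm η η Y t := by
  obtain ⟨V, a, hV, hV', hηV, ha, hfa⟩ := exists_realDiag hη.1
  have hint := (integral_resolventForm hV hV (fun i => spectrum_pos_of_posDef hη (ha i))
    (fun i => spectrum_pos_of_posDef hη (ha i)) Y).2
  rw [← hηV] at hint
  rw [hint]
  set N := fun i j => ‖(Vᴴ * Y * V) i j‖ ^ 2 with hN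
  have hNs : ∀ i j, N i j = N j i := by
    intro i j
    have h : (Vᴴ * Y * V)ᴴ = Vᴴ * Y * V := by
      simp only [Matrix.conjTranspose_mul, Matrix.conjTranspose_conjTranspose, hY.eq, mul_assoc]
    simp only [hN]
    conv_lhs => rw [← h, Matrix.conjTranspose_apply, norm_star]
  have hmem : ∀ i, a i ∈ eigs η := fun i => by
    rw [eigs, Set.Finite.mem_toFinset]
    exact ha i
  have htr : ∀ μ ν, (Y * eigProj η ν * Y * eigProj η μ).trace =
      ((∑ i, ∑ j, (if a i = μ then 1 else 0) * (if a j = ν then 1 else 0) * N i j : ℝ) : ℂ) := by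
    intro μ ν
    rw [eigProj, eigProj, hfa, hfa, ← trace_realDiag_form, hY.eq, Matrix.trace_mul_comm]
    simp only [mul_assoc]
  have hF : entropyForm η Y = ((∑ i, ∑ j, ((if a i = a j then 1 / (2 * a i) else 0) +
      (if a i < a j then (Real.log (a i) - Real.log (a j)) / (a i - a j) else 0)) * N i j : ℝ)
        : ℂ) := by
    rw [entropyForm, entropyForm₂]
    simp only [htr]
    simp only [← Complex.ofReal_mul, ← Complex.ofReal_sum, ← Complex.ofReal_add]
    congr 1
    have h1 : ∑ μ ∈ eigs η, (∑ i, ∑ j, (if a i = μ then (1 : ℝ) else 0) *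
        (if a j = μ then 1 else 0) * N i j) * (1 / (2 * μ)) =
        ∑ i, ∑ j, (if a i = a j then 1 / (2 * a i) else 0) * N i j := by
      simp only [Finset.sum_mul]
      rw [Finset.sum_comm]
      refine Finset.sum_congr rfl fun i _ => ?_
      rw [Finset.sum_comm]
      refine Finset.sum_congr rfl fun j _ => ?_
      rw [Finset.sum_eq_single (a i)]
      · by_cases h : a i = a j
        · simp [h, mul_comm]
        · simp [h, Ne.symm h]
      · intro μ _ hμ
        simp [hμ.symm]
      · exact fun h => absurd (hmem i) h
    have h2 : ∑ μ ∈ eigs η, ∑ ν ∈ eigs η with μ < ν,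
        (∑ i, ∑ j, (if a i = μ then (1 : ℝ) else 0) * (if a j = ν then 1 else 0) * N i j) *
          ((Real.log μ - Real.log ν) / (μ - ν)) =
        ∑ i, ∑ j, (if a i < a j then (Real.log (a i) - Real.log (a j)) / (a i - a j) else 0) *
          N i j := by
      simp only [Finset.sum_mul, Finset.sum_filter]
      have : ∀ μ ν : ℝ, (if μ < ν then ∑ i, ∑ j, (if a i = μ then (1 : ℝ) else 0) *
          (if a j = ν then 1 else 0) * N i j * ((Real.log μ - Real.log ν) / (μ - ν)) else 0) =
          ∑ i, ∑ j, (if μ < ν then (if a i = μ then (1 : ℝ) else 0) *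
          (if a j = ν then 1 else 0) * N i j * ((Real.log μ - Real.log ν) / (μ - ν)) else 0) := by
        intro μ ν
        split_ifs with h <;> simp
      simp only [this]
      have hswap : ∀ G : ℝ → ℝ → n → n → ℝ, ∑ μ ∈ eigs η, ∑ ν ∈ eigs η, ∑ i, ∑ j, G μ ν i j =
          ∑ i, ∑ j, ∑ μ ∈ eigs η, ∑ ν ∈ eigs η, G μ ν i j := by
        intro G
        calc _ = ∑ μ ∈ eigs η, ∑ i, ∑ ν ∈ eigs η, ∑ j, G μ ν i j :=
              Finset.sum_congr rfl fun μ _ => Finset.sum_comm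
          _ = ∑ i, ∑ μ ∈ eigs η, ∑ ν ∈ eigs η, ∑ j, G μ ν i j := Finset.sum_comm
          _ = ∑ i, ∑ μ ∈ eigs η, ∑ j, ∑ ν ∈ eigs η, G μ ν i j :=
              Finset.sum_congr rfl fun i _ => Finset.sum_congr rfl fun μ _ => Finset.sum_comm
          _ = _ := Finset.sum_congr rfl fun i _ => Finset.sum_comm
      rw [hswap]
      refine Finset.sum_congr rfl fun i _ => Finset.sum_congr rfl fun j _ => ?_
      rw [Finset.sum_eq_single (a i), Finset.sum_eq_single (a j)]
      · by_cases h : a i < a j <;> simp [h, mul_comm]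
      · intro ν _ hν
        simp [hν.symm]
      · exact fun h => absurd (hmem j) h
      · intro μ _ hμ
        simp [hμ.symm]
      · exact fun h => absurd (hmem i) h
    rw [h1, h2, ← Finset.sum_add_distrib]
    refine Finset.sum_congr rfl fun i _ => ?_
    rw [← Finset.sum_add_distrib]
    refine Finset.sum_congr rfl fun j _ => ?_
    rw [add_mul]
  rw [hF]
  congr 1
  -- The weights N are symmetric because Y is Hermitian, so only the symmetrization of a kernel
  -- matters. F_η sums over ordered pairs, while the resolvent kernel is not symmetric.
  have hsym : ∀ k : ℝ → ℝ → ℝ, ∑ i, ∑ j, k (a i) (a j) * N i j =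
      ∑ i, ∑ j, (1 / 2 * (k (a i) (a j) + k (a j) (a i))) * N i j := by
    intro k
    have h1 : ∑ i, ∑ j, k (a i) (a j) * N i j = ∑ i, ∑ j, k (a j) (a i) * N i j := by
      rw [Finset.sum_comm]
      exact Finset.sum_congr rfl fun i _ => Finset.sum_congr rfl fun j _ => by rw [hNs]
    have h2 : ∑ i, ∑ j, (1 / 2 * (k (a i) (a j) + k (a j) (a i))) * N i j =
        1 / 2 * (∑ i, ∑ j, k (a i) (a j) * N i j + ∑ i, ∑ j, k (a j) (a i) * N i j) := by
      simp only [← Finset.sum_add_distrib, Finset.mul_sum]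
      exact Finset.sum_congr rfl fun i _ => Finset.sum_congr rfl fun j _ => by ring
    rw [h2, ← h1]
    ring
  rw [hsym (fun x y => (if x = y then 1 / (2 * x) else 0) +
    if x < y then (Real.log x - Real.log y) / (x - y) else 0), hsym entropyKernel]
  refine Finset.sum_congr rfl fun i _ => Finset.sum_congr rfl fun j _ => ?_
  congr 2
  rcases lt_trichotomy (a i) (a j) with h | h | h
  · rw [entropyKernel_add_swap h.ne]
    simp [h, h.ne, h.ne', h.not_gt]
  · rw [h]
    simp [entropyKernel]
  · rw [add_comm (entropyKernel _ _), entropyKernel_add_swap h.ne]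
    simp [h, h.ne, h.ne', h.not_gt]

end SpectralSums

/-! ### Cubic error bound and lower bounds on spectra -/

section EntropyExpansion

open MeasureTheory

variable {n : Type*} [Fintype n] [DecidableEq n]

theorem cfc_resolvent_mul {A : Matrix n n ℂ} (hA : A.IsHermitian) {t : ℝ}
    (h : ∀ x ∈ spectrum ℝ A, x + t ≠ 0) :
    cfc (fun x : ℝ => (x + t)⁻¹) A * (A + (t : ℂ) • 1) = 1 ∧
      (A + (t : ℂ) • 1) * cfc (fun x : ℝ => (x + t)⁻¹) A = 1 := by
  have h1 : cfc (fun x : ℝ => x + t) A = A + (t : ℂ) • 1 := by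
    rw [cfc_add_const t (fun x => x) A (continuousOn_real_spectrum _ _) hA.isSelfAdjoint,
      cfc_id' ℝ A hA.isSelfAdjoint, Algebra.algebraMap_eq_smul_one]
    rfl
  have hone : cfc (fun _ : ℝ => (1 : ℝ)) A = 1 := cfc_const_one ℝ A hA.isSelfAdjoint
  rw [← h1, cfc_mul_cfc, cfc_mul_cfc, ← hone]
  exact ⟨cfc_congr fun x hx => inv_mul_cancel₀ (h x hx),
    cfc_congr fun x hx => mul_inv_cancel₀ (h x hx)⟩

theorem norm_cfc_resolvent_le {A : Matrix n n ℂ} {m t : ℝ} (hm : 0 < m) (ht : 0 ≤ t)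
    (h : ∀ x ∈ spectrum ℝ A, m ≤ x) : ‖cfc (fun x : ℝ => (x + t)⁻¹) A‖ ≤ (m + t)⁻¹ := by
  refine norm_cfc_matrix_le (by positivity) fun x hx => ?_
  have hx' := h x hx
  rw [abs_of_nonneg (inv_nonneg.2 (by linarith))]
  gcongr

theorem norm_cfc_resolvent_sub_le {A B : Matrix n n ℂ} (hA : A.IsHermitian) (hB : B.IsHermitian)
    {m t : ℝ} (hm : 0 < m) (ht : 0 ≤ t) (hAm : ∀ x ∈ spectrum ℝ A, m ≤ x)
    (hBm : ∀ x ∈ spectrum ℝ B, m ≤ x) :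
    ‖cfc (fun x : ℝ => (x + t)⁻¹) A - cfc (fun x : ℝ => (x + t)⁻¹) B‖ ≤
      ‖A - B‖ * ((m + t) ^ 2)⁻¹ := by
  have hA1 := (cfc_resolvent_mul hA (t := t) fun x hx => by linarith [hAm x hx]).1
  have hB1 := (cfc_resolvent_mul hB (t := t) fun x hx => by linarith [hBm x hx]).2
  have hA2 := norm_cfc_resolvent_le hm ht hAm
  have hB2 := norm_cfc_resolvent_le hm ht hBm
  set R := cfc (fun x : ℝ => (x + t)⁻¹) A
  set R' := cfc (fun x : ℝ => (x + t)⁻¹) B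
  -- Second resolvent identity.
  have hid : R - R' = -(R * (A - B) * R') := by
    have : R * (A - B) * R' = (R * (A + (t : ℂ) • 1)) * R' - R * ((B + (t : ℂ) • 1) * R') := by
      simp only [mul_add, add_mul, mul_sub, sub_mul, mul_assoc]
      abel
    rw [this, hA1, hB1, one_mul, mul_one, neg_sub]
  rw [hid, norm_neg]
  calc ‖R * (A - B) * R'‖ ≤ ‖R‖ * ‖A - B‖ * ‖R'‖ :=
        (norm_mul_le _ _).trans (by gcongr; exact norm_mul_le _ _)
    _ ≤ (m + t)⁻¹ * ‖A - B‖ * (m + t)⁻¹ := by gcongr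
    _ = _ := by rw [pow_two, mul_inv]; ring

theorem norm_cfc_div_sq_le {A : Matrix n n ℂ} {m t : ℝ} (hm : 0 < m) (ht : 0 ≤ t)
    (h : ∀ x ∈ spectrum ℝ A, m ≤ x) : ‖cfc (fun x : ℝ => x / (x + t) ^ 2) A‖ ≤ (m + t)⁻¹ := by
  refine norm_cfc_matrix_le (by positivity) fun x hx => ?_
  have hx' := h x hx
  have hx0 : 0 < x := by linarith
  rw [abs_of_nonneg (by positivity)]
  calc x / (x + t) ^ 2 ≤ (x + t) / (x + t) ^ 2 := by gcongr; linarith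
    _ = (x + t)⁻¹ := by field_simp
    _ ≤ (m + t)⁻¹ := by gcongr

theorem norm_cfc_div_sq_sub_le {A B : Matrix n n ℂ} (hA : A.IsHermitian) (hB : B.IsHermitian)
    {m t : ℝ} (hm : 0 < m) (ht : 0 ≤ t) (hAm : ∀ x ∈ spectrum ℝ A, m ≤ x)
    (hBm : ∀ x ∈ spectrum ℝ B, m ≤ x) :
    ‖cfc (fun x : ℝ => x / (x + t) ^ 2) A - cfc (fun x : ℝ => x / (x + t) ^ 2) B‖ ≤
      3 * ‖A - B‖ * ((m + t) ^ 2)⁻¹ := by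
  -- The identity x/(x+t)² = (x+t)⁻¹ − t(x+t)⁻² reduces everything to the resolvent; the factor t is
  -- then paid for by t(m+t)⁻¹ ≤ 1, which yields the constant 1 + 2 = 3.
  have hf : ∀ {M : Matrix n n ℂ}, M.IsHermitian → (∀ x ∈ spectrum ℝ M, m ≤ x) →
      cfc (fun x : ℝ => x / (x + t) ^ 2) M = cfc (fun x : ℝ => (x + t)⁻¹) M -
        (t : ℂ) • (cfc (fun x : ℝ => (x + t)⁻¹) M * cfc (fun x : ℝ => (x + t)⁻¹) M) := by
    intro M hM hMm
    have hs : ∀ N : Matrix n n ℂ, (t : ℂ) • N = t • N := fun N => rfl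
    rw [cfc_mul_cfc, hs, ← cfc_smul t _ M (continuousOn_real_spectrum _ _),
      ← cfc_sub _ _ M (continuousOn_real_spectrum _ _) (continuousOn_real_spectrum _ _)]
    refine cfc_congr fun x hx => ?_
    have : x + t ≠ 0 := by linarith [hMm x hx]
    simp only [smul_eq_mul]
    field_simp
    ring
  have hA2 := norm_cfc_resolvent_le hm ht hAm
  have hB2 := norm_cfc_resolvent_le hm ht hBm
  have hAB := norm_cfc_resolvent_sub_le hA hB hm ht hAm hBm
  rw [hf hA hAm, hf hB hBm]
  set R := cfc (fun x : ℝ => (x + t)⁻¹) A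
  set R' := cfc (fun x : ℝ => (x + t)⁻¹) B
  have hid : R - (t : ℂ) • (R * R) - (R' - (t : ℂ) • (R' * R')) =
      (R - R') - (t : ℂ) • (R * (R - R') + (R - R') * R') := by
    rw [show R * (R - R') + (R - R') * R' = R * R - R' * R' by
      simp only [mul_sub, sub_mul]; abel, smul_sub]
    abel
  rw [hid]
  have hmt : 0 < m + t := by linarith
  have h2 : ‖R * (R - R') + (R - R') * R'‖ ≤ 2 * (m + t)⁻¹ * ‖R - R'‖ := by
    refine (norm_add_le _ _).trans ?_
    have h3 : ‖R * (R - R')‖ ≤ (m + t)⁻¹ * ‖R - R'‖ := (norm_mul_le _ _).trans (by gcongr)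
    have h4 : ‖(R - R') * R'‖ ≤ ‖R - R'‖ * (m + t)⁻¹ := (norm_mul_le _ _).trans (by gcongr)
    linarith
  have htm : t * (m + t)⁻¹ ≤ 1 := by
    rw [← div_eq_mul_inv, div_le_one hmt]; linarith
  calc ‖(R - R') - (t : ℂ) • (R * (R - R') + (R - R') * R')‖
      ≤ ‖R - R'‖ + ‖(t : ℂ) • (R * (R - R') + (R - R') * R')‖ := norm_sub_le _ _
    _ ≤ ‖R - R'‖ + t * (2 * (m + t)⁻¹ * ‖R - R'‖) := by
      rw [norm_smul, Complex.norm_real, Real.norm_of_nonneg ht]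
      gcongr
    _ = (1 + 2 * (t * (m + t)⁻¹)) * ‖R - R'‖ := by ring
    _ ≤ (1 + 2 * 1) * (‖A - B‖ * ((m + t) ^ 2)⁻¹) := by gcongr
    _ = _ := by ring

theorem norm_trace_four_mul_le (F X G Y : Matrix n n ℂ) :
    ‖(F * X * G * Y).trace‖ ≤ Fintype.card n * (‖F‖ * ‖X‖ * ‖G‖ * ‖Y‖) := by
  refine (norm_trace_le _).trans ?_
  gcongr
  exact (norm_mul_le _ _).trans (by
    gcongr
    exact (norm_mul_le _ _).trans (by gcongr; exact norm_mul_le _ _))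

theorem norm_resolventForm_le {η : Matrix n n ℂ} (Y : Matrix n n ℂ) {m t : ℝ} (hm : 0 < m)
    (ht : 0 ≤ t) (h : ∀ x ∈ spectrum ℝ η, m ≤ x) :
    ‖resolventForm η η Y t‖ ≤ Fintype.card n * ‖Y‖ ^ 2 * ((m + t) ^ 2)⁻¹ := by
  refine (norm_trace_four_mul_le _ _ _ _).trans ?_
  have h1 := norm_cfc_div_sq_le hm ht h
  have h2 := norm_cfc_resolvent_le hm ht h
  rw [Matrix.l2_opNorm_conjTranspose]
  calc _ ≤ Fintype.card n * ((m + t)⁻¹ * ‖Y‖ * (m + t)⁻¹ * ‖Y‖) := by gcongr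
    _ = _ := by rw [pow_two (m + t), mul_inv]; ring

/-- Exchanging one resolvent factor at a time costs an extra power of (m+t)⁻¹. The resulting decay
(m+t)⁻³ has integral 1/(2m²). -/
theorem norm_resolventForm_sub_le {A B η : Matrix n n ℂ} (hA : A.IsHermitian)
    (hB : B.IsHermitian) (hη : η.IsHermitian) (Y : Matrix n n ℂ) {m t : ℝ} (hm : 0 < m)
    (ht : 0 ≤ t) (hAm : ∀ x ∈ spectrum ℝ A, m ≤ x) (hBm : ∀ x ∈ spectrum ℝ B, m ≤ x)
    (hηm : ∀ x ∈ spectrum ℝ η, m ≤ x) :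
    ‖resolventForm A B Y t - resolventForm η η Y t‖ ≤
      Fintype.card n * ‖Y‖ ^ 2 * (3 * ‖A - η‖ + ‖B - η‖) * ((m + t) ^ 3)⁻¹ := by
  have h1 := norm_cfc_div_sq_sub_le hA hη hm ht hAm hηm
  have h2 := norm_cfc_resolvent_sub_le hB hη hm ht hBm hηm
  have h3 := norm_cfc_resolvent_le hm ht hBm
  have h4 := norm_cfc_div_sq_le hm ht hηm
  rw [resolventForm, resolventForm]
  set F := cfc (fun x : ℝ => x / (x + t) ^ 2) A
  set F' := cfc (fun x : ℝ => x / (x + t) ^ 2) η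
  set R := cfc (fun x : ℝ => (x + t)⁻¹) B
  set R' := cfc (fun x : ℝ => (x + t)⁻¹) η
  have hid : (F * Y * R * Yᴴ).trace - (F' * Y * R' * Yᴴ).trace =
      ((F - F') * Y * R * Yᴴ).trace + (F' * Y * (R - R') * Yᴴ).trace := by
    rw [← Matrix.trace_sub, ← Matrix.trace_add]
    congr 1
    simp only [mul_sub, sub_mul]
    abel
  rw [hid]
  refine (norm_add_le _ _).trans ((add_le_add (norm_trace_four_mul_le _ _ _ _)
    (norm_trace_four_mul_le _ _ _ _)).trans ?_)
  rw [Matrix.l2_opNorm_conjTranspose]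
  have hmt : 0 < m + t := by linarith
  calc _ ≤ Fintype.card n * (3 * ‖A - η‖ * ((m + t) ^ 2)⁻¹ * ‖Y‖ * (m + t)⁻¹ * ‖Y‖) +
      Fintype.card n * ((m + t)⁻¹ * ‖Y‖ * (‖B - η‖ * ((m + t) ^ 2)⁻¹) * ‖Y‖) := by gcongr
    _ = _ := by field_simp

/-- Second order expansion of the relative entropy around a positive definite matrix. -/
theorem norm_relEntropy_sub_entropyForm_le {A B η : Matrix n n ℂ} (hA : A.PosDef) (hB : B.PosDef)
    (hη : η.PosDef) (htr : A.trace = B.trace) {m : ℝ} (hm : 0 < m)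
    (hAm : ∀ x ∈ spectrum ℝ A, m ≤ x) (hBm : ∀ x ∈ spectrum ℝ B, m ≤ x)
    (hηm : ∀ x ∈ spectrum ℝ η, m ≤ x) :
    ‖(relEntropy A B : ℂ) - entropyForm η (A - B)‖ ≤
      Fintype.card n * ‖A - B‖ ^ 2 * (3 * ‖A - η‖ + ‖B - η‖) * (2 * m ^ 2)⁻¹ := by
  rw [relEntropy_eq_integral hA hB htr, entropyForm_eq_integral hη (hA.1.sub hB.1),
    ← integral_sub (integrable_resolventForm hA hB _) (integrable_resolventForm hη hη _)]
  have hi := integral_inv_cube_const_add hm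
  rw [← hi.2, ← integral_const_mul]
  refine norm_integral_le_of_norm_le (hi.1.const_mul _) ?_
  refine (ae_restrict_iff' measurableSet_Ioi).2 (Filter.Eventually.of_forall fun t ht => ?_)
  exact norm_resolventForm_sub_le hA.1 hB.1 hη.1 _ hm (le_of_lt ht) hAm hBm hηm

theorem norm_entropyForm_le {η Y : Matrix n n ℂ} (hη : η.PosDef) (hY : Y.IsHermitian) {m : ℝ}
    (hm : 0 < m) (hηm : ∀ x ∈ spectrum ℝ η, m ≤ x) :
    ‖entropyForm η Y‖ ≤ Fintype.card n * ‖Y‖ ^ 2 * m⁻¹ := by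
  rw [entropyForm_eq_integral hη hY]
  have hi := integral_inv_sq_const_add hm
  rw [← hi.2, ← integral_const_mul]
  refine norm_integral_le_of_norm_le (hi.1.const_mul _) ?_
  refine (ae_restrict_iff' measurableSet_Ioi).2 (Filter.Eventually.of_forall fun t ht => ?_)
  exact norm_resolventForm_le Y hm (le_of_lt ht) hηm

/-- For x < m, the inverse of η − x has norm at most 1/(2m − x), and the perturbation is at most m <
2m − x. A Neumann series then shows that A − x is invertible. -/
theorem le_spectrum_of_norm_sub_le {A η : Matrix n n ℂ} (hη : η.IsHermitian) {m : ℝ}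
    (hηm : ∀ x ∈ spectrum ℝ η, 2 * m ≤ x) (h : ‖A - η‖ ≤ m) :
    ∀ x ∈ spectrum ℝ A, m ≤ x := by
  intro x hx
  by_contra! hlt
  refine hx ?_
  have hm0 : 0 ≤ m := (norm_nonneg _).trans h
  have h1 := cfc_resolvent_mul hη (t := -x) fun y hy => by linarith [hηm y hy]
  have h2 : ‖cfc (fun y : ℝ => (y + -x)⁻¹) η‖ ≤ (2 * m - x)⁻¹ := by
    refine norm_cfc_matrix_le (inv_nonneg.2 (by linarith)) fun y hy => ?_
    have := hηm y hy
    rw [abs_of_nonneg (inv_nonneg.2 (by linarith))]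
    exact inv_anti₀ (by linarith) (by linarith)
  set R := cfc (fun y : ℝ => (y + -x)⁻¹) η
  have h3 : ‖-(R * (A - η))‖ < 1 := by
    rw [norm_neg]
    refine (norm_mul_le _ _).trans_lt ?_
    calc ‖R‖ * ‖A - η‖ ≤ (2 * m - x)⁻¹ * m :=
          mul_le_mul h2 h (norm_nonneg _) (inv_nonneg.2 (by linarith))
      _ < 1 := by
        rw [inv_mul_lt_iff₀ (by linarith)]
        linarith
  have h4 := isUnit_one_sub_of_norm_lt_one h3
  have h5 : IsUnit (η + ((-x : ℝ) : ℂ) • (1 : Matrix n n ℂ)) :=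
    isUnit_iff_exists.2 ⟨R, h1.2, h1.1⟩
  have h6 : algebraMap ℝ (Matrix n n ℂ) x - A =
      -((η + ((-x : ℝ) : ℂ) • (1 : Matrix n n ℂ)) * (1 - -(R * (A - η)))) := by
    rw [sub_neg_eq_add, mul_add, mul_one, ← mul_assoc, h1.2, one_mul,
      Algebra.algebraMap_eq_smul_one]
    have : ((-x : ℝ) : ℂ) • (1 : Matrix n n ℂ) = -(x • (1 : Matrix n n ℂ)) := by
      rw [Complex.ofReal_neg, neg_smul]; rfl
    rw [this]
    abel
  rw [spectrum.mem_resolventSet_iff, h6]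
  exact (h5.mul h4).neg

theorem posDef_of_spectrum_pos {A : Matrix n n ℂ} (hA : A.IsHermitian)
    (h : ∀ x ∈ spectrum ℝ A, 0 < x) : A.PosDef :=
  hA.posDef_iff_eigenvalues_pos.2 fun i => h _ (hA.eigenvalues_mem_spectrum_real i)

theorem infSpec_le {A : Matrix n n ℂ} {x : ℝ} (hx : x ∈ spectrum ℝ A) : infSpec A ≤ x :=
  csInf_le A.finite_real_spectrum.bddBelow hx

theorem infSpec_pos [Nonempty n] {A : Matrix n n ℂ} (hA : A.PosDef) : 0 < infSpec A := by
  have hne : (spectrum ℝ A).Nonempty := by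
    rw [hA.1.spectrum_real_eq_range_eigenvalues]
    exact range_nonempty _
  exact spectrum_pos_of_posDef hA (hne.csInf_mem A.finite_real_spectrum)

/-- The eigenvalues sum to 1 and each is at least the infimum. This trades every dimension factor
for the reciprocal of the smallest eigenvalue. -/
theorem card_mul_infSpec_le {A : Matrix n n ℂ} (hA : IsState A) :
    Fintype.card n * infSpec A ≤ 1 := by
  obtain ⟨V, a, hV, -, hAV, ha, -⟩ := exists_realDiag hA.1.1
  have h := hA.2
  rw [hAV, Matrix.trace_mul_cycle, hV, one_mul] at h
  have h1 : ((∑ i, a i : ℝ) : ℂ) = (1 : ℝ) := by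
    rw [Complex.ofReal_one, ← h]; simp [realDiag, Matrix.trace]
  rw [← Complex.ofReal_injective h1]
  calc (Fintype.card n : ℝ) * infSpec A = ∑ _i : n, infSpec A := by simp
    _ ≤ ∑ i, a i := Finset.sum_le_sum fun i _ => infSpec_le (ha i)

end EntropyExpansion

/-! ### Tensor products, partial trace and a crude entropy bound -/

section PartialTrace

variable {S E : Type*} [Fintype S] [DecidableEq S] [Fintype E] [DecidableEq E]

theorem trace_mul_ptrace (A : Matrix S S ℂ) (M : Matrix (S × E) (S × E) ℂ) :
    (A * ptrace M).trace = ((A ⊗ₖ (1 : Matrix E E ℂ)) * M).trace := by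
  simp only [Matrix.trace, Matrix.diag_apply, Matrix.mul_apply, ptrace, Matrix.of_apply,
    Matrix.kroneckerMap_apply, Fintype.sum_prod_type, Matrix.one_apply, mul_ite, mul_one, mul_zero,
    ite_mul, zero_mul, Finset.mul_sum, Finset.sum_ite_eq, Finset.mem_univ, if_true]
  exact Finset.sum_congr rfl fun i _ => Finset.sum_comm

theorem trace_ptrace (M : Matrix (S × E) (S × E) ℂ) : (ptrace M).trace = M.trace := by
  have h := trace_mul_ptrace (1 : Matrix S S ℂ) M
  rwa [Matrix.one_kronecker_one, one_mul, one_mul] at h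

theorem ptrace_posSemidef {M : Matrix (S × E) (S × E) ℂ} (hM : M.PosSemidef) :
    (ptrace M).PosSemidef := by
  have h : ptrace M = ∑ e : E, M.submatrix (fun i => (i, e)) (fun i => (i, e)) := by
    ext i j
    simp [ptrace, Matrix.sum_apply]
  rw [h]
  exact Matrix.posSemidef_sum _ fun e _ => hM.submatrix _

theorem ptrace_isState {M : Matrix (S × E) (S × E) ℂ} (hM : IsState M) : IsState (ptrace M) :=
  ⟨ptrace_posSemidef hM.1, by rw [trace_ptrace, hM.2]⟩

theorem kronecker_unitary {V : Matrix S S ℂ} {W : Matrix E E ℂ} (hV : Vᴴ * V = 1)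
    (hW : Wᴴ * W = 1) : (V ⊗ₖ W)ᴴ * (V ⊗ₖ W) = 1 := by
  rw [Matrix.conjTranspose_kronecker, ← Matrix.mul_kronecker_mul, hV, hW,
    Matrix.one_kronecker_one]

theorem kronecker_isState {ρ : Matrix S S ℂ} {ξ : Matrix E E ℂ} (hρ : IsState ρ)
    (hξ : IsState ξ) : IsState (ρ ⊗ₖ ξ) :=
  ⟨hρ.1.kronecker hξ.1, by rw [Matrix.trace_kronecker, hρ.2, hξ.2, one_mul]⟩

theorem conj_isState {n : Type*} [Fintype n] [DecidableEq n] {V ρ : Matrix n n ℂ}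
    (hV : Vᴴ * V = 1) (hρ : IsState ρ) : IsState (V * ρ * Vᴴ) :=
  ⟨hρ.1.mul_mul_conjTranspose_same V, by rw [Matrix.trace_mul_cycle, hV, one_mul, hρ.2]⟩

theorem realDiag_kronecker (a : S → ℝ) (b : E → ℝ) :
    realDiag a ⊗ₖ realDiag b = realDiag fun p : S × E => a p.1 * b p.2 := by
  rw [realDiag, realDiag, Matrix.diagonal_kronecker_diagonal, realDiag]
  congr 1
  ext p
  simp

theorem conj_realDiag_kronecker (V : Matrix S S ℂ) (W : Matrix E E ℂ) (a : S → ℝ) (b : E → ℝ) :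
    (V * realDiag a * Vᴴ) ⊗ₖ (W * realDiag b * Wᴴ) =
      (V ⊗ₖ W) * realDiag (fun p : S × E => a p.1 * b p.2) * (V ⊗ₖ W)ᴴ := by
  rw [← realDiag_kronecker, Matrix.conjTranspose_kronecker, ← Matrix.mul_kronecker_mul,
    ← Matrix.mul_kronecker_mul]

theorem norm_diag_le_norm_conj {n : Type*} [Fintype n] [DecidableEq n] {V : Matrix n n ℂ}
    (hV : Vᴴ * V = 1) (a : n → ℝ) (i : n) : ‖(a i : ℂ)‖ ≤ ‖V * realDiag a * Vᴴ‖ := by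
  have h1 : Vᴴ * (V * realDiag a * Vᴴ) * Vᴴᴴ = realDiag a := by
    rw [Matrix.conjTranspose_conjTranspose]
    calc _ = (Vᴴ * V) * realDiag a * (Vᴴ * V) := by simp only [mul_assoc]
      _ = _ := by rw [hV, one_mul, mul_one]
  have h2 := norm_conj_unitary_le (V := Vᴴ)
    (by rw [Matrix.conjTranspose_conjTranspose]; exact mul_eq_one_comm.mp hV)
    (V * realDiag a * Vᴴ)
  rw [h1] at h2
  have h3 := (norm_entry_le (realDiag a) i i).trans h2
  simpa [realDiag] using h3

theorem norm_kronecker_le_of_isHermitian {A : Matrix S S ℂ} {B : Matrix E E ℂ}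
    (hA : A.IsHermitian) (hB : B.IsHermitian) : ‖A ⊗ₖ B‖ ≤ ‖A‖ * ‖B‖ := by
  obtain ⟨V, a, hV, hV', hAV, -⟩ := exists_realDiag hA
  obtain ⟨W, b, hW, hW', hBW, -⟩ := exists_realDiag hB
  have h : A ⊗ₖ B = (V ⊗ₖ W) * realDiag (fun p : S × E => a p.1 * b p.2) * (V ⊗ₖ W)ᴴ := by
    rw [← conj_realDiag_kronecker, ← hAV, ← hBW]
  rw [h]
  refine (norm_conj_unitary_le (kronecker_unitary hV hW) _).trans ?_
  rw [realDiag, Matrix.l2_opNorm_diagonal, pi_norm_le_iff_of_nonneg (by positivity)]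
  intro p
  rw [Complex.ofReal_mul, norm_mul]
  have h1 := norm_diag_le_norm_conj hV a p.1
  have h2 := norm_diag_le_norm_conj hW b p.2
  rw [← hAV] at h1
  rw [← hBW] at h2
  exact mul_le_mul h1 h2 (norm_nonneg _) (norm_nonneg _)

/-- The C*-identity reduces this to Hermitian factors, which are diagonalized simultaneously. -/
theorem norm_kronecker_le (A : Matrix S S ℂ) (B : Matrix E E ℂ) : ‖A ⊗ₖ B‖ ≤ ‖A‖ * ‖B‖ := by
  refine (sq_le_sq₀ (norm_nonneg _) (by positivity)).1 ?_
  rw [pow_two, ← Matrix.l2_opNorm_conjTranspose_mul_self, Matrix.conjTranspose_kronecker,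
    ← Matrix.mul_kronecker_mul]
  refine (norm_kronecker_le_of_isHermitian (Matrix.isHermitian_conjTranspose_mul_self A)
    (Matrix.isHermitian_conjTranspose_mul_self B)).trans_eq ?_
  rw [Matrix.l2_opNorm_conjTranspose_mul_self, Matrix.l2_opNorm_conjTranspose_mul_self]
  ring

theorem norm_ptrace_le (M : Matrix (S × E) (S × E) ℂ) :
    ‖ptrace M‖ ≤ Fintype.card (S × E) * ‖M‖ := by
  refine (norm_le_traceNorm _).trans (traceNorm_le_of_forall fun W hW => ?_)
  rw [trace_mul_ptrace]
  refine (norm_trace_le _).trans ?_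
  gcongr
  refine (norm_mul_le _ _).trans (mul_le_of_le_one_left (norm_nonneg _) ?_)
  exact (norm_kronecker_le _ _).trans (mul_le_one₀ hW (norm_nonneg _)
    (norm_le_one_of_unitary (by simp)))

theorem mem_spectrum_conj_realDiag {n : Type*} [Fintype n] [DecidableEq n] {V : Matrix n n ℂ}
    (hV : Vᴴ * V = 1) (a : n → ℝ) (i : n) : a i ∈ spectrum ℝ (V * realDiag a * Vᴴ) := by
  by_contra hi
  have h1 := cfc_conj_realDiag hV a (fun x => if x = a i then 1 else 0)
  have h2 : cfc (fun x : ℝ => if x = a i then (1 : ℝ) else 0) (V * realDiag a * Vᴴ) = 0 := by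
    rw [← cfc_const_zero ℝ (V * realDiag a * Vᴴ)]
    refine cfc_congr fun x hx => if_neg ?_
    rintro rfl
    exact hi hx
  rw [h2] at h1
  have h3 : Vᴴ * (V * realDiag (fun j => if a j = a i then 1 else 0) * Vᴴ) * V =
      realDiag (fun j => if a j = a i then 1 else 0) := by
    calc _ = (Vᴴ * V) * realDiag (fun j => if a j = a i then 1 else 0) * (Vᴴ * V) := by
          simp only [mul_assoc]
      _ = _ := by rw [hV, one_mul, mul_one]
  rw [← h1, mul_zero, zero_mul] at h3
  have := congrFun (congrFun h3 i) i
  simp [realDiag] at this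

theorem le_one_of_mem_spectrum {n : Type*} [Fintype n] [DecidableEq n] {ρ : Matrix n n ℂ}
    (hρ : IsState ρ) {x : ℝ} (hx : x ∈ spectrum ℝ ρ) : x ≤ 1 := by
  rw [hρ.1.1.spectrum_real_eq_range_eigenvalues] at hx
  obtain ⟨i, rfl⟩ := hx
  have h : ((∑ i, hρ.1.1.eigenvalues i : ℝ) : ℂ) = (1 : ℝ) := by
    have h1 := hρ.2.symm.trans hρ.1.1.trace_eq_sum_eigenvalues
    push_cast
    exact h1.symm
  rw [← Complex.ofReal_injective h]
  exact Finset.single_le_sum (fun i _ => hρ.1.eigenvalues_nonneg i) (Finset.mem_univ i)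

/-- The spectrum of the product contains each product of eigenvalues, and those of a state are at
most 1. Hence a lower bound for the tensor product is also one for the probe state. -/
theorem infSpec_kronecker_le {ρ : Matrix S S ℂ} {ξ : Matrix E E ℂ} [Nonempty S] (hρ : IsState ρ)
    (hξ : IsState ξ) {x : ℝ} (hx : x ∈ spectrum ℝ ξ) : infSpec (ρ ⊗ₖ ξ) ≤ x := by
  have hξ' := hξ.1.1
  obtain ⟨V, a, hV, hV', hAV, ha, -⟩ := exists_realDiag hρ.1.1
  have hx0 := spectrum_nonneg_of_posSemidef hξ.1 hx
  rw [hξ'.spectrum_real_eq_range_eigenvalues] at hx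
  obtain ⟨j, rfl⟩ := hx
  obtain ⟨i⟩ := ‹Nonempty S›
  have hW : (hξ'.eigenvectorUnitary : Matrix E E ℂ)ᴴ * hξ'.eigenvectorUnitary = 1 :=
    Unitary.coe_star_mul_self _
  have h := mem_spectrum_conj_realDiag (kronecker_unitary hV hW)
    (fun p : S × E => a p.1 * hξ'.eigenvalues p.2) (i, j)
  rw [← conj_realDiag_kronecker, ← hAV,
    show (hξ'.eigenvectorUnitary : Matrix E E ℂ) * realDiag hξ'.eigenvalues *
      (hξ'.eigenvectorUnitary : Matrix E E ℂ)ᴴ = ξ from hξ'.spectral_theorem.symm] at h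
  refine (infSpec_le h).trans ?_
  exact mul_le_of_le_one_left hx0 (le_one_of_mem_spectrum hρ (ha i))

theorem abs_mul_log_le {x : ℝ} (h0 : 0 ≤ x) (h1 : x ≤ 1) : |x * Real.log x| ≤ 1 := by
  rcases h0.eq_or_lt with rfl | h
  · simp
  · rw [mul_comm]
    exact (Real.abs_log_mul_self_lt x h h1).le

/-- A bound for the relative entropy of a state with respect to the product of its marginal with
a positive definite state, independent of the spectrum of the marginal. -/
theorem abs_relEntropy_ptrace_le {ω : Matrix (S × E) (S × E) ℂ} {ξ : Matrix E E ℂ}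
    (hω : IsState ω) (hξ : IsState ξ) {m : ℝ} (hm : 0 < m) (hξm : ∀ x ∈ spectrum ℝ ξ, m ≤ x) :
    |relEntropy ω (ptrace ω ⊗ₖ ξ)| ≤ Fintype.card (S × E) * (1 + m⁻¹) := by
  have hρ := ptrace_isState hω
  obtain ⟨V, a, hV, hV', hρV, ha, -⟩ := exists_realDiag hρ.1.1
  obtain ⟨W, b, hW, hW', hξW, hb, -⟩ := exists_realDiag hξ.1.1
  have hZ := kronecker_unitary hV hW
  set Z := V ⊗ₖ W with hZdef
  set M := Zᴴ * ω * Z with hMdef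
  have hM : M.PosSemidef := hω.1.conjTranspose_mul_mul_same Z
  have ha0 : ∀ i, 0 ≤ a i := fun i => spectrum_nonneg_of_posSemidef hρ.1 (ha i)
  have ha1 : ∀ i, a i ≤ 1 := fun i => le_one_of_mem_spectrum hρ (ha i)
  have hb0 : ∀ i, m ≤ b i := fun i => hξm _ (hb i)
  have hb1 : ∀ i, b i ≤ 1 := fun i => le_one_of_mem_spectrum hξ (hb i)
  have hMp : ptrace M = realDiag a := by
    refine Matrix.ext_iff_trace_mul_left.2 fun A => ?_
    rw [trace_mul_ptrace, hMdef]
    calc ((A ⊗ₖ (1 : Matrix E E ℂ)) * (Zᴴ * ω * Z)).trace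
        = ((Z * (A ⊗ₖ (1 : Matrix E E ℂ)) * Zᴴ) * ω).trace := by
          rw [← mul_assoc, Matrix.trace_mul_comm]; simp only [mul_assoc]
      _ = ((V * A * Vᴴ) * ptrace ω).trace := by
          rw [trace_mul_ptrace, hZdef, Matrix.conjTranspose_kronecker, ← Matrix.mul_kronecker_mul,
            ← Matrix.mul_kronecker_mul, mul_one, hW']
      _ = (A * (Vᴴ * (V * realDiag a * Vᴴ) * V)).trace := by
          conv_lhs => rw [hρV, mul_assoc, mul_assoc, Matrix.trace_mul_comm]
          simp only [mul_assoc]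
      _ = (A * ((Vᴴ * V) * realDiag a * (Vᴴ * V))).trace := by simp only [mul_assoc]
      _ = _ := by rw [hV, one_mul, mul_one]
  -- The diagonal entries over i are nonnegative and sum to a i. Thus log(a i) only occurs with
  -- weight at most a i, and x log x stays bounded however small the marginal eigenvalue is.
  have hMle : ∀ p : S × E, (M p p).re ≤ a p.1 := by
    rintro ⟨i, j⟩
    have h1 : ∑ e, M (i, e) (i, e) = (a i : ℂ) := by
      have := congrFun (congrFun hMp i) i
      simpa [ptrace, realDiag] using this
    have h2 : ∑ e, (M (i, e) (i, e)).re = a i := by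
      rw [← Complex.re_sum, h1, Complex.ofReal_re]
    rw [← h2]
    exact Finset.single_le_sum (f := fun e => (M (i, e) (i, e)).re)
      (fun e _ => (Complex.nonneg_iff.1 (hM.diag_nonneg (i := (i, e)))).1) (Finset.mem_univ j)
  have hM0 : ∀ p, 0 ≤ (M p p).re := fun p => (Complex.nonneg_iff.1 (hM.diag_nonneg (i := p))).1
  have e2 : (ω * cfc Real.log (ptrace ω ⊗ₖ ξ)).trace =
      ∑ p : S × E, M p p * (Real.log (a p.1 * b p.2) : ℂ) := by
    have h1 : cfc Real.log (ptrace ω ⊗ₖ ξ) =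
        Z * realDiag (fun p : S × E => Real.log (a p.1 * b p.2)) * Zᴴ := by
      conv_lhs => rw [hρV, hξW, conj_realDiag_kronecker]
      exact cfc_conj_realDiag hZ _ _
    rw [h1, ← mul_assoc, ← mul_assoc, Matrix.trace_mul_comm]
    rw [← mul_assoc, ← mul_assoc, ← hMdef]
    simp [Matrix.trace, realDiag, Matrix.mul_diagonal]
  have b2 : |(ω * cfc Real.log (ptrace ω ⊗ₖ ξ)).trace.re| ≤ Fintype.card (S × E) * m⁻¹ := by
    rw [e2, Complex.re_sum]
    refine (Finset.abs_sum_le_sum_abs _ _).trans ?_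
    calc _ ≤ ∑ _p : S × E, m⁻¹ := Finset.sum_le_sum fun p _ => ?_
      _ = _ := by rw [Finset.sum_const, Finset.card_univ, nsmul_eq_mul]
    rw [Complex.re_mul_ofReal, abs_mul, abs_of_nonneg (hM0 p)]
    have hbp := hb0 p.2
    have hb2 := hb1 p.2
    have hbp0 : 0 < b p.2 := by linarith
    have hx0 : 0 ≤ a p.1 * b p.2 := mul_nonneg (ha0 _) hbp0.le
    have hx1 : a p.1 * b p.2 ≤ 1 := mul_le_one₀ (ha1 _) hbp0.le hb2
    have hx := abs_mul_log_le hx0 hx1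
    rw [abs_mul, abs_of_nonneg hx0] at hx
    have h3 : (M p p).re ≤ m⁻¹ * (a p.1 * b p.2) := by
      refine (hMle p).trans ?_
      rw [le_inv_mul_iff₀ hm, mul_comm]
      exact mul_le_mul_of_nonneg_left hbp (ha0 _)
    calc (M p p).re * |Real.log (a p.1 * b p.2)|
        ≤ m⁻¹ * (a p.1 * b p.2) * |Real.log (a p.1 * b p.2)| := by gcongr
      _ = m⁻¹ * (a p.1 * b p.2 * |Real.log (a p.1 * b p.2)|) := by ring
      _ ≤ m⁻¹ * 1 := by gcongr
      _ = m⁻¹ := mul_one _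
  obtain ⟨Y, c, hY, -, hωY, hc, hfc⟩ := exists_realDiag hω.1.1
  have b1 : |(ω * cfc Real.log ω).trace.re| ≤ Fintype.card (S × E) := by
    rw [self_mul_cfc hω.1.1, hfc, Matrix.trace_mul_cycle, hY, one_mul]
    have : (realDiag fun i => c i * Real.log (c i)).trace =
        ((∑ i, c i * Real.log (c i) : ℝ) : ℂ) := by
      simp [realDiag, Matrix.trace]
    rw [this, Complex.ofReal_re]
    refine (Finset.abs_sum_le_sum_abs _ _).trans ?_
    calc _ ≤ ∑ _p : S × E, (1 : ℝ) := Finset.sum_le_sum fun p _ => abs_mul_log_le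
          (spectrum_nonneg_of_posSemidef hω.1 (hc p)) (le_one_of_mem_spectrum hω (hc p))
      _ = _ := by rw [Finset.sum_const, Finset.card_univ, nsmul_eq_mul, mul_one]
  rw [relEntropy, mul_sub, Matrix.trace_sub, Complex.sub_re]
  calc _ ≤ _ := abs_sub _ _
    _ ≤ Fintype.card (S × E) + Fintype.card (S × E) * m⁻¹ := add_le_add b1 b2
    _ = _ := by ring

end PartialTrace

/-! ### Gibbs states are faithful and the propagator is unitary -/

section Gibbs

variable {n : Type*} [Fintype n] [DecidableEq n]

theorem exp_posDef {A : Matrix n n ℂ} (hA : A.IsHermitian) : (NormedSpace.exp A).PosDef := by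
  have hB : ((2⁻¹ : ℂ) • A).IsHermitian := by
    rw [Matrix.IsHermitian, Matrix.conjTranspose_smul, hA.eq]
    simp
  have h : NormedSpace.exp A =
      (NormedSpace.exp ((2⁻¹ : ℂ) • A))ᴴ * NormedSpace.exp ((2⁻¹ : ℂ) • A) := by
    rw [hB.exp.eq, ← Matrix.exp_add_of_commute _ _ (Commute.refl _), ← add_smul]
    norm_num
  have hp : (NormedSpace.exp A).PosSemidef := h ▸ Matrix.posSemidef_conjTranspose_mul_self _
  exact hp.posDef_iff_isUnit.2 (Matrix.isUnit_exp A)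

theorem neg_ofReal_smul_isHermitian (β : ℝ) {h : Matrix n n ℂ} (hh : h.IsHermitian) :
    (-(β : ℂ) • h).IsHermitian := by
  rw [Matrix.IsHermitian, Matrix.conjTranspose_smul, hh.eq]
  simp

theorem gibbs_posDef [Nonempty n] (β : ℝ) {h : Matrix n n ℂ} (hh : h.IsHermitian) :
    (gibbs β h).PosDef := by
  have hp := exp_posDef (neg_ofReal_smul_isHermitian β hh)
  exact hp.smul (inv_pos.2 hp.trace_pos)

theorem gibbs_isState [Nonempty n] (β : ℝ) {h : Matrix n n ℂ} (hh : h.IsHermitian) :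
    IsState (gibbs β h) := by
  refine ⟨(gibbs_posDef β hh).posSemidef, ?_⟩
  have hp := exp_posDef (neg_ofReal_smul_isHermitian β hh)
  rw [gibbs, Matrix.trace_smul, smul_eq_mul, inv_mul_cancel₀ hp.trace_pos.ne']

theorem exp_I_smul_unitary {H : Matrix n n ℂ} (hH : H.IsHermitian) (τ : ℝ) :
    (NormedSpace.exp (-(Complex.I * (τ : ℂ)) • H))ᴴ *
      NormedSpace.exp (-(Complex.I * (τ : ℂ)) • H) = 1 := by
  have h : (-(Complex.I * (τ : ℂ)) • H)ᴴ = -(-(Complex.I * (τ : ℂ)) • H) := by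
    rw [Matrix.conjTranspose_smul, hH.eq, ← neg_smul]
    simp
  rw [← Matrix.exp_conjTranspose, h, ← Matrix.exp_add_of_commute _ _
    (Commute.refl (-(Complex.I * (τ : ℂ)) • H)).neg_left, neg_add_cancel, NormedSpace.exp_zero]

end Gibbs

/-! ### The dual map for the trace pairing -/

section TraceDual

variable {n : Type*} [Fintype n] [DecidableEq n]

/-- The adjoint of a linear map on matrices with respect to the pairing `Tr (A B)`. -/
def traceDual (Φ : SuperOp n) : SuperOp n where
  toFun A := Matrix.of fun i j => (A * Φ (Matrix.single j i 1)).trace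
  map_add' A B := by
    ext i j
    simp [add_mul]
  map_smul' z A := by
    ext i j
    simp

theorem trace_traceDual_mul (Φ : SuperOp n) (A B : Matrix n n ℂ) :
    (traceDual Φ A * B).trace = (A * Φ B).trace := by
  conv_rhs => rw [Matrix.matrix_eq_sum_single B]
  simp only [map_sum, Matrix.mul_sum, Matrix.trace_sum]
  have h : ∀ i j, (A * Φ (Matrix.single i j (B i j))).trace = B i j * traceDual Φ A j i := by
    intro i j
    rw [show Matrix.single i j (B i j) = B i j • Matrix.single i j (1 : ℂ) by
      rw [Matrix.smul_single, smul_eq_mul, mul_one], map_smul, Matrix.mul_smul,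
      Matrix.trace_smul, smul_eq_mul]
    rfl
  simp only [h]
  simp only [Matrix.trace, Matrix.diag_apply, Matrix.mul_apply]
  rw [Finset.sum_comm]
  exact Finset.sum_congr rfl fun i _ => Finset.sum_congr rfl fun j _ => mul_comm _ _

/-- A linear map whose trace dual is injective is injective. -/
theorem injective_of_traceDual_injective {Φ : SuperOp n}
    (h : ∀ A, (∀ B, (A * Φ B).trace = 0) → A = 0) : Function.Injective Φ := by
  have hinj : Function.Injective (traceDual Φ) := by
    rw [injective_iff_map_eq_zero]
    intro A hA
    refine h A fun B => ?_
    rw [← trace_traceDual_mul, hA, zero_mul, Matrix.trace_zero]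
  have hsurj := LinearMap.surjective_of_injective hinj
  rw [injective_iff_map_eq_zero]
  intro B hB
  refine Matrix.ext_iff_trace_mul_left.2 fun A => ?_
  obtain ⟨A', rfl⟩ := hsurj A
  rw [trace_traceDual_mul, hB, mul_zero, mul_zero]

end TraceDual

/-! ### Irreducible Kraus maps: existence and faithfulness of invariant states -/

section PerronFrobenius

variable {n ι : Type*} [Fintype n] [DecidableEq n] [Fintype ι]

/-- `Φ` is the trace preserving completely positive map with Kraus operators `K`. -/
structure IsKraus (K : ι → Matrix n n ℂ) (Φ : SuperOp n) : Prop where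
  sum_eq_one : ∑ i, (K i)ᴴ * K i = 1
  apply_eq : ∀ A, Φ A = ∑ i, K i * A * (K i)ᴴ

variable {K : ι → Matrix n n ℂ} {Φ : SuperOp n}

theorem IsKraus.trace_apply (h : IsKraus K Φ) (A : Matrix n n ℂ) : (Φ A).trace = A.trace := by
  rw [h.apply_eq, Matrix.trace_sum]
  have : ∀ i, (K i * A * (K i)ᴴ).trace = ((K i)ᴴ * K i * A).trace := fun i => by
    rw [Matrix.trace_mul_cycle]
  simp only [this]
  rw [← Matrix.trace_sum, ← Finset.sum_mul, h.sum_eq_one, one_mul]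

theorem IsKraus.posSemidef (h : IsKraus K Φ) {A : Matrix n n ℂ} (hA : A.PosSemidef) :
    (Φ A).PosSemidef := by
  rw [h.apply_eq]
  exact Matrix.posSemidef_sum _ fun i _ => hA.mul_mul_conjTranspose_same _

theorem IsKraus.isState (h : IsKraus K Φ) {A : Matrix n n ℂ} (hA : IsState A) :
    IsState (Φ A) :=
  ⟨h.posSemidef hA.1, by rw [h.trace_apply, hA.2]⟩

theorem IsKraus.conjTranspose_apply (h : IsKraus K Φ) (A : Matrix n n ℂ) : Φ Aᴴ = (Φ A)ᴴ := by
  rw [h.apply_eq, h.apply_eq, Matrix.conjTranspose_sum]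
  refine Finset.sum_congr rfl fun i _ => ?_
  simp only [Matrix.conjTranspose_mul, Matrix.conjTranspose_conjTranspose, mul_assoc]

theorem IsKraus.traceDual_apply (h : IsKraus K Φ) (A : Matrix n n ℂ) :
    traceDual Φ A = ∑ i, (K i)ᴴ * A * K i := by
  refine Matrix.ext_iff_trace_mul_right.2 fun B => ?_
  rw [trace_traceDual_mul, h.apply_eq, Matrix.mul_sum, Finset.sum_mul, Matrix.trace_sum,
    Matrix.trace_sum]
  refine Finset.sum_congr rfl fun i _ => ?_
  rw [← mul_assoc, Matrix.trace_mul_comm]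
  simp only [mul_assoc]

/-- Irreducibility at the level of Kraus operators: they have no common invariant subspace, since
one with projection p would make p X p stable under Φ. -/
theorem IsKraus.eq_zero_or_one (h : IsKraus K Φ) (hI : Irred Φ) {p : Matrix n n ℂ}
    (hp : p.IsHermitian) (hpp : p * p = p) (hinv : ∀ i, K i * p = p * K i * p) :
    p = 0 ∨ p = 1 := by
  refine hI p hp hpp fun A => ⟨∑ i, K i * p * A * (K i * p)ᴴ, ?_⟩
  rw [h.apply_eq, Finset.mul_sum, Finset.sum_mul]
  refine Finset.sum_congr rfl fun i _ => ?_
  have h2 : p * (K i)ᴴ = p * (K i)ᴴ * p := by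
    have := congrArg Matrix.conjTranspose (hinv i)
    simpa only [Matrix.conjTranspose_mul, hp.eq, mul_assoc] using this
  calc K i * (p * A * p) * (K i)ᴴ = (K i * p) * A * (p * (K i)ᴴ) := by simp only [mul_assoc]
    _ = (p * K i * p) * A * (p * (K i)ᴴ * p) := by rw [← hinv, ← h2]
    _ = p * (K i * p * A * (K i * p)ᴴ) * p := by
      rw [Matrix.conjTranspose_mul, hp.eq]
      simp only [mul_assoc]

theorem exists_eq_conjTranspose_mul_self {A : Matrix n n ℂ} (hA : A.PosSemidef) :
    ∃ B : Matrix n n ℂ, A = Bᴴ * B := by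
  refine ⟨cfc Real.sqrt A, ?_⟩
  rw [(cfc_isHermitian _ A).eq, cfc_mul_cfc]
  conv_lhs => rw [← cfc_id' ℝ A hA.1.isSelfAdjoint]
  exact cfc_congr fun x hx => (Real.mul_self_sqrt (spectrum_nonneg_of_posSemidef hA hx)).symm

/-- The orthogonal projection onto the kernel of `H`, for `H` self-adjoint. -/
def kerProj (H : Matrix n n ℂ) : Matrix n n ℂ := cfc (fun x : ℝ => if x = 0 then 1 else 0) H

theorem kerProj_isHermitian (H : Matrix n n ℂ) : (kerProj H).IsHermitian := cfc_isHermitian _ H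

theorem kerProj_mul_self (H : Matrix n n ℂ) : kerProj H * kerProj H = kerProj H := by
  rw [kerProj, cfc_mul_cfc]
  exact cfc_congr fun x _ => by simp

theorem mul_kerProj {H : Matrix n n ℂ} (hH : H.IsHermitian) : H * kerProj H = 0 := by
  rw [kerProj, self_mul_cfc hH, ← cfc_const_zero ℝ H]
  exact cfc_congr fun x _ => by simp

theorem one_sub_kerProj {H : Matrix n n ℂ} (hH : H.IsHermitian) :
    1 - kerProj H = cfc (fun x : ℝ => x⁻¹) H * H ∧ 1 - kerProj H = H * cfc (fun x : ℝ => x⁻¹) H := by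
  rw [kerProj, cfc_one_sub hH, cfc_mul_self hH, self_mul_cfc hH]
  constructor <;>
  · refine cfc_congr fun x _ => ?_
    by_cases hx : x = 0 <;> simp [hx]

/-- A Schur lemma: the twisted commutation makes the kernel of a invariant under every Kraus
operator, so it is everything or zero. -/
theorem IsKraus.eq_zero_or_isUnit (h : IsKraus K Φ) (hI : Irred Φ) {a : Matrix n n ℂ} {z : ℂ}
    (ha : ∀ i, a * K i = z • (K i * a)) : a = 0 ∨ IsUnit a := by
  have hH := Matrix.isHermitian_conjTranspose_mul_self a
  set p := kerProj (aᴴ * a) with hp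
  have hap : a * p = 0 := by
    rw [← Matrix.conjTranspose_mul_self_eq_zero, Matrix.conjTranspose_mul]
    calc pᴴ * aᴴ * (a * p) = pᴴ * ((aᴴ * a) * p) := by simp only [mul_assoc]
      _ = 0 := by rw [mul_kerProj hH, mul_zero]
  have h1 : 1 - p = cfc (fun x : ℝ => x⁻¹) (aᴴ * a) * aᴴ * a := by
    rw [mul_assoc]
    exact (one_sub_kerProj hH).1
  have hKp : ∀ i, K i * p = p * K i * p := fun i => by
    have h2 : (1 - p) * (K i * p) = 0 := by
      rw [h1, mul_assoc, ← mul_assoc a, ha, Matrix.smul_mul, mul_assoc (K i), hap]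
      simp
    rw [sub_mul, one_mul, sub_eq_zero] at h2
    rw [mul_assoc]
    exact h2
  rcases h.eq_zero_or_one hI (kerProj_isHermitian _) (kerProj_mul_self (aᴴ * a)) hKp with h0 | h0
  · right
    rw [← hp] at h0
    rw [h0, sub_zero] at h1
    exact isUnit_iff_exists.2 ⟨_, mul_eq_one_comm.mp h1.symm, h1.symm⟩
  · left
    rw [← hp] at h0
    rwa [h0, mul_one] at hap

/-- Non-zero invariant positive operators of an irreducible map are positive definite. -/
theorem IsKraus.posDef_of_invariant (h : IsKraus K Φ) (hI : Irred Φ) {ρ : Matrix n n ℂ}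
    (hρ : ρ.PosSemidef) (h0 : ρ ≠ 0) (hinv : Φ ρ = ρ) : ρ.PosDef := by
  set q := kerProj ρ with hq
  have hqh : qᴴ = q := (kerProj_isHermitian ρ).eq
  have hρq : ρ * q = 0 := mul_kerProj hρ.1
  -- Compressing Φρ = ρ to the kernel of ρ gives a vanishing sum of positive terms. Each term
  -- vanishes, so the range of ρ is invariant under every Kraus operator.
  have h1 : ∀ i, q * K i * ρ = 0 := by
    have hs : ∑ i, q * (K i * ρ * (K i)ᴴ) * q = 0 := by
      rw [← Finset.sum_mul, ← Finset.mul_sum, ← h.apply_eq, hinv, mul_assoc, hρq, mul_zero]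
    have hps : ∀ i, (q * (K i * ρ * (K i)ᴴ) * q).PosSemidef := fun i => by
      have := (hρ.mul_mul_conjTranspose_same (K i)).mul_mul_conjTranspose_same q
      rwa [hqh] at this
    have htr : ∀ i ∈ Finset.univ, (q * (K i * ρ * (K i)ᴴ) * q).trace = 0 := by
      refine (Finset.sum_eq_zero_iff_of_nonneg fun i _ => (hps i).trace_nonneg).1 ?_
      rw [← Matrix.trace_sum, hs, Matrix.trace_zero]
    intro i
    have hz := (hps i).trace_eq_zero_iff.1 (htr i (Finset.mem_univ i))
    obtain ⟨B, hB⟩ := exists_eq_conjTranspose_mul_self hρ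
    have h2 : (B * (K i)ᴴ * q)ᴴ * (B * (K i)ᴴ * q) = 0 := by
      rw [← hz, hB]
      simp only [Matrix.conjTranspose_mul, Matrix.conjTranspose_conjTranspose, hqh, mul_assoc]
    have h3 := congrArg Matrix.conjTranspose (Matrix.conjTranspose_mul_self_eq_zero.1 h2)
    simp only [Matrix.conjTranspose_mul, Matrix.conjTranspose_conjTranspose, hqh,
      Matrix.conjTranspose_zero] at h3
    rw [hB, ← mul_assoc, mul_assoc q, h3, zero_mul]
  have h2 := (one_sub_kerProj hρ.1).2
  rw [← hq] at h2
  have hKq : ∀ i, K i * (1 - q) = (1 - q) * K i * (1 - q) := fun i => by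
    have h4 : q * (K i * (1 - q)) = 0 := by
      rw [h2, ← mul_assoc, ← mul_assoc, h1, zero_mul]
    rw [mul_assoc, sub_mul 1 q, one_mul, h4, sub_zero]
  rcases h.eq_zero_or_one hI (p := 1 - q) (Matrix.isHermitian_one.sub (kerProj_isHermitian ρ))
    (by rw [sub_mul, one_mul, mul_sub, mul_one, kerProj_mul_self, sub_self, sub_zero])
    hKq with h3 | h3
  · rw [sub_eq_zero] at h3
    rw [← h3, mul_one] at hρq
    exact absurd hρq h0
  · rw [h3] at h2
    refine hρ.posDef_iff_isUnit.2 ?_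
    exact isUnit_iff_exists.2 ⟨_, h2.symm, mul_eq_one_comm.mp h2.symm⟩

theorem IsKraus.exists_fixed [Nonempty n] (h : IsKraus K Φ) :
    ∃ x : Matrix n n ℂ, x ≠ 0 ∧ x.IsHermitian ∧ Φ x = x := by
  -- Trace preservation puts the range of Φ − 1 in the traceless matrices, so it misses the
  -- identity.
  have hns : ¬ Function.Injective (Φ - 1 : SuperOp n) := by
    intro hinj
    obtain ⟨x, hx⟩ := LinearMap.surjective_of_injective hinj (1 : Matrix n n ℂ)
    have h1 := congrArg Matrix.trace hx
    rw [LinearMap.sub_apply, Matrix.trace_sub, h.trace_apply, Module.End.one_apply, sub_self,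
      Matrix.trace_one] at h1
    exact Nat.cast_ne_zero.2 Fintype.card_ne_zero h1.symm
  rw [injective_iff_map_eq_zero] at hns
  push Not at hns
  obtain ⟨x, hx, hx0⟩ := hns
  rw [LinearMap.sub_apply, Module.End.one_apply, sub_eq_zero] at hx
  -- The Hermitian part of x is again fixed; if it vanishes, x is anti-Hermitian and i x is
  -- Hermitian.
  by_cases hc : x + xᴴ = 0
  · refine ⟨Complex.I • x, smul_ne_zero Complex.I_ne_zero hx0, ?_, by rw [map_smul, hx]⟩
    rw [Matrix.IsHermitian, Matrix.conjTranspose_smul, eq_neg_of_add_eq_zero_right hc]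
    simp
  · refine ⟨x + xᴴ, hc, Matrix.isHermitian_add_transpose_self x, ?_⟩
    rw [map_add, h.conjTranspose_apply, hx]

theorem mul_eq_zero_of_trace_eq_zero {p A : Matrix n n ℂ} (hp : p.IsHermitian) (hpp : p * p = p)
    (hA : A.PosSemidef) (h : (p * A).trace = 0) : p * A = 0 := by
  obtain ⟨B, hB⟩ := exists_eq_conjTranspose_mul_self hA
  have h1 : ((B * p)ᴴ * (B * p)).trace = 0 := by
    rw [Matrix.conjTranspose_mul, hp.eq, ← h, hB]
    conv_rhs => rw [← hpp]
    rw [← mul_assoc, Matrix.trace_mul_comm]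
    simp only [mul_assoc]
  have h2 := congrArg Matrix.conjTranspose (Matrix.trace_conjTranspose_mul_self_eq_zero_iff.1 h1)
  rw [Matrix.conjTranspose_mul, hp.eq, Matrix.conjTranspose_zero] at h2
  rw [hB, ← mul_assoc, h2, zero_mul]

/-- The positive part of a self-adjoint fixed point is a fixed point. -/
theorem IsKraus.posPart_fixed (h : IsKraus K Φ) {x : Matrix n n ℂ} (hx : x.IsHermitian)
    (hfix : Φ x = x) : Φ (cfc (fun t : ℝ => max t 0) x) = cfc (fun t : ℝ => max t 0) x := by
  set xp := cfc (fun t : ℝ => max t 0) x with hxp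
  set xm := cfc (fun t : ℝ => max (-t) 0) x with hxm
  set p := cfc (fun t : ℝ => if 0 < t then 1 else 0) x with hp
  have hph : p.IsHermitian := cfc_isHermitian _ x
  have hpp : p * p = p := by
    rw [hp, cfc_mul_cfc]
    exact cfc_congr fun t _ => by simp
  have hxpp : xp.PosSemidef := cfc_posSemidef fun t _ => le_max_right _ _
  have hxmp : xm.PosSemidef := cfc_posSemidef fun t _ => le_max_right _ _
  have hsub : x = xp - xm := by
    rw [hxp, hxm, ← cfc_sub _ _ x (continuousOn_real_spectrum _ _)
      (continuousOn_real_spectrum _ _)]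
    conv_lhs => rw [← cfc_id' ℝ x hx.isSelfAdjoint]
    refine cfc_congr fun t _ => ?_
    rcases le_total t 0 with ht | ht <;> simp [ht]
  have hpx : p * x = xp := by
    rw [hp, cfc_mul_self hx]
    refine cfc_congr fun t _ => ?_
    rcases le_or_gt t 0 with ht | ht
    · simp [ht, ht.not_gt]
    · simp [ht, ht.le]
  have hΦp := h.posSemidef hxpp
  have hΦm := h.posSemidef hxmp
  have hΦ : x = Φ xp - Φ xm := by rw [← map_sub, ← hsub, hfix]
  have hqh : (1 - p).IsHermitian := Matrix.isHermitian_one.sub hph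
  have hqq : (1 - p) * (1 - p) = 1 - p := by
    rw [sub_mul, one_mul, mul_sub, mul_one, hpp, sub_self, sub_zero]
  have hnn : ∀ {q A : Matrix n n ℂ}, q.IsHermitian → q * q = q → A.PosSemidef →
      0 ≤ (q * A).trace := by
    intro q A hq hqq hA
    have : (q * A).trace = (q * A * qᴴ).trace := by
      rw [hq.eq, Matrix.trace_mul_cycle, hqq]
    rw [this]
    exact (hA.mul_mul_conjTranspose_same q).trace_nonneg
  -- Tr(p x) = Tr x₊ = Tr Φ(x₊) by trace preservation. Hence neither image leaks out of its half,
  -- and compressing x = Φ(x₊) − Φ(x₋) by p gives Φ(x₊) = x₊.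
  have hsum : ((1 - p) * Φ xp).trace + (p * Φ xm).trace = 0 := by
    have h1 : (p * x).trace = (p * Φ xp).trace - (p * Φ xm).trace := by
      conv_lhs => rw [hΦ, mul_sub, Matrix.trace_sub]
    rw [hpx, ← h.trace_apply] at h1
    rw [sub_mul, one_mul, Matrix.trace_sub, h1]
    ring
  have h1 : ((1 - p) * Φ xp).trace = 0 ∧ (p * Φ xm).trace = 0 :=
    (add_eq_zero_iff_of_nonneg (hnn hqh hqq hΦp) (hnn hph hpp hΦm)).1 hsum
  have h2 := mul_eq_zero_of_trace_eq_zero hqh hqq hΦp h1.1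
  have h3 := mul_eq_zero_of_trace_eq_zero hph hpp hΦm h1.2
  rw [sub_mul, one_mul, sub_eq_zero] at h2
  have h4 : p * x = p * Φ xp := by
    conv_lhs => rw [hΦ, mul_sub, h3, sub_zero]
  rw [h2, ← h4, hpx]

theorem IsKraus.exists_invariant [Nonempty n] (h : IsKraus K Φ) :
    ∃ ρ : Matrix n n ℂ, IsState ρ ∧ Φ ρ = ρ := by
  obtain ⟨x, hx0, hx, hfix⟩ := h.exists_fixed
  obtain ⟨y, hy0, hyp, hy⟩ : ∃ y : Matrix n n ℂ, y ≠ 0 ∧ y.PosSemidef ∧ Φ y = y := by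
    -- The positive parts of x and −x cannot both vanish; a nonzero one is normalized.
    by_cases hp : cfc (fun t : ℝ => max t 0) x = 0
    · have hfix' : Φ (-x) = -x := by rw [map_neg, hfix]
      refine ⟨cfc (fun t : ℝ => max t 0) (-x), ?_, cfc_posSemidef fun t _ => le_max_right _ _,
        h.posPart_fixed hx.neg hfix'⟩
      intro hm
      refine hx0 ?_
      rw [← cfc_comp_neg (fun t : ℝ => max t 0) x
        ((Set.Finite.image _ x.finite_real_spectrum).continuousOn _) hx.isSelfAdjoint] at hm
      have hsub : x = cfc (fun t : ℝ => max t 0) x - cfc (fun t : ℝ => max (-t) 0) x := by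
        rw [← cfc_sub _ _ x (continuousOn_real_spectrum _ _) (continuousOn_real_spectrum _ _)]
        conv_lhs => rw [← cfc_id' ℝ x hx.isSelfAdjoint]
        refine cfc_congr fun t _ => ?_
        rcases le_total t 0 with ht | ht <;> simp [ht]
      rw [hsub, hp, hm, sub_zero]
    · exact ⟨_, hp, cfc_posSemidef fun t _ => le_max_right _ _, h.posPart_fixed hx hfix⟩
  have htr : 0 < y.trace :=
    lt_of_le_of_ne hyp.trace_nonneg fun h0 => hy0 (hyp.trace_eq_zero_iff.1 h0.symm)
  refine ⟨y.trace⁻¹ • y, ⟨hyp.smul (inv_nonneg.2 htr.le), ?_⟩, by rw [map_smul, hy]⟩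
  rw [Matrix.trace_smul, smul_eq_mul, inv_mul_cancel₀ htr.ne']

end PerronFrobenius

/-! ### Algebra of spectral projectors -/

section SpectralProjector

variable {V : Type*} [AddCommGroup V] [Module ℂ V] [FiniteDimensional ℂ V]

/-- Generalized eigenspaces span, and a spectral projector is 1 or 0 on each of them. Identities
between spectral projectors thus become case distinctions. -/
theorem end_ext_genEigenspace {Φ A B : Module.End ℂ V}
    (h : ∀ μ, ∀ x ∈ Φ.maxGenEigenspace μ, A x = B x) : A = B := by
  refine LinearMap.ext fun x => ?_
  have hx : x ∈ ⨆ μ, Φ.maxGenEigenspace μ := by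
    rw [Module.End.iSup_maxGenEigenspace_eq_top]
    trivial
  induction hx using Submodule.iSup_induction' with
  | mem μ x hx => exact h μ x hx
  | zero => rw [map_zero, map_zero]
  | add x y _ _ hx hy => rw [map_add, map_add, hx, hy]

theorem specProj_apply_of_mem (Φ : Module.End ℂ V) {M : Set ℂ} {μ : ℂ} (hμ : μ ∈ M) {x : V}
    (hx : x ∈ Φ.maxGenEigenspace μ) : specProj Φ M x = x := by
  rw [specProj, Submodule.projection_eq_self_iff]
  exact Submodule.mem_iSup_of_mem μ (Submodule.mem_iSup_of_mem hμ hx)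

theorem specProj_apply_of_notMem (Φ : Module.End ℂ V) {M : Set ℂ} {μ : ℂ} (hμ : μ ∉ M) {x : V}
    (hx : x ∈ Φ.maxGenEigenspace μ) : specProj Φ M x = 0 := by
  rw [specProj, Submodule.projection_apply_eq_zero_iff]
  exact Submodule.mem_iSup_of_mem μ (Submodule.mem_iSup_of_mem hμ hx)

theorem specProj_mul_of_disjoint (Φ : Module.End ℂ V) {M N : Set ℂ} (h : Disjoint M N) :
    specProj Φ M * specProj Φ N = 0 := by
  refine end_ext_genEigenspace (Φ := Φ) fun μ x hx => ?_
  rw [Module.End.mul_apply, LinearMap.zero_apply]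
  by_cases hμ : μ ∈ N
  · rw [specProj_apply_of_mem Φ hμ hx,
      specProj_apply_of_notMem Φ (fun hM => Set.disjoint_left.1 h hM hμ) hx]
  · rw [specProj_apply_of_notMem Φ hμ hx, map_zero]

theorem specProj_mul_of_subset (Φ : Module.End ℂ V) {M N : Set ℂ} (h : M ⊆ N) :
    specProj Φ M * specProj Φ N = specProj Φ M := by
  refine end_ext_genEigenspace (Φ := Φ) fun μ x hx => ?_
  rw [Module.End.mul_apply]
  by_cases hμ : μ ∈ N
  · rw [specProj_apply_of_mem Φ hμ hx]
  · rw [specProj_apply_of_notMem Φ hμ hx, map_zero,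
      specProj_apply_of_notMem Φ (fun hM => hμ (h hM)) hx]

theorem specProj_mul_self (Φ : Module.End ℂ V) (M : Set ℂ) :
    specProj Φ M * specProj Φ M = specProj Φ M :=
  specProj_mul_of_subset Φ subset_rfl

theorem specProj_comm (Φ : Module.End ℂ V) (M : Set ℂ) : Φ * specProj Φ M = specProj Φ M * Φ := by
  refine end_ext_genEigenspace (Φ := Φ) fun μ x hx => ?_
  have hx' : Φ x ∈ Φ.maxGenEigenspace μ :=
    Module.End.mapsTo_maxGenEigenspace_of_comm (Commute.refl Φ) μ hx
  rw [Module.End.mul_apply, Module.End.mul_apply]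
  by_cases hμ : μ ∈ M
  · rw [specProj_apply_of_mem Φ hμ hx, specProj_apply_of_mem Φ hμ hx']
  · rw [specProj_apply_of_notMem Φ hμ hx, specProj_apply_of_notMem Φ hμ hx', map_zero]

theorem specProj_eq_sum (Φ : Module.End ℂ V) {M : Set ℂ} {F : Finset ℂ}
    (hF : ∀ μ, μ ∈ F ↔ Φ.HasEigenvalue μ ∧ μ ∈ M) :
    specProj Φ M = ∑ μ ∈ F, specProj Φ {μ} := by
  refine end_ext_genEigenspace (Φ := Φ) fun μ x hx => ?_
  rw [LinearMap.sum_apply]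
  have hne : ∀ ν ∈ F, ν ≠ μ → specProj Φ {ν} x = 0 := fun ν _ hν =>
    specProj_apply_of_notMem Φ (M := {ν}) (fun h => hν (mem_singleton_iff.1 h).symm) hx
  by_cases hμ : μ ∈ F
  · rw [Finset.sum_eq_single_of_mem μ hμ hne, specProj_apply_of_mem Φ ((hF μ).1 hμ).2 hx,
      specProj_apply_of_mem Φ (mem_singleton μ) hx]
  · rw [Finset.sum_eq_zero fun ν hν => hne ν hν fun h => hμ (h ▸ hν)]
    by_cases hM : μ ∈ M
    · have hev : ¬ Φ.HasEigenvalue μ := fun h => hμ ((hF μ).2 ⟨h, hM⟩)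
      have : Φ.maxGenEigenspace μ = ⊥ := by
        by_contra hb
        exact hev (Module.End.HasUnifEigenvalue.lt zero_lt_one
          (show Φ.HasUnifEigenvalue μ ⊤ from hb))
      rw [this, Submodule.mem_bot] at hx
      rw [hx, map_zero]
    · exact specProj_apply_of_notMem Φ hM hx

theorem hasEigenvalue_of_not_injective {Φ : Module.End ℂ V} {e : ℂ}
    (h : ¬ Function.Injective (Φ - e • (1 : Module.End ℂ V))) : Φ.HasEigenvalue e := by
  rw [injective_iff_map_eq_zero] at h
  push Not at h
  obtain ⟨x, hx, hx0⟩ := h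
  refine Module.End.hasEigenvalue_of_hasEigenvector (x := x) ⟨?_, hx0⟩
  rw [Module.End.mem_eigenspace_iff]
  rwa [LinearMap.sub_apply, LinearMap.smul_apply, Module.End.one_apply, sub_eq_zero] at hx

theorem exists_finset_eigenvalues (Φ : Module.End ℂ V) :
    ∃ F : Finset ℂ, (∀ μ, μ ∈ F ↔ Φ.HasEigenvalue μ) ∧ F.card ≤ Module.finrank ℂ V := by
  refine ⟨Φ.charpoly.roots.toFinset, fun μ => ?_, ?_⟩
  · rw [Multiset.mem_toFinset, Polynomial.mem_roots Φ.charpoly_monic.ne_zero,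
      Module.End.hasEigenvalue_iff_isRoot_charpoly]
  · refine (Multiset.toFinset_card_le _).trans ((Polynomial.card_roots' _).trans ?_)
    rw [LinearMap.charpoly_natDegree]

end SpectralProjector

/-! ### Peripheral eigenvalues of irreducible Kraus maps -/

section Peripheral

variable {n ι : Type*} [Fintype n] [DecidableEq n] [Fintype ι]
variable {K : ι → Matrix n n ℂ} {Φ : SuperOp n}

theorem hasEigenvalue_of_traceDual {b : Matrix n n ℂ} {f : ℂ} (hb : b ≠ 0)
    (h : traceDual Φ b = f • b) : Φ.HasEigenvalue f := by
  refine hasEigenvalue_of_not_injective fun hinj => hb ?_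
  refine Matrix.ext_iff_trace_mul_right.2 fun B => ?_
  obtain ⟨C, rfl⟩ := LinearMap.surjective_of_injective hinj B
  rw [LinearMap.sub_apply, LinearMap.smul_apply, Module.End.one_apply, mul_sub, Matrix.trace_sub,
    ← trace_traceDual_mul, h, Matrix.smul_mul, Matrix.mul_smul, sub_self, zero_mul,
    Matrix.trace_zero]

theorem exists_traceDual_of_hasEigenvalue {e : ℂ} (h : Φ.HasEigenvalue e) :
    ∃ a : Matrix n n ℂ, a ≠ 0 ∧ traceDual Φ a = e • a := by
  by_contra! hc
  have hinj : Function.Injective (Φ - e • (1 : SuperOp n)) := by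
    refine injective_of_traceDual_injective fun A hA => ?_
    by_contra hA0
    refine hc A hA0 (Matrix.ext_iff_trace_mul_right.2 fun B => ?_)
    have := hA B
    rwa [LinearMap.sub_apply, LinearMap.smul_apply, Module.End.one_apply, mul_sub,
      Matrix.trace_sub, ← trace_traceDual_mul, sub_eq_zero, Matrix.mul_smul,
      ← Matrix.smul_mul] at this
  obtain ⟨x, hx⟩ := h.exists_hasEigenvector
  refine hx.2 (hinj ?_)
  rw [map_zero, LinearMap.sub_apply, LinearMap.smul_apply, Module.End.one_apply, hx.apply_eq_smul,
    sub_self]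

theorem mul_eq_zero_of_posDef {M ρ : Matrix n n ℂ} (hρ : ρ.PosDef)
    (h : (M * ρ * Mᴴ).trace = 0) : M = 0 := by
  obtain ⟨B, hB⟩ := exists_eq_conjTranspose_mul_self hρ.posSemidef
  have h1 : ((B * Mᴴ)ᴴ * (B * Mᴴ)).trace = 0 := by
    rw [← h, hB]
    simp only [Matrix.conjTranspose_mul, Matrix.conjTranspose_conjTranspose, mul_assoc]
  have h2 := Matrix.trace_conjTranspose_mul_self_eq_zero_iff.1 h1
  have h3 : ρ * Mᴴ = 0 := by rw [hB, mul_assoc, h2, mul_zero]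
  obtain ⟨u, hu⟩ := hρ.isUnit
  rw [← hu] at h3
  have h4 : Mᴴ = 0 := by
    rw [← one_mul Mᴴ, ← u.inv_mul, mul_assoc, h3, mul_zero]
  exact Matrix.conjTranspose_eq_zero.1 h4

/-- Peripheral eigenvectors of the dual map intertwine the Kraus operators. -/
theorem IsKraus.intertwines (h : IsKraus K Φ) {ρ : Matrix n n ℂ} (hρ : ρ.PosDef) (hinv : Φ ρ = ρ)
    {e : ℂ} (he : ‖e‖ = 1) {a : Matrix n n ℂ} (ha : traceDual Φ a = e • a) (i : ι) :
    a * K i = e • (K i * a) := by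
  have hee : star e * e = 1 := by
    have := Complex.conj_mul' e
    rw [he] at this
    simpa using this
  set M : ι → Matrix n n ℂ := fun i => a * K i - e • (K i * a) with hM
  -- The defects M i add up to the defect in the Kadison–Schwarz inequality, which has zero trace
  -- against the invariant ρ. Faithfulness of ρ then forces each M i to vanish.
  have hsum : ∑ i, (M i)ᴴ * M i = traceDual Φ (aᴴ * a) - aᴴ * a := by
    have h1 := ha
    rw [h.traceDual_apply] at h1
    have h2 : ∑ i, (K i)ᴴ * aᴴ * K i = star e • aᴴ := by
      rw [← Matrix.conjTranspose_smul, ← h1, Matrix.conjTranspose_sum]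
      refine Finset.sum_congr rfl fun i _ => ?_
      simp only [Matrix.conjTranspose_mul, Matrix.conjTranspose_conjTranspose, mul_assoc]
    have h3 : ∀ i, (M i)ᴴ * M i = (K i)ᴴ * (aᴴ * a) * K i - e • (((K i)ᴴ * aᴴ * K i) * a) -
        star e • (aᴴ * ((K i)ᴴ * a * K i)) + aᴴ * ((K i)ᴴ * K i) * a := by
      intro i
      have h4 : aᴴ * ((K i)ᴴ * K i) * a = (star e * e) • (aᴴ * ((K i)ᴴ * K i) * a) := by
        rw [hee, one_smul]
      rw [h4]
      simp only [hM, Matrix.conjTranspose_sub, Matrix.conjTranspose_smul, Matrix.conjTranspose_mul,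
        sub_mul, mul_sub, Matrix.smul_mul, Matrix.mul_smul, smul_smul, mul_assoc]
      rw [mul_comm e (star e)]
      abel
    simp only [h3, Finset.sum_add_distrib, Finset.sum_sub_distrib, ← Finset.smul_sum,
      ← Finset.sum_mul, ← Finset.mul_sum]
    rw [h2, h1, h.sum_eq_one, h.traceDual_apply, mul_one]
    simp only [Matrix.smul_mul, Matrix.mul_smul, smul_smul]
    rw [mul_comm e (star e), hee, one_smul]
    abel
  have htr : ∑ i, (M i * ρ * (M i)ᴴ).trace = 0 := by
    have h1 : ∀ i, (M i * ρ * (M i)ᴴ).trace = ((M i)ᴴ * M i * ρ).trace := fun i => by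
      rw [Matrix.trace_mul_cycle]
    simp only [h1]
    rw [← Matrix.trace_sum, ← Finset.sum_mul, hsum, sub_mul, Matrix.trace_sub,
      trace_traceDual_mul, hinv, sub_self]
  have h0 := (Finset.sum_eq_zero_iff_of_nonneg fun i _ =>
    (hρ.posSemidef.mul_mul_conjTranspose_same (M i)).trace_nonneg).1 htr i (Finset.mem_univ i)
  exact sub_eq_zero.1 (mul_eq_zero_of_posDef hρ h0)

/-- Subtract an eigenvalue of a: the difference still commutes with every Kraus operator but is not
invertible, so it is zero. -/
theorem IsKraus.scalar_of_commute [Nonempty n] (h : IsKraus K Φ) (hI : Irred Φ)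
    {a : Matrix n n ℂ} (ha : ∀ i, a * K i = K i * a) : ∃ z : ℂ, a = z • 1 := by
  obtain ⟨z, hz⟩ := spectrum.nonempty_of_isAlgClosed_of_finiteDimensional ℂ a
  refine ⟨z, ?_⟩
  have h1 : algebraMap ℂ (Matrix n n ℂ) z = z • 1 := Algebra.algebraMap_eq_smul_one z
  have hc : ∀ i, (z • 1 - a) * K i = (1 : ℂ) • (K i * (z • 1 - a)) := fun i => by
    simp [sub_mul, mul_sub, ha]
  rcases h.eq_zero_or_isUnit hI hc with h0 | h0
  · exact (sub_eq_zero.1 h0).symm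
  · rw [← h1] at h0
    exact absurd h0 hz

theorem IsKraus.scalar_of_traceDual_fixed [Nonempty n] (h : IsKraus K Φ) (hI : Irred Φ)
    {ρ : Matrix n n ℂ} (hρ : ρ.PosDef) (hinv : Φ ρ = ρ) {a : Matrix n n ℂ}
    (ha : traceDual Φ a = a) : ∃ z : ℂ, a = z • 1 :=
  h.scalar_of_commute hI fun i => by
    simpa using h.intertwines hρ hinv (e := 1) (by simp) (by rw [ha, one_smul]) i

/-- The operator `B ↦ B - Φ B + Tr B` is injective for irreducible `Φ`. -/
theorem IsKraus.injective_one_sub_add_trace [Nonempty n] (h : IsKraus K Φ) (hI : Irred Φ) :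
    Function.Injective
      (1 - Φ + (Matrix.traceLinearMap n ℂ ℂ).smulRight (1 : Matrix n n ℂ) : SuperOp n) := by
  obtain ⟨ρ, hρ, hinv⟩ := h.exists_invariant
  have hρ0 : ρ ≠ 0 := by
    rintro rfl
    simpa using hρ.2
  have hρd := h.posDef_of_invariant hI hρ.1 hρ0 hinv
  refine injective_of_traceDual_injective fun A hA => ?_
  have hA' : ∀ B, (A * B).trace - (A * Φ B).trace + B.trace * A.trace = 0 := by
    intro B
    have := hA B
    simpa [mul_add, mul_sub] using this
  -- Pairing with the invariant state isolates the trace of A; then A is a dual fixed point, hence a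
  -- scalar, hence zero.
  have htr : A.trace = 0 := by
    have := hA' ρ
    rwa [hinv, sub_self, zero_add, hρ.2, one_mul] at this
  have hfix : traceDual Φ A = A := by
    refine Matrix.ext_iff_trace_mul_right.2 fun B => ?_
    have := hA' B
    rw [htr, mul_zero, add_zero, sub_eq_zero] at this
    rw [trace_traceDual_mul, this]
  obtain ⟨z, rfl⟩ := h.scalar_of_traceDual_fixed hI hρd hinv hfix
  rw [Matrix.trace_smul, Matrix.trace_one, smul_eq_mul, mul_eq_zero] at htr
  rcases htr with h0 | h0
  · rw [h0, zero_smul]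
  · exact absurd h0 (Nat.cast_ne_zero.2 Fintype.card_ne_zero)

theorem IsKraus.eq_zero_of_fixed [Nonempty n] (h : IsKraus K Φ) (hI : Irred Φ)
    {x : Matrix n n ℂ} (hx : Φ x = x) (htr : x.trace = 0) : x = 0 := by
  refine h.injective_one_sub_add_trace hI ?_
  rw [map_zero]
  simp [hx, htr]

theorem IsKraus.existsUnique_invariant [Nonempty n] (h : IsKraus K Φ) (hI : Irred Φ) :
    ∃! ρ : Matrix n n ℂ, IsState ρ ∧ Φ ρ = ρ := by
  obtain ⟨ρ, hρ, hinv⟩ := h.exists_invariant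
  refine ⟨ρ, ⟨hρ, hinv⟩, fun σ hσ => sub_eq_zero.1 (h.eq_zero_of_fixed hI ?_ ?_)⟩
  · rw [map_sub, hσ.2, hinv]
  · rw [Matrix.trace_sub, hσ.1.2, hρ.2, sub_self]

theorem IsKraus.posDef_of_isState (h : IsKraus K Φ) (hI : Irred Φ) {ρ : Matrix n n ℂ}
    (hρ : IsState ρ) (hinv : Φ ρ = ρ) : ρ.PosDef := by
  refine h.posDef_of_invariant hI hρ.1 ?_ hinv
  rintro rfl
  simpa using hρ.2

/-- Each peripheral eigenvalue comes with a unitary intertwiner of the Kraus operators. -/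
theorem IsKraus.exists_unitary [Nonempty n] (h : IsKraus K Φ) (hI : Irred Φ) {e : ℂ}
    (hev : Φ.HasEigenvalue e) (he : ‖e‖ = 1) :
    ∃ a : Matrix n n ℂ, aᴴ * a = 1 ∧ ∀ i, a * K i = e • (K i * a) := by
  obtain ⟨ρ, hρ, hinv⟩ := h.exists_invariant
  have hρd := h.posDef_of_isState hI hρ hinv
  obtain ⟨a, ha0, ha⟩ := exists_traceDual_of_hasEigenvalue hev
  have hint := h.intertwines hρd hinv he ha
  have hee : star e * e = 1 := by
    have := Complex.conj_mul' e
    rw [he] at this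
    simpa using this
  -- The phases cancel, so aᴴ a is a dual fixed point and therefore a positive scalar; rescaling by
  -- its square root makes a unitary.
  have hfix : traceDual Φ (aᴴ * a) = aᴴ * a := by
    rw [h.traceDual_apply]
    have : ∀ i, (K i)ᴴ * (aᴴ * a) * K i = aᴴ * ((K i)ᴴ * K i) * a := by
      intro i
      calc (K i)ᴴ * (aᴴ * a) * K i = (a * K i)ᴴ * (a * K i) := by
            simp only [Matrix.conjTranspose_mul, mul_assoc]
        _ = (star e * e) • (aᴴ * ((K i)ᴴ * K i) * a) := by
            rw [hint, Matrix.conjTranspose_smul, Matrix.smul_mul, Matrix.mul_smul, smul_smul,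
              Matrix.conjTranspose_mul]
            simp only [mul_assoc]
        _ = _ := by rw [hee, one_smul]
    simp only [this]
    rw [← Finset.sum_mul, ← Finset.mul_sum, h.sum_eq_one, mul_one]
  obtain ⟨z, hz⟩ := h.scalar_of_traceDual_fixed hI hρd hinv hfix
  obtain ⟨i₀⟩ := ‹Nonempty n›
  have hz0 : 0 ≤ z := by
    have := (Matrix.posSemidef_conjTranspose_mul_self a).diag_nonneg (i := i₀)
    rw [hz] at this
    simpa using this
  have hzne : z ≠ 0 := by
    rintro rfl
    rw [zero_smul] at hz
    exact ha0 (Matrix.conjTranspose_mul_self_eq_zero.1 hz)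
  obtain ⟨hr, hi⟩ := Complex.nonneg_iff.1 hz0
  have hzr : z = (z.re : ℂ) := Complex.ext rfl (by simpa using hi.symm)
  have hrpos : 0 < z.re := lt_of_le_of_ne hr fun h0 => hzne (by rw [hzr, ← h0]; simp)
  refine ⟨((√z.re)⁻¹ : ℂ) • a, ?_, fun i => ?_⟩
  · rw [Matrix.conjTranspose_smul, Matrix.smul_mul, Matrix.mul_smul, smul_smul, hz, smul_smul]
    have : star ((√z.re : ℂ)⁻¹) * (√z.re : ℂ)⁻¹ * z = 1 := by
      have h2 : (√z.re : ℂ) * (√z.re : ℂ) = z := by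
        rw [← Complex.ofReal_mul, Real.mul_self_sqrt hr, ← hzr]
      have h3 : (√z.re : ℂ) ≠ 0 := by
        exact_mod_cast (Real.sqrt_pos.2 hrpos).ne'
      have h4 : star ((√z.re : ℂ)⁻¹) = (√z.re : ℂ)⁻¹ := by simp
      rw [h4]
      nth_rw 3 [← h2]
      field_simp
    rw [this, one_smul]
  · rw [Matrix.smul_mul, hint, Matrix.mul_smul, smul_comm]

theorem IsKraus.traceDual_of_intertwines (h : IsKraus K Φ) {a : Matrix n n ℂ} {e : ℂ}
    (ha : ∀ i, a * K i = e • (K i * a)) : traceDual Φ a = e • a := by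
  rw [h.traceDual_apply]
  have : ∀ i, (K i)ᴴ * a * K i = e • ((K i)ᴴ * K i * a) := by
    intro i
    rw [mul_assoc, ha, Matrix.mul_smul, mul_assoc]
  simp only [this]
  rw [← Finset.smul_sum, ← Finset.sum_mul, h.sum_eq_one, one_mul]

theorem IsKraus.apply_mul_of_intertwines (h : IsKraus K Φ) {a : Matrix n n ℂ} {e : ℂ}
    (ha : ∀ i, a * K i = e • (K i * a)) (x : Matrix n n ℂ) : e • Φ (a * x) = a * Φ x := by
  rw [h.apply_eq, h.apply_eq, Finset.smul_sum, Finset.mul_sum]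
  refine Finset.sum_congr rfl fun i _ => ?_
  rw [← mul_assoc, ← mul_assoc, ← mul_assoc, ha]
  simp only [Matrix.smul_mul]

/-- Multiplication by a turns an e-eigenvector of Φ into a fixed point, so simplicity of the
eigenvalue 1 transfers to e. -/
theorem IsKraus.eq_zero_of_eigen [Nonempty n] (h : IsKraus K Φ) (hI : Irred Φ) {e : ℂ}
    (he : ‖e‖ = 1) {a : Matrix n n ℂ} (hu : aᴴ * a = 1) (ha : ∀ i, a * K i = e • (K i * a))
    {x : Matrix n n ℂ} (hx : Φ x = e • x) (htr : (a * x).trace = 0) : x = 0 := by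
  have he0 : e ≠ 0 := by
    rintro rfl
    simp at he
  have h1 := h.apply_mul_of_intertwines ha x
  rw [hx, Matrix.mul_smul] at h1
  have h2 := h.eq_zero_of_fixed hI (smul_right_injective _ he0 h1) htr
  rw [← one_mul x, ← hu, mul_assoc, h2, mul_zero]

/-- The spectral projector of a peripheral eigenvalue. -/
theorem IsKraus.specProj_apply [Nonempty n] (h : IsKraus K Φ) (hI : Irred Φ) {ρ : Matrix n n ℂ}
    (hρ : IsState ρ) (hinv : Φ ρ = ρ) {e : ℂ} (he : ‖e‖ = 1) {a : Matrix n n ℂ}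
    (hu : aᴴ * a = 1) (ha : ∀ i, a * K i = e • (K i * a)) (A : Matrix n n ℂ) :
    specProj Φ {e} A = (a * A).trace • (aᴴ * ρ) := by
  have hu' : a * aᴴ = 1 := mul_eq_one_comm.mp hu
  have he0 : e ≠ 0 := by
    rintro rfl
    simp at he
  have hdual := h.traceDual_of_intertwines ha
  have hx0 : Φ (aᴴ * ρ) = e • (aᴴ * ρ) := by
    have h1 := h.apply_mul_of_intertwines ha (aᴴ * ρ)
    rw [← mul_assoc, hu', one_mul, hinv] at h1
    rw [← one_mul (Φ (aᴴ * ρ)), ← hu, mul_assoc, ← h1, Matrix.mul_smul]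
  -- The functional Tr(a ·) is a left eigenvector. It therefore kills every generalized eigenspace
  -- other than that of e.
  have hpow : ∀ (k : ℕ) (μ : ℂ) (x : Matrix n n ℂ),
      (a * ((Φ - algebraMap ℂ (SuperOp n) μ) ^ k) x).trace = (e - μ) ^ k * (a * x).trace := by
    intro k μ
    induction k with
    | zero => intro x; simp
    | succ k ih =>
      intro x
      rw [pow_succ, Module.End.mul_apply, ih, LinearMap.sub_apply, mul_sub, Matrix.trace_sub,
        ← trace_traceDual_mul, hdual, Module.algebraMap_end_apply]
      simp only [Matrix.smul_mul, Matrix.mul_smul, Matrix.trace_smul, smul_eq_mul]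
      ring
  set Pe : SuperOp n :=
    ((Matrix.traceLinearMap n ℂ ℂ).comp (LinearMap.mulLeft ℂ a)).smulRight (aᴴ * ρ) with hPe
  have hPea : ∀ x, Pe x = (a * x).trace • (aᴴ * ρ) := fun x => by simp [hPe]
  rw [← hPea]
  refine LinearMap.congr_fun (end_ext_genEigenspace (Φ := Φ) fun μ x hx => ?_) A
  rw [hPea]
  obtain ⟨k, hk⟩ := Module.End.mem_maxGenEigenspace _ _ _ |>.1 hx
  rw [← Algebra.algebraMap_eq_smul_one] at hk
  by_cases hμ : μ = e
  · subst hμ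
    rw [specProj_apply_of_mem Φ (mem_singleton μ) hx]
    -- Absence of Jordan blocks: on the kernel of Tr(a ·), Φ − e is injective.
    have hkey : ∀ (k : ℕ) (y : Matrix n n ℂ), (a * y).trace = 0 →
        ((Φ - algebraMap ℂ (SuperOp n) μ) ^ k) y = 0 → y = 0 := by
      intro k
      induction k with
      | zero => intro y _ hy; simpa using hy
      | succ k ih =>
        intro y hy hyk
        rw [pow_succ, Module.End.mul_apply] at hyk
        have h1 := ih _ (by
          have := hpow 1 μ y
          rwa [pow_one, sub_self, pow_one, zero_mul] at this) hyk
        rw [LinearMap.sub_apply, Module.algebraMap_end_apply, sub_eq_zero] at h1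
        exact h.eq_zero_of_eigen hI he hu ha h1 hy
    have htr : (a * (x - (a * x).trace • (aᴴ * ρ))).trace = 0 := by
      rw [mul_sub, Matrix.mul_smul, ← mul_assoc, hu', one_mul, Matrix.trace_sub,
        Matrix.trace_smul, hρ.2, smul_eq_mul, mul_one, sub_self]
    refine sub_eq_zero.1 (hkey (k + 1) _ htr ?_)
    have h1 : ((Φ - algebraMap ℂ (SuperOp n) μ) ^ (k + 1)) x = 0 := by
      rw [pow_succ', Module.End.mul_apply, hk, map_zero]
    have h2 : ((Φ - algebraMap ℂ (SuperOp n) μ) ^ (k + 1)) (aᴴ * ρ) = 0 := by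
      rw [pow_succ, Module.End.mul_apply, LinearMap.sub_apply, Module.algebraMap_end_apply, hx0,
        sub_self, map_zero]
    rw [map_sub, map_smul, h1, h2, smul_zero, sub_zero]
  · rw [specProj_apply_of_notMem Φ (M := {e}) hμ hx]
    have h1 := hpow k μ x
    rw [hk, mul_zero, Matrix.trace_zero] at h1
    have h2 : (a * x).trace = 0 := by
      rcases mul_eq_zero.1 h1.symm with h3 | h3
      · exact absurd (sub_eq_zero.1 (eq_zero_of_pow_eq_zero h3)).symm hμ
      · exact h3
    rw [h2, zero_smul]

theorem IsKraus.specProj_one_apply [Nonempty n] (h : IsKraus K Φ) (hI : Irred Φ)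
    {ρ : Matrix n n ℂ} (hρ : IsState ρ) (hinv : Φ ρ = ρ) (A : Matrix n n ℂ) :
    specProj Φ {1} A = A.trace • ρ := by
  have := h.specProj_apply hI hρ hinv (e := 1) (a := 1) (by simp) (by simp) (by simp) A
  simpa using this

theorem IsKraus.traceNorm_specProj_le [Nonempty n] (h : IsKraus K Φ) (hI : Irred Φ) {e : ℂ}
    (hev : Φ.HasEigenvalue e) (he : ‖e‖ = 1) (A : Matrix n n ℂ) :
    traceNorm (specProj Φ {e} A) ≤ traceNorm A := by
  obtain ⟨ρ, hρ, hinv⟩ := h.exists_invariant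
  obtain ⟨a, hu, ha⟩ := h.exists_unitary hI hev he
  rw [h.specProj_apply hI hρ hinv he hu ha, traceNorm_smul]
  have h1 : ‖a‖ ≤ 1 := norm_le_one_of_unitary hu
  have h2 : traceNorm (aᴴ * ρ) ≤ 1 := by
    refine (traceNorm_mul_le _ _).trans ?_
    rwa [traceNorm_of_isState hρ, mul_one, Matrix.l2_opNorm_conjTranspose]
  calc _ ≤ traceNorm A * 1 := mul_le_mul (norm_trace_mul_le_of_norm_le_one h1 A) h2
        (traceNorm_nonneg _) (traceNorm_nonneg _)
    _ = _ := mul_one _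

/-- The order of every peripheral eigenvalue divides `((dim)²)!`. -/
theorem IsKraus.pow_factorial_eq_one [Nonempty n] (h : IsKraus K Φ) (hI : Irred Φ) {e : ℂ}
    (hev : Φ.HasEigenvalue e) (he : ‖e‖ = 1) : e ^ (Fintype.card n ^ 2).factorial = 1 := by
  obtain ⟨a, hu, ha⟩ := h.exists_unitary hI hev he
  have he0 : e ≠ 0 := by
    rintro rfl
    simp at he
  have hpow : ∀ (j : ℕ) i, a ^ j * K i = e ^ j • (K i * a ^ j) := by
    intro j i
    induction j with
    | zero => simp
    | succ j ih =>
      rw [pow_succ, mul_assoc, ha, Matrix.mul_smul, ← mul_assoc, ih, Matrix.smul_mul, smul_smul,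
        mul_assoc, pow_succ e, mul_comm e]
  have hua : IsUnit a := isUnit_iff_exists.2 ⟨aᴴ, mul_eq_one_comm.mp hu, hu⟩
  -- Powers of a are invertible, hence nonzero, and intertwine with the powers of e. There are at
  -- most n² eigenvalues, so two of these powers coincide.
  have hevj : ∀ j : ℕ, Φ.HasEigenvalue (e ^ j) := fun j =>
    hasEigenvalue_of_traceDual (hua.pow j).ne_zero (h.traceDual_of_intertwines (hpow j))
  obtain ⟨F, hF, hcard⟩ := exists_finset_eigenvalues Φ
  rw [Module.finrank_matrix, Module.finrank_self, mul_one, ← pow_two] at hcard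
  obtain ⟨i, hi, j, hj, hij, heq⟩ := Finset.exists_ne_map_eq_of_card_lt_of_maps_to
    (s := Finset.range (Fintype.card n ^ 2 + 1)) (t := F) (f := fun j => e ^ j)
    (by rw [Finset.card_range]; omega) (fun j _ => (hF _).2 (hevj j))
  wlog hlt : i < j generalizing i j
  · exact this j hj i hi hij.symm heq.symm (by omega)
  simp only [Finset.mem_range] at hi hj
  have h1 : e ^ (j - i) = 1 := by
    have h2 : e ^ i * e ^ (j - i) = e ^ i * 1 := by
      rw [← pow_add, mul_one, Nat.add_sub_cancel' hlt.le]
      exact heq.symm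
    exact mul_left_cancel₀ (pow_ne_zero i he0) h2
  obtain ⟨c, hc⟩ := Nat.dvd_factorial (m := j - i) (n := Fintype.card n ^ 2) (by omega) (by omega)
  rw [hc, pow_mul, h1, one_pow]

end Peripheral

/-! ### Smoothness of invariant states and peripheral projectors -/

section Smoothness

open Filter Topology

/-- Solutions of a `C²` family of linear equations depend on the parameter in a `C²` way. -/
theorem exists_contDiffWithinAt_solution {V : Type*} [NormedAddCommGroup V] [NormedSpace ℂ V]
    [FiniteDimensional ℂ V] {B : ℝ → Module.End ℂ V} {I : Set ℝ} {s : ℝ} (hs : s ∈ I)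
    (hB : ∀ x, ContDiffOn ℝ 2 (fun t => B t x) I) (hinj : Function.Injective (B s)) (v : V) :
    ∃ g : ℝ → V, ContDiffWithinAt ℝ 2 g I s ∧
      ∀ᶠ t in 𝓝[I] s, Function.Injective (B t) ∧ B t (g t) = v := by
  have : FiniteDimensional ℝ V := FiniteDimensional.complexToReal V
  have : CompleteSpace V := FiniteDimensional.complete ℂ V
  set Bc : ℝ → (V →L[ℝ] V) := fun t =>
    LinearMap.toContinuousLinearMap ((B t).restrictScalars ℝ) with hBc
  have hBa : ∀ t x, Bc t x = B t x := fun t x => rfl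
  have hsm : ContDiffOn ℝ 2 Bc I := contDiffOn_clm_apply.2 hB
  have hu : IsUnit (Bc s) := by
    rw [ContinuousLinearMap.isUnit_iff_bijective]
    exact ⟨hinj, LinearMap.surjective_of_injective hinj⟩
  obtain ⟨u, hu⟩ := hu
  -- `Ring.inverse` is 0 off the units, but invertibility is an open condition, so near s this is
  -- the true inverse.
  refine ⟨fun t => Ring.inverse (Bc t) v, ?_, ?_⟩
  · have h1 : ContDiffAt ℝ 2 (Ring.inverse : (V →L[ℝ] V) → _) (Bc s) :=
      hu ▸ contDiffAt_ringInverse ℝ u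
    exact (h1.comp_contDiffWithinAt s (hsm s hs)).clm_apply contDiffWithinAt_const
  · have h2 : ∀ᶠ T in 𝓝 (Bc s), IsUnit T :=
      Units.isOpen.mem_nhds (show IsUnit (Bc s) from ⟨u, hu⟩)
    filter_upwards [(hsm.continuousOn s hs).tendsto.eventually h2] with t ht
    refine ⟨(ContinuousLinearMap.isUnit_iff_bijective.1 ht).1, ?_⟩
    rw [← hBa, ← mul_apply_eq_comp, Ring.mul_inverse_cancel _ ht]
    rfl

theorem contDiff_trace {n : Type*} [Fintype n] [DecidableEq n] :
    ContDiff ℝ 2 (Matrix.trace : Matrix n n ℂ → ℂ) :=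
  (LinearMap.toContinuousLinearMap
    ((Matrix.traceLinearMap n ℂ ℂ).restrictScalars ℝ)).contDiff

theorem contDiffOn_matrix_iff {n : Type*} [Fintype n] [DecidableEq n] {f : ℝ → Matrix n n ℂ}
    {I : Set ℝ} : ContDiffOn ℝ 2 f I ↔ ∀ i j, ContDiffOn ℝ 2 (fun t => f t i j) I := by
  refine ⟨fun h i j => ?_, fun h => ?_⟩
  · exact (LinearMap.toContinuousLinearMap
      ((Matrix.entryLinearMap ℂ ℂ i j).restrictScalars ℝ)).contDiff.comp_contDiffOn h
  · have h1 : f = fun t => ∑ i, ∑ j, f t i j • Matrix.single i j (1 : ℂ) := by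
      ext1 t
      conv_lhs => rw [Matrix.matrix_eq_sum_single (f t)]
      simp [Matrix.smul_single]
    rw [h1]
    exact ContDiffOn.sum fun i _ => ContDiffOn.sum fun j _ => (h i j).smul contDiffOn_const

variable {n ι : Type*} [Fintype n] [DecidableEq n] [Nonempty n] [Fintype ι]

/-- A `C²` family of irreducible trace preserving completely positive maps. -/
structure IsIrredFamily (ι : Type*) [Fintype ι] (Φ : ℝ → SuperOp n) : Prop where
  kraus : ∀ s ∈ Icc (0 : ℝ) 1, ∃ K : ι → Matrix n n ℂ, IsKraus K (Φ s)
  irred : ∀ s ∈ Icc (0 : ℝ) 1, Irred (Φ s)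
  smooth : ∀ A, ContDiffOn ℝ 2 (fun t => Φ t A) (Icc 0 1)

variable {Φ : ℝ → SuperOp n}

theorem IsIrredFamily.contDiffOn_traceDual (h : IsIrredFamily ι Φ) (A : Matrix n n ℂ) :
    ContDiffOn ℝ 2 (fun t => traceDual (Φ t) A) (Icc 0 1) :=
  contDiffOn_matrix_iff.2 fun i j =>
    contDiff_trace.comp_contDiffOn (contDiffOn_const.mul (h.smooth (Matrix.single j i 1)))

theorem IsIrredFamily.existsUnique_invariant (h : IsIrredFamily ι Φ) {s : ℝ}
    (hs : s ∈ Icc (0 : ℝ) 1) : ∃! ρ : Matrix n n ℂ, IsState ρ ∧ Φ s ρ = ρ := by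
  obtain ⟨K, hK⟩ := h.kraus s hs
  exact hK.existsUnique_invariant (h.irred s hs)

theorem IsIrredFamily.contDiffOn_invariant (h : IsIrredFamily ι Φ) {ρ : ℝ → Matrix n n ℂ}
    (hρ : ∀ s ∈ Icc (0 : ℝ) 1, IsState (ρ s) ∧ Φ s (ρ s) = ρ s) :
    ContDiffOn ℝ 2 ρ (Icc 0 1) := by
  intro s hs
  obtain ⟨K, hK⟩ := h.kraus s hs
  -- The invariant state solves B t ρ = 1: the fixed-point equation plus a rank-one trace term that
  -- removes the kernel.
  set B : ℝ → SuperOp n := fun t =>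
    1 - Φ t + (Matrix.traceLinearMap n ℂ ℂ).smulRight (1 : Matrix n n ℂ) with hB
  have hBs : ∀ x, ContDiffOn ℝ 2 (fun t => B t x) (Icc 0 1) := fun x =>
    (contDiffOn_const.sub (h.smooth x)).add contDiffOn_const
  obtain ⟨g, hg, hev⟩ := exists_contDiffWithinAt_solution hs hBs
    (hK.injective_one_sub_add_trace (h.irred s hs)) 1
  have heq : ∀ᶠ t in 𝓝[Icc 0 1] s, ρ t = g t := by
    filter_upwards [hev, self_mem_nhdsWithin] with t ht htI
    refine ht.1 ?_
    rw [ht.2]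
    obtain ⟨h1, h2⟩ := hρ t htI
    simp [hB, h2, h1.2]
  exact hg.congr_of_eventuallyEq heq (heq.self_of_nhdsWithin hs)

/-- The phases in aᴴ b cancel, so it commutes with all Kraus operators and is a scalar: dual
peripheral eigenspaces are lines. -/
theorem IsKraus.eq_smul_of_traceDual {K : ι → Matrix n n ℂ} {Ψ : SuperOp n} (h : IsKraus K Ψ)
    (hI : Irred Ψ) {e : ℂ} (he : ‖e‖ = 1) {a b : Matrix n n ℂ} (hu : aᴴ * a = 1)
    (ha : ∀ i, a * K i = e • (K i * a)) (hb : traceDual Ψ b = e • b) : ∃ z : ℂ, b = z • a := by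
  obtain ⟨ρ, hρ, hinv⟩ := h.exists_invariant
  have hu' : a * aᴴ = 1 := mul_eq_one_comm.mp hu
  have hb' := h.intertwines (h.posDef_of_isState hI hρ hinv) hinv he hb
  have ha' : ∀ i, K i * aᴴ = e • (aᴴ * K i) := fun i => by
    calc K i * aᴴ = aᴴ * (a * K i) * aᴴ := by rw [← mul_assoc, hu, one_mul]
      _ = e • (aᴴ * K i * (a * aᴴ)) := by
        rw [ha, Matrix.mul_smul, Matrix.smul_mul]
        simp only [mul_assoc]
      _ = _ := by rw [hu', mul_one]
  obtain ⟨z, hz⟩ := h.scalar_of_commute hI (a := aᴴ * b) fun i => by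
    rw [mul_assoc, hb', Matrix.mul_smul, ← mul_assoc, ← mul_assoc, ha', Matrix.smul_mul]
  refine ⟨z, ?_⟩
  rw [← one_mul b, ← hu', mul_assoc, hz, Matrix.mul_smul, mul_one]

theorem IsIrredFamily.contDiffOn_specProj (h : IsIrredFamily ι Φ) {e : ℂ} (he : ‖e‖ = 1)
    (hev : ∀ s ∈ Icc (0 : ℝ) 1, (Φ s).HasEigenvalue e) (A : Matrix n n ℂ) :
    ContDiffOn ℝ 2 (fun t => specProj (Φ t) {e} A) (Icc 0 1) := by
  choose! ρ hρ _ using fun s (hs : s ∈ Icc (0 : ℝ) 1) => h.existsUnique_invariant hs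
  have hρs := h.contDiffOn_invariant hρ
  intro s hs
  obtain ⟨K, hK⟩ := h.kraus s hs
  obtain ⟨hρ1, hρ2⟩ := hρ s hs
  obtain ⟨a₀, hu, ha⟩ := hK.exists_unitary (h.irred s hs) (hev s hs) he
  have hu' : a₀ * a₀ᴴ = 1 := mul_eq_one_comm.mp hu
  have hdual := hK.traceDual_of_intertwines ha
  set x₀ := a₀ᴴ * ρ s with hx₀
  have hx₀e : Φ s x₀ = e • x₀ := by
    have h1 := hK.apply_mul_of_intertwines ha x₀
    rw [hx₀, ← mul_assoc, hu', one_mul, hρ2] at h1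
    rw [← one_mul (Φ s x₀), ← hu, mul_assoc, hx₀, ← h1, Matrix.mul_smul]
  have hx₀a : (x₀ * a₀).trace = 1 := by
    rw [Matrix.trace_mul_comm, hx₀, ← mul_assoc, hu', one_mul, hρ1.2]
  set τ : Matrix n n ℂ →ₗ[ℂ] ℂ :=
    (Matrix.traceLinearMap n ℂ ℂ).comp (LinearMap.mulLeft ℂ x₀) with hτ
  have hτa : ∀ y, τ y = (x₀ * y).trace := fun y => by simp [hτ]
  -- A bordered system: its solution for the right-hand side a₀ is the dual eigenvector at t
  -- normalized by Tr(x₀ ·) = 1. The normalization picks a C² choice of the eigenvector, which is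
  -- unitary only up to a scalar.
  set B : ℝ → SuperOp n := fun t => e • (1 : SuperOp n) - traceDual (Φ t) + τ.smulRight a₀ with hB
  have hBa : ∀ t y, B t y = e • y - traceDual (Φ t) y + (x₀ * y).trace • a₀ := fun t y => by
    simp [hB, hτa]
  have hBs : ∀ y, ContDiffOn ℝ 2 (fun t => B t y) (Icc 0 1) := fun y => by
    simp only [hBa]
    exact (contDiffOn_const.sub (h.contDiffOn_traceDual y)).add contDiffOn_const
  have hinj : Function.Injective (B s) := by
    rw [injective_iff_map_eq_zero]
    intro y hy
    rw [hBa] at hy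
    have h1 : (x₀ * y).trace = 0 := by
      have h2 := congrArg (fun M => (x₀ * M).trace) hy
      simp only [mul_add, mul_sub, Matrix.mul_smul, Matrix.trace_add, Matrix.trace_sub,
        Matrix.trace_smul, hx₀a, smul_eq_mul, mul_zero, Matrix.trace_zero] at h2
      rw [Matrix.trace_mul_comm x₀ (traceDual _ _), trace_traceDual_mul, hx₀e, Matrix.mul_smul,
        Matrix.trace_smul, smul_eq_mul, Matrix.trace_mul_comm y x₀, sub_self, zero_add,
        mul_one] at h2
      exact h2
    rw [h1, zero_smul, add_zero, sub_eq_zero] at hy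
    obtain ⟨z, rfl⟩ := hK.eq_smul_of_traceDual (h.irred s hs) he hu ha hy.symm
    rw [Matrix.mul_smul, Matrix.trace_smul, hx₀a, smul_eq_mul, mul_one] at h1
    rw [h1, zero_smul]
  obtain ⟨g, hg, hevt⟩ := exists_contDiffWithinAt_solution hs hBs hinj a₀
  -- The rank-one formula is invariant under rescaling a when the adjoint is replaced by the
  -- inverse, so the non-unitary g t may be used.
  have hform : ∀ᶠ t in 𝓝[Icc 0 1] s, IsUnit (g t) ∧
      specProj (Φ t) {e} A = (g t * A).trace • (Ring.inverse (g t) * ρ t) := by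
    filter_upwards [hevt, self_mem_nhdsWithin] with t ht htI
    obtain ⟨K', hK'⟩ := h.kraus t htI
    obtain ⟨hσ1, hσ2⟩ := hρ t htI
    obtain ⟨a, hua, haa⟩ := hK'.exists_unitary (h.irred t htI) (hev t htI) he
    have hua' : a * aᴴ = 1 := mul_eq_one_comm.mp hua
    have h1 : B t a = (x₀ * a).trace • a₀ := by
      rw [hBa, hK'.traceDual_of_intertwines haa, sub_self, zero_add]
    have hz : (x₀ * a).trace ≠ 0 := by
      intro h0
      rw [h0, zero_smul] at h1
      have h2 : a = 0 := ht.1 (h1.trans (map_zero _).symm)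
      rw [h2, mul_zero] at hua
      exact zero_ne_one hua
    set z := (x₀ * a).trace
    have hga : g t = z⁻¹ • a := by
      refine ht.1 ?_
      rw [ht.2, map_smul, h1, smul_smul, inv_mul_cancel₀ hz, one_smul]
    have hm1 : g t * (z • aᴴ) = 1 := by
      rw [hga, Matrix.smul_mul, Matrix.mul_smul, smul_smul, inv_mul_cancel₀ hz, one_smul, hua']
    have hm2 : (z • aᴴ) * g t = 1 := mul_eq_one_comm.mp hm1
    have hinv : Ring.inverse (g t) = z • aᴴ :=
      Ring.inverse_unit (⟨g t, z • aᴴ, hm1, hm2⟩ : (Matrix n n ℂ)ˣ)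
    refine ⟨isUnit_iff_exists.2 ⟨_, hm1, hm2⟩, ?_⟩
    rw [hK'.specProj_apply (h.irred t htI) hσ1 hσ2 he hua haa, hinv, hga, Matrix.smul_mul,
      Matrix.trace_smul, Matrix.smul_mul, smul_smul, smul_eq_mul]
    congr 1
    field_simp
  have hsm : ContDiffWithinAt ℝ 2 (fun t => (g t * A).trace • (Ring.inverse (g t) * ρ t))
      (Icc 0 1) s := by
    obtain ⟨u, hu⟩ := (hform.self_of_nhdsWithin hs).1
    have h1 : ContDiffAt ℝ 2 (Ring.inverse : Matrix n n ℂ → _) (g s) :=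
      hu ▸ contDiffAt_ringInverse ℝ u
    have h2 := h1.comp_contDiffWithinAt s hg
    exact (contDiff_trace.contDiffAt.comp_contDiffWithinAt s
      (hg.mul contDiffWithinAt_const)).smul (h2.mul (hρs s hs))
  have heq : ∀ᶠ t in 𝓝[Icc 0 1] s,
      specProj (Φ t) {e} A = (g t * A).trace • (Ring.inverse (g t) * ρ t) :=
    hform.mono fun t ht => ht.2
  exact hsm.congr_of_eventuallyEq heq (heq.self_of_nhdsWithin hs)

/-- Continuous branches of peripheral eigenvalues are constant. -/
theorem IsIrredFamily.branch_const (h : IsIrredFamily ι Φ) {e : ℝ → ℂ} (he : IsPeriBranch Φ e) :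
    ∀ s ∈ Icc (0 : ℝ) 1, e s = e 0 := by
  set N := (Fintype.card n ^ 2).factorial with hN
  have hfin : {z : ℂ | z ^ N = 1}.Finite := by
    have := Polynomial.nthRoots N (1 : ℂ) |>.toFinset.finite_toSet
    refine this.subset fun z hz => ?_
    rw [Finset.mem_coe, Multiset.mem_toFinset, Polynomial.mem_nthRoots (Nat.factorial_pos _)]
    exact hz
  have hmaps : MapsTo e (Icc 0 1) {z : ℂ | z ^ N = 1} := fun s hs => by
    obtain ⟨K, hK⟩ := h.kraus s hs
    exact hK.pow_factorial_eq_one (h.irred s hs) (he.2 s hs).1 (he.2 s hs).2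
  intro s hs
  -- The branch takes values in a finite set of roots of unity, and its image is connected.
  have hpre : IsPreconnected (e '' Icc 0 1) := isPreconnected_Icc.image e he.1
  have h0 : (0 : ℝ) ∈ Icc (0 : ℝ) 1 := by simp
  exact hfin.countable.isTotallyDisconnected _ hmaps.image_subset hpre
    (mem_image_of_mem e hs) (mem_image_of_mem e h0)

theorem iteratedDerivWithin_clm_comp {F G : Type*} [NormedAddCommGroup F] [NormedSpace ℝ F]
    [NormedAddCommGroup G] [NormedSpace ℝ G] (L : F →L[ℝ] G) {f : ℝ → F}
    (hf : ContDiffOn ℝ 2 f (Icc 0 1)) {s : ℝ} (hs : s ∈ Icc (0 : ℝ) 1) {α : ℕ} (hα : α ≤ 2) :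
    iteratedDerivWithin α (fun t => L (f t)) (Icc 0 1) s =
      L (iteratedDerivWithin α f (Icc 0 1) s) := by
  have h := L.iteratedFDerivWithin_comp_left (hf s hs) (uniqueDiffOn_Icc zero_lt_one) hs
    (i := α) (by exact_mod_cast hα)
  rw [iteratedDerivWithin_eq_iteratedFDerivWithin, iteratedDerivWithin_eq_iteratedFDerivWithin]
  exact congrArg (fun M => M fun _ => (1 : ℝ)) h

theorem IsIrredFamily.exists_bound (h : IsIrredFamily ι Φ) {e : ℂ} (he : ‖e‖ = 1)
    (hev : ∀ s ∈ Icc (0 : ℝ) 1, (Φ s).HasEigenvalue e) :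
    ∃ c : ℝ, 0 ≤ c ∧ ∀ s ∈ Icc (0 : ℝ) 1, ∀ α : ℕ, α = 1 ∨ α = 2 → ∀ A : Matrix n n ℂ,
      traceNorm (iteratedDerivWithin α (fun t => specProj (Φ t) {e} A) (Icc 0 1) s)
        ≤ c * traceNorm A := by
  have hsm := h.contDiffOn_specProj he hev
  have hb : ∀ (α : ℕ) (A : Matrix n n ℂ), ∃ c : ℝ, 0 ≤ c ∧ (α ≤ 2 → ∀ s ∈ Icc (0 : ℝ) 1,
      traceNorm (iteratedDerivWithin α (fun t => specProj (Φ t) {e} A) (Icc 0 1) s) ≤ c) := by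
    intro α A
    by_cases hα : α ≤ 2
    · have hc := (hsm A).continuousOn_iteratedDerivWithin (m := α) (by exact_mod_cast hα)
        (uniqueDiffOn_Icc zero_lt_one)
      obtain ⟨C, hC⟩ := isCompact_Icc.exists_bound_of_continuousOn hc
      have hC0 : 0 ≤ C := (norm_nonneg _).trans (hC 0 (by simp))
      refine ⟨Fintype.card n * C, by positivity, fun _ s hs => ?_⟩
      exact (traceNorm_le_card_mul_norm _).trans (by gcongr; exact hC s hs)
    · exact ⟨0, le_rfl, fun h => absurd h hα⟩
  choose c hc0 hc using hb
  -- Expand A in matrix units, whose coefficients are bounded by the trace norm; adding the bounds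
  -- for both orders serves α = 1 and α = 2 at once.
  refine ⟨∑ i, ∑ j, (c 1 (Matrix.single i j 1) + c 2 (Matrix.single i j 1)),
    Finset.sum_nonneg fun i _ => Finset.sum_nonneg fun j _ => add_nonneg (hc0 _ _) (hc0 _ _),
    fun s hs α hα A => ?_⟩
  have hα2 : α ≤ 2 := by omega
  have hsum : (fun t => specProj (Φ t) {e} A) =
      fun t => ∑ i, ∑ j, A i j • specProj (Φ t) {e} (Matrix.single i j 1) := by
    ext1 t
    conv_lhs => rw [Matrix.matrix_eq_sum_single A]
    simp only [map_sum]
    refine Finset.sum_congr rfl fun i _ => Finset.sum_congr rfl fun j _ => ?_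
    rw [← map_smul, Matrix.smul_single, smul_eq_mul, mul_one]
  have hsij : ∀ i j, ContDiffOn ℝ (α : WithTop ℕ∞)
      (fun t => specProj (Φ t) {e} (Matrix.single i j 1)) (Icc 0 1) := fun i j =>
    (hsm (Matrix.single i j 1)).of_le (by exact_mod_cast hα2)
  have hsmi : ∀ i j, ContDiffOn ℝ (α : WithTop ℕ∞)
      (fun t => A i j • specProj (Φ t) {e} (Matrix.single i j 1)) (Icc 0 1) := fun i j =>
    (hsij i j).const_smul (A i j)
  rw [hsum, iteratedDerivWithin_fun_sum hs (uniqueDiffOn_Icc zero_lt_one)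
    fun i _ => (ContDiffOn.sum fun j _ => hsmi i j) s hs]
  refine (traceNorm_sum_le _ _).trans ?_
  rw [Finset.sum_mul]
  refine Finset.sum_le_sum fun i _ => ?_
  rw [iteratedDerivWithin_fun_sum hs (uniqueDiffOn_Icc zero_lt_one) fun j _ => hsmi i j s hs]
  refine (traceNorm_sum_le _ _).trans ?_
  rw [Finset.sum_mul]
  refine Finset.sum_le_sum fun j _ => ?_
  rw [iteratedDerivWithin_fun_const_smul hs (uniqueDiffOn_Icc zero_lt_one) (A i j) (hsij i j s hs),
    traceNorm_smul, mul_comm]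
  have h1 : ‖A i j‖ ≤ traceNorm A := (norm_entry_le A i j).trans (norm_le_traceNorm A)
  refine mul_le_mul ?_ h1 (norm_nonneg _) (add_nonneg (hc0 _ _) (hc0 _ _))
  rcases hα with rfl | rfl
  · exact (hc _ _ hα2 s hs).trans (le_add_of_nonneg_right (hc0 _ _))
  · exact (hc _ _ hα2 s hs).trans (le_add_of_nonneg_left (hc0 _ _))

theorem IsIrredFamily.exists_isPeriBound (h : IsIrredFamily ι Φ) : ∃ c, IsPeriBound Φ c := by
  have hb : ∀ e : ℂ, ∃ c : ℝ, 0 ≤ c ∧ (‖e‖ = 1 → (∀ s ∈ Icc (0 : ℝ) 1, (Φ s).HasEigenvalue e) →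
      ∀ s ∈ Icc (0 : ℝ) 1, ∀ α : ℕ, α = 1 ∨ α = 2 → ∀ A : Matrix n n ℂ,
      traceNorm (iteratedDerivWithin α (fun t => specProj (Φ t) {e} A) (Icc 0 1) s)
        ≤ c * traceNorm A) := by
    intro e
    by_cases he : ‖e‖ = 1 ∧ ∀ s ∈ Icc (0 : ℝ) 1, (Φ s).HasEigenvalue e
    · obtain ⟨c, hc0, hc⟩ := h.exists_bound he.1 he.2
      exact ⟨c, hc0, fun _ _ => hc⟩
    · exact ⟨0, le_rfl, fun h1 h2 => absurd ⟨h1, h2⟩ he⟩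
  choose c hc0 hc using hb
  obtain ⟨F, hF, -⟩ := exists_finset_eigenvalues (Φ 0)
  have h0 : (0 : ℝ) ∈ Icc (0 : ℝ) 1 := by simp
  -- Every branch is constant, equal to an eigenvalue of Φ 0, so finitely many constants suffice.
  refine ⟨∑ e ∈ F, c e, fun e he => ?_⟩
  have hconst := h.branch_const he
  have heq : EqOn e (fun _ => e 0) (Icc 0 1) := hconst
  have hev : ∀ s ∈ Icc (0 : ℝ) 1, (Φ s).HasEigenvalue (e 0) := fun s hs => by
    rw [← hconst s hs]
    exact (he.2 s hs).1
  have hPeq : ∀ A, EqOn (fun t => specProj (Φ t) {e t} A) (fun t => specProj (Φ t) {e 0} A)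
      (Icc 0 1) := fun A t ht => by simp only [hconst t ht]
  have hc' : c (e 0) ≤ ∑ e ∈ F, c e :=
    Finset.single_le_sum (fun e _ => hc0 e) ((hF _).2 (hev 0 h0))
  refine ⟨contDiffOn_const.congr heq, fun A =>
    (h.contDiffOn_specProj (he.2 0 h0).2 hev A).congr (hPeq A), fun s hs α hα => ⟨?_, fun A => ?_⟩⟩
  · rw [iteratedDerivWithin_congr heq hs, iteratedDerivWithin_const, if_neg (by omega), norm_zero]
    exact (hc0 _).trans hc'
  · rw [iteratedDerivWithin_congr (hPeq A) hs]
    exact (hc _ (he.2 0 h0).2 hev s hs α hα A).trans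
      (mul_le_mul_of_nonneg_right hc' (traceNorm_nonneg A))

end Smoothness

/-! ### The reduced dynamics as a C² family of Kraus maps -/

section Family

variable {S E : Type*} [Fintype S] [DecidableEq S] [Fintype E] [DecidableEq E]

theorem contDiffOn_kronecker {f : ℝ → Matrix S S ℂ} {g : ℝ → Matrix E E ℂ} {I : Set ℝ}
    (hf : ContDiffOn ℝ 2 f I) (hg : ContDiffOn ℝ 2 g I) :
    ContDiffOn ℝ 2 (fun t => f t ⊗ₖ g t) I :=
  contDiffOn_matrix_iff.2 fun p q =>
    (contDiffOn_matrix_iff.1 hf p.1 q.1).mul (contDiffOn_matrix_iff.1 hg p.2 q.2)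

theorem contDiffOn_ptrace {f : ℝ → Matrix (S × E) (S × E) ℂ} {I : Set ℝ}
    (hf : ContDiffOn ℝ 2 f I) : ContDiffOn ℝ 2 (fun t => ptrace (f t)) I :=
  contDiffOn_matrix_iff.2 fun i j =>
    ContDiffOn.sum fun e _ => contDiffOn_matrix_iff.1 hf (i, e) (j, e)

theorem contDiffOn_conjTranspose {n : Type*} [Fintype n] [DecidableEq n] {f : ℝ → Matrix n n ℂ}
    {I : Set ℝ} (hf : ContDiffOn ℝ 2 f I) : ContDiffOn ℝ 2 (fun t => (f t)ᴴ) I :=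
  contDiffOn_matrix_iff.2 fun i j =>
    Complex.conjCLE.contDiff.comp_contDiffOn (contDiffOn_matrix_iff.1 hf j i)

theorem contDiffOn_exp {n : Type*} [Fintype n] [DecidableEq n] {f : ℝ → Matrix n n ℂ}
    {I : Set ℝ} (hf : ContDiffOn ℝ 2 f I) :
    ContDiffOn ℝ 2 (fun t => NormedSpace.exp (f t)) I := fun s hs =>
  (NormedSpace.exp_analytic (𝕂 := ℝ) (f s)).contDiffAt.comp_contDiffWithinAt s (hf s hs)

/-- With ξ = BᴴB, the map is A ↦ Tr_E(W(A ⊗ 1)Wᴴ) for W = U(1 ⊗ Bᴴ). The E-blocks of W are the Kraus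
operators, and their normalization is Tr ξ = 1. -/
theorem exists_isKraus_reduced {U : Matrix (S × E) (S × E) ℂ} {ξ : Matrix E E ℂ}
    (hU : Uᴴ * U = 1) (hξ : IsState ξ) :
    ∃ K : E × E → Matrix S S ℂ, IsKraus K (reduced U ξ) := by
  obtain ⟨B, hB⟩ := exists_eq_conjTranspose_mul_self hξ.1
  set W : Matrix (S × E) (S × E) ℂ := U * ((1 : Matrix S S ℂ) ⊗ₖ Bᴴ) with hW
  have hWW : Wᴴ * W = (1 : Matrix S S ℂ) ⊗ₖ (B * Bᴴ) := by
    rw [hW, Matrix.conjTranspose_mul, Matrix.conjTranspose_kronecker,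
      Matrix.conjTranspose_conjTranspose, Matrix.conjTranspose_one]
    calc _ = ((1 : Matrix S S ℂ) ⊗ₖ B) * (Uᴴ * U) * ((1 : Matrix S S ℂ) ⊗ₖ Bᴴ) := by
          simp only [mul_assoc]
      _ = _ := by rw [hU, mul_one, ← Matrix.mul_kronecker_mul, mul_one]
  have hWA : ∀ A : Matrix S S ℂ, U * (A ⊗ₖ ξ) * Uᴴ = W * (A ⊗ₖ (1 : Matrix E E ℂ)) * Wᴴ := by
    intro A
    rw [hW, Matrix.conjTranspose_mul, Matrix.conjTranspose_kronecker,
      Matrix.conjTranspose_conjTranspose, Matrix.conjTranspose_one]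
    calc U * (A ⊗ₖ ξ) * Uᴴ = U * ((((1 : Matrix S S ℂ) ⊗ₖ Bᴴ) * (A ⊗ₖ (1 : Matrix E E ℂ))) *
          ((1 : Matrix S S ℂ) ⊗ₖ B)) * Uᴴ := by
          rw [← Matrix.mul_kronecker_mul, ← Matrix.mul_kronecker_mul, one_mul, mul_one, mul_one,
            ← hB]
      _ = _ := by simp only [mul_assoc]
  refine ⟨fun p => Matrix.of fun i j => W (i, p.1) (j, p.2), ?_, fun A => ?_⟩
  · ext k l
    have h1 : ∑ f, (Wᴴ * W) (k, f) (l, f) = (1 : Matrix S S ℂ) k l := by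
      rw [hWW]
      have h2 : ∑ f, (B * Bᴴ) f f = 1 := by
        rw [← hξ.2, hB, Matrix.trace_mul_comm]
        rfl
      change ∑ f, (1 : Matrix S S ℂ) k l * (B * Bᴴ) f f = _
      rw [← Finset.mul_sum, h2, mul_one]
    rw [← h1]
    simp only [Matrix.sum_apply, Matrix.mul_apply, Matrix.conjTranspose_apply, Matrix.of_apply,
      Fintype.sum_prod_type]
    rw [Finset.sum_comm]
    exact Finset.sum_congr rfl fun f _ => Finset.sum_comm
  · change ptrace (U * (A ⊗ₖ ξ) * Uᴴ) = _
    rw [hWA]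
    ext i j
    simp only [ptrace, Matrix.of_apply, Matrix.sum_apply, Matrix.mul_apply,
      Matrix.conjTranspose_apply, Matrix.kroneckerMap_apply, Matrix.one_apply,
      Fintype.sum_prod_type, mul_ite, mul_one, mul_zero, Finset.sum_ite_eq',
      Finset.mem_univ, if_true]
    exact Finset.sum_congr rfl fun e _ => Finset.sum_comm

namespace ADRIS

variable (R : ADRIS S E)

theorem U_unitary {s : ℝ} (hs : s ∈ Icc (0 : ℝ) 1) : (R.U s)ᴴ * R.U s = 1 := by
  refine exp_I_smul_unitary ?_ R.τ
  have h1 : (R.hS ⊗ₖ (1 : Matrix E E ℂ)).IsHermitian := by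
    rw [Matrix.IsHermitian, Matrix.conjTranspose_kronecker, R.hS_sa.eq, Matrix.conjTranspose_one]
  have h2 : ((1 : Matrix S S ℂ) ⊗ₖ R.hE s).IsHermitian := by
    rw [Matrix.IsHermitian, Matrix.conjTranspose_kronecker, (R.hE_sa s hs).eq,
      Matrix.conjTranspose_one]
  have h3 : ((R.lam : ℂ) • R.v s).IsHermitian := by
    rw [Matrix.IsHermitian, Matrix.conjTranspose_smul, (R.v_sa s hs).eq]
    simp
  exact (h1.add h2).add h3

theorem ξ_isState [Nonempty E] {s : ℝ} (hs : s ∈ Icc (0 : ℝ) 1) : IsState (R.ξ s) :=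
  gibbs_isState _ (R.hE_sa s hs)

theorem ξ_posDef [Nonempty E] {s : ℝ} (hs : s ∈ Icc (0 : ℝ) 1) : (R.ξ s).PosDef :=
  gibbs_posDef _ (R.hE_sa s hs)

theorem contDiffOn_U : ContDiffOn ℝ 2 R.U (Icc 0 1) :=
  contDiffOn_exp (((contDiffOn_const.add
    (contDiffOn_kronecker contDiffOn_const R.hE_smooth)).add
    (R.v_smooth.const_smul (R.lam : ℂ))).const_smul (-(Complex.I * (R.τ : ℂ))))

theorem contDiffOn_ξ [Nonempty E] : ContDiffOn ℝ 2 R.ξ (Icc 0 1) := by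
  have h1 : ContDiffOn ℝ 2 (fun s => NormedSpace.exp (-(R.β s : ℂ) • R.hE s)) (Icc 0 1) :=
    contDiffOn_exp ((Complex.ofRealCLM.contDiff.comp_contDiffOn R.β_smooth).neg.smul R.hE_smooth)
  refine ContDiffOn.smul (ContDiffOn.inv (contDiff_trace.comp_contDiffOn h1) fun s hs => ?_) h1
  exact (exp_posDef (neg_ofReal_smul_isHermitian _ (R.hE_sa s hs))).trace_pos.ne'

theorem isIrredFamily [Nonempty E] (h : ∀ s ∈ Icc (0 : ℝ) 1, Irred (R.L s)) :
    IsIrredFamily (E × E) R.L where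
  kraus _ hs := exists_isKraus_reduced (R.U_unitary hs) (R.ξ_isState hs)
  irred := h
  smooth _ := contDiffOn_ptrace ((R.contDiffOn_U.mul
    (contDiffOn_kronecker contDiffOn_const R.contDiffOn_ξ)).mul
    (contDiffOn_conjTranspose R.contDiffOn_U))

end ADRIS

end Family

/-! ### The induced norm and the spectral gap -/

section SuperNorm

variable {n : Type*} [Fintype n] [DecidableEq n]

theorem traceNorm_apply_le (Φ : SuperOp n) (A : Matrix n n ℂ) :
    traceNorm (Φ A) ≤ superNorm Φ * traceNorm A := by
  have hb : BddAbove {r | ∃ A, traceNorm A ≤ 1 ∧ r = traceNorm (Φ A)} := by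
    refine ⟨Fintype.card n * ‖LinearMap.toContinuousLinearMap Φ‖, ?_⟩
    rintro r ⟨A, hA, rfl⟩
    refine (traceNorm_le_card_mul_norm _).trans (mul_le_mul_of_nonneg_left ?_ (Nat.cast_nonneg _))
    refine ((LinearMap.toContinuousLinearMap Φ).le_opNorm A).trans ?_
    exact mul_le_of_le_one_right (norm_nonneg _) ((norm_le_traceNorm A).trans hA)
  rcases eq_or_ne A 0 with rfl | hA
  · simp [traceNorm_zero]
  · have hpos : 0 < traceNorm A :=
      (traceNorm_nonneg A).lt_of_ne fun h => hA (traceNorm_eq_zero_iff.1 h.symm)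
    have h1 : traceNorm (Φ (((traceNorm A)⁻¹ : ℂ) • A)) ≤ superNorm Φ :=
      le_csSup hb ⟨_, by
        rw [traceNorm_smul, norm_inv, Complex.norm_real, Real.norm_of_nonneg hpos.le,
          inv_mul_cancel₀ hpos.ne'], rfl⟩
    rw [map_smul, traceNorm_smul, norm_inv, Complex.norm_real, Real.norm_of_nonneg hpos.le,
      inv_mul_le_iff₀ hpos] at h1
    rwa [mul_comm]

theorem superNorm_nonneg (Φ : SuperOp n) : 0 ≤ superNorm Φ :=
  Real.sSup_nonneg fun _ ⟨_, _, hr⟩ => hr ▸ traceNorm_nonneg _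

theorem H4.nonneg {Φ : ℝ → SuperOp n} {ℓ : ℝ} (h : H4 Φ ℓ) : 0 ≤ ℓ :=
  (superNorm_nonneg _).trans (h.1.1 (mem_image_of_mem _ (show (0 : ℝ) ∈ Icc (0 : ℝ) 1 by simp)))

theorem H4.traceNorm_le {Φ : ℝ → SuperOp n} {ℓ : ℝ} (h : H4 Φ ℓ) {s : ℝ}
    (hs : s ∈ Icc (0 : ℝ) 1) (A : Matrix n n ℂ) :
    traceNorm (Φ s (contrProj (Φ s) A)) ≤ ℓ * traceNorm A :=
  (traceNorm_apply_le (Φ s * contrProj (Φ s)) A).trans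
    (mul_le_mul_of_nonneg_right (h.1.1 (mem_image_of_mem _ hs)) (traceNorm_nonneg A))

end SuperNorm

/-! ### Distance of roots of unity from 1 -/

theorem norm_one_sub_pow_le {z : ℂ} (hz : ‖z‖ = 1) (j : ℕ) : ‖1 - z ^ j‖ ≤ j * ‖1 - z‖ := by
  induction j with
  | zero => simp
  | succ j ih =>
    have h : 1 - z ^ (j + 1) = (1 - z ^ j) + z ^ j * (1 - z) := by ring
    rw [h]
    refine (norm_add_le _ _).trans ?_
    rw [norm_mul, norm_pow, hz, one_pow, one_mul]
    push_cast
    linarith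

/-- The powers of z over a full period sum to 0, so N is the sum of the N numbers 1 − z^j, each of
size at most N|1 − z|. -/
theorem one_le_mul_norm_one_sub {z : ℂ} {N : ℕ} (hN : 0 < N) (hz : z ^ N = 1) (h1 : z ≠ 1)
    (hz1 : ‖z‖ = 1) : 1 ≤ N * ‖1 - z‖ := by
  have h0 : ∑ j ∈ Finset.range N, z ^ j = 0 := by
    rw [geom_sum_eq h1, hz, sub_self, zero_div]
  have h2 : (N : ℂ) = ∑ j ∈ Finset.range N, (1 - z ^ j) := by
    rw [Finset.sum_sub_distrib, h0]
    simp
  have h3 : (N : ℝ) ≤ ∑ j ∈ Finset.range N, N * ‖1 - z‖ := by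
    calc (N : ℝ) = ‖(N : ℂ)‖ := by simp
      _ ≤ ∑ j ∈ Finset.range N, ‖1 - z ^ j‖ := by
        rw [h2]
        exact norm_sum_le _ _
      _ ≤ _ := Finset.sum_le_sum fun j hj => (norm_one_sub_pow_le hz1 j).trans (by
        gcongr
        exact (Finset.mem_range.1 hj).le)
  rw [Finset.sum_const, Finset.card_range, nsmul_eq_mul] at h3
  have hN' : (0 : ℝ) < N := by exact_mod_cast hN
  nlinarith

/-! ### The peripheral spectrum is independent of the parameter -/

section Persistence

open Filter Topology

variable {n ι : Type*} [Fintype n] [DecidableEq n] [Nonempty n] [Fintype ι]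

theorem IsKraus.specProj_map {K : ι → Matrix n n ℂ} {Ψ : SuperOp n} (h : IsKraus K Ψ)
    (hI : Irred Ψ) {e : ℂ} (hev : Ψ.HasEigenvalue e) (he : ‖e‖ = 1) (A : Matrix n n ℂ) :
    specProj Ψ {e} (Ψ A) = e • specProj Ψ {e} A := by
  obtain ⟨ρ, hρ, hinv⟩ := h.exists_invariant
  obtain ⟨a, hu, ha⟩ := h.exists_unitary hI hev he
  rw [h.specProj_apply hI hρ hinv he hu ha, h.specProj_apply hI hρ hinv he hu ha,
    ← trace_traceDual_mul, h.traceDual_of_intertwines ha, Matrix.smul_mul, Matrix.trace_smul,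
    smul_assoc]

theorem IsKraus.hasEigenvalue_one {K : ι → Matrix n n ℂ} {Ψ : SuperOp n} (h : IsKraus K Ψ) :
    Ψ.HasEigenvalue 1 := by
  obtain ⟨ρ, hρ, hinv⟩ := h.exists_invariant
  refine Module.End.hasEigenvalue_of_hasEigenvector (x := ρ)
    ⟨Module.End.mem_eigenspace_iff.2 (by rw [hinv, one_smul]), ?_⟩
  rintro rfl
  simpa using hρ.2

theorem contrProj_map (Ψ : SuperOp n) (A : Matrix n n ℂ) :
    contrProj Ψ (Ψ A) = Ψ (contrProj Ψ A) := by
  have h := LinearMap.congr_fun (specProj_comm Ψ {z | ‖z‖ = 1}) A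
  rw [Module.End.mul_apply, Module.End.mul_apply] at h
  simp [contrProj, periProj, h]

theorem contrProj_contrProj (Ψ : SuperOp n) (A : Matrix n n ℂ) :
    contrProj Ψ (contrProj Ψ A) = contrProj Ψ A := by
  have h := LinearMap.congr_fun (specProj_mul_self Ψ {z | ‖z‖ = 1}) A
  rw [Module.End.mul_apply] at h
  simp [contrProj, periProj, h]

theorem exists_finset_peripheral (Ψ : SuperOp n) :
    ∃ F : Finset ℂ, (∀ μ, μ ∈ F ↔ Ψ.HasEigenvalue μ ∧ ‖μ‖ = 1) ∧
      F.card ≤ Fintype.card n ^ 2 := by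
  obtain ⟨F, hF, hcard⟩ := exists_finset_eigenvalues Ψ
  rw [Module.finrank_matrix, Module.finrank_self, mul_one, ← pow_two] at hcard
  exact ⟨F.filter fun μ => ‖μ‖ = 1, fun μ => by rw [Finset.mem_filter, hF],
    (Finset.card_filter_le _ _).trans hcard⟩

theorem eq_sum_specProj_add (Ψ : SuperOp n) {F : Finset ℂ}
    (hF : ∀ μ, μ ∈ F ↔ Ψ.HasEigenvalue μ ∧ ‖μ‖ = 1) (A : Matrix n n ℂ) :
    A = ∑ μ ∈ F, specProj Ψ {μ} A + contrProj Ψ A := by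
  rw [contrProj, periProj, specProj_eq_sum Ψ (M := {z | ‖z‖ = 1}) hF, LinearMap.sub_apply, LinearMap.sum_apply,
    Module.End.one_apply, add_sub_cancel]

variable {Φ : ℝ → SuperOp n}

/-- Away from the spectrum, the roots of unity of the given order stay in the resolvent set
with a uniform resolvent bound. -/
theorem IsIrredFamily.traceNorm_le_of_not_hasEigenvalue (h : IsIrredFamily ι Φ) {ℓ : ℝ}
    (H : H4 Φ ℓ) {e : ℂ} (he : ‖e‖ = 1) (heN : e ^ (Fintype.card n ^ 2).factorial = 1) {s : ℝ}
    (hs : s ∈ Icc (0 : ℝ) 1) (hev : ¬ (Φ s).HasEigenvalue e) (A : Matrix n n ℂ) :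
    traceNorm A ≤ ((Fintype.card n ^ 2 : ℕ) * (Fintype.card n ^ 2).factorial +
      (1 - ℓ)⁻¹ * (1 + (Fintype.card n ^ 2 : ℕ))) * traceNorm (e • A - Φ s A) := by
  obtain ⟨K, hK⟩ := h.kraus s hs
  have hI := h.irred s hs
  obtain ⟨F, hF, hcard⟩ := exists_finset_peripheral (Φ s)
  set N := (Fintype.card n ^ 2).factorial with hN
  set M := Fintype.card n ^ 2
  set B := e • A - Φ s A with hB
  have hℓ : 0 < 1 - ℓ := sub_pos.2 H.2
  have hPB : ∀ f ∈ F, traceNorm (specProj (Φ s) {f} B) ≤ traceNorm B := fun f hf =>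
    hK.traceNorm_specProj_le hI ((hF f).1 hf).1 ((hF f).1 hf).2 B
  have hcardR : (F.card : ℝ) ≤ (M : ℝ) := by exact_mod_cast hcard
  have hB0 := traceNorm_nonneg B
  -- On the f-component e − Φ acts as the scalar e − f, and f/e ≠ 1 is a root of unity of order
  -- dividing N.
  have hP : ∀ f ∈ F, traceNorm (specProj (Φ s) {f} A) ≤ N * traceNorm B := by
    intro f hf
    obtain ⟨hf1, hf2⟩ := (hF f).1 hf
    have h1 : specProj (Φ s) {f} B = (e - f) • specProj (Φ s) {f} A := by
      rw [hB, map_sub, map_smul, hK.specProj_map hI hf1 hf2, sub_smul]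
    have he0 : e ≠ 0 := by
      rintro rfl
      simp at he
    have h2 : 1 ≤ N * ‖e - f‖ := by
      have h3 := one_le_mul_norm_one_sub (z := f / e) (N := N) (Nat.factorial_pos _)
        (by rw [div_pow, heN, hK.pow_factorial_eq_one hI hf1 hf2, div_one])
        (fun h4 => hev ((div_eq_one_iff_eq he0).1 h4 ▸ hf1)) (by rw [norm_div, he, hf2, div_one])
      have h5 : e - f = e * (1 - f / e) := by
        field_simp
      rwa [h5, norm_mul, he, one_mul]
    have h6 := hPB f hf
    rw [h1, traceNorm_smul] at h6
    have h7 := traceNorm_nonneg (specProj (Φ s) {f} A)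
    calc traceNorm (specProj (Φ s) {f} A)
        ≤ (N * ‖e - f‖) * traceNorm (specProj (Φ s) {f} A) := le_mul_of_one_le_left h7 h2
      _ ≤ N * traceNorm B := by
        rw [mul_assoc]
        gcongr
  -- On the range of Q, Φ contracts by ℓ < 1 = |e|. The factor 1 + M bounds the norm of Q, as there
  -- are at most M peripheral projectors of norm at most 1.
  have hQ : traceNorm (contrProj (Φ s) A) ≤ (1 - ℓ)⁻¹ * (1 + M) * traceNorm B := by
    have h1 : contrProj (Φ s) B = e • contrProj (Φ s) A - Φ s (contrProj (Φ s) A) := by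
      rw [hB, map_sub, map_smul, contrProj_map]
    have h2 : traceNorm (contrProj (Φ s) A) ≤
        traceNorm (contrProj (Φ s) B) + ℓ * traceNorm (contrProj (Φ s) A) := by
      calc traceNorm (contrProj (Φ s) A) = traceNorm (e • contrProj (Φ s) A) := by
            rw [traceNorm_smul, he, one_mul]
        _ = traceNorm (contrProj (Φ s) B + Φ s (contrProj (Φ s) (contrProj (Φ s) A))) := by
            rw [h1, contrProj_contrProj, sub_add_cancel]
        _ ≤ _ := (traceNorm_add_le _ _).trans (add_le_add_right (H.traceNorm_le hs _) _)
    have h3 : traceNorm (contrProj (Φ s) B) ≤ (1 + M) * traceNorm B := by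
      have h4 : contrProj (Φ s) B = B - ∑ f ∈ F, specProj (Φ s) {f} B :=
        eq_sub_of_add_eq' (eq_sum_specProj_add (Φ s) hF B).symm
      rw [h4]
      refine (traceNorm_sub_le _ _).trans ?_
      have h5 : traceNorm (∑ f ∈ F, specProj (Φ s) {f} B) ≤ M * traceNorm B := by
        refine (traceNorm_sum_le _ _).trans ((Finset.sum_le_card_nsmul _ _ _ hPB).trans ?_)
        rw [nsmul_eq_mul]
        gcongr
      linarith
    rw [mul_assoc, le_inv_mul_iff₀ hℓ]
    linarith
  rw [eq_sum_specProj_add (Φ s) hF A]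
  refine (traceNorm_add_le _ _).trans ?_
  rw [add_mul]
  refine add_le_add ((traceNorm_sum_le _ _).trans ((Finset.sum_le_card_nsmul _ _ _ hP).trans ?_)) hQ
  rw [nsmul_eq_mul, mul_assoc]
  gcongr

/-- The peripheral eigenvalues do not depend on the parameter. -/
theorem IsIrredFamily.hasEigenvalue_iff (h : IsIrredFamily ι Φ) {ℓ : ℝ} (H : H4 Φ ℓ) {e : ℂ}
    (he : ‖e‖ = 1) {s t : ℝ} (hs : s ∈ Icc (0 : ℝ) 1) (ht : t ∈ Icc (0 : ℝ) 1) :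
    (Φ s).HasEigenvalue e ↔ (Φ t).HasEigenvalue e := by
  refine isPreconnected_Icc.induction₂ (fun s t => (Φ s).HasEigenvalue e ↔ (Φ t).HasEigenvalue e)
    (fun s hs => ?_) (fun _ _ _ _ _ _ h1 h2 => h1.trans h2) (fun _ _ _ _ h1 => h1.symm) hs ht
  have hsm : ∀ x, ContDiffOn ℝ 2 (fun t => (e • (1 : SuperOp n) - Φ t) x) (Icc 0 1) := fun x =>
    contDiffOn_const.sub (h.smooth x)
  have hBa : ∀ t x, (e • (1 : SuperOp n) - Φ t) x = e • x - Φ t x := fun t x => rfl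
  -- If e is an eigenvalue at s, its eigenvector is almost one for nearby t, which the uniform
  -- resolvent bound forbids unless e stays an eigenvalue. If it is not, injectivity of e − Φ is an
  -- open condition.
  by_cases hev : (Φ s).HasEigenvalue e
  · obtain ⟨x, hx⟩ := hev.exists_hasEigenvector
    obtain ⟨K, hK⟩ := h.kraus s hs
    have heN := hK.pow_factorial_eq_one (h.irred s hs) hev he
    set C : ℝ := (Fintype.card n ^ 2 : ℕ) * (Fintype.card n ^ 2).factorial +
      (1 - ℓ)⁻¹ * (1 + (Fintype.card n ^ 2 : ℕ)) with hC
    have hC0 : 0 ≤ C := by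
      have : 0 < 1 - ℓ := sub_pos.2 H.2
      positivity
    have hcont : Tendsto (fun t => C * (Fintype.card n * ‖e • x - Φ t x‖)) (𝓝[Icc 0 1] s) (𝓝 0) := by
      have h1 := (((hsm x).continuousOn s hs).norm.const_mul (Fintype.card n : ℝ)).const_mul C
      have h2 := h1.tendsto
      simp only [hBa] at h2
      rwa [hx.apply_eq_smul, sub_self, norm_zero, mul_zero, mul_zero] at h2
    filter_upwards [hcont.eventually_lt_const (norm_pos_iff.2 hx.2), self_mem_nhdsWithin]
      with t ht htI
    refine ⟨fun _ => ?_, fun _ => hev⟩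
    by_contra hn
    have h3 := h.traceNorm_le_of_not_hasEigenvalue H he heN htI hn x
    have h4 := mul_le_mul_of_nonneg_left (traceNorm_le_card_mul_norm (e • x - Φ t x)) hC0
    have h5 := norm_le_traceNorm x
    linarith
  · have hinj : Function.Injective (e • (1 : SuperOp n) - Φ s) := by
      rw [injective_iff_map_eq_zero]
      intro x hx
      by_contra hx0
      rw [hBa, sub_eq_zero] at hx
      exact hev (Module.End.hasEigenvalue_of_hasEigenvector (x := x)
        ⟨Module.End.mem_eigenspace_iff.2 hx.symm, hx0⟩)
    obtain ⟨_, _, hev'⟩ := exists_contDiffWithinAt_solution hs hsm hinj 0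
    filter_upwards [hev'] with t ht
    refine ⟨fun h1 => absurd h1 hev, fun h1 => ?_⟩
    obtain ⟨x, hx⟩ := h1.exists_hasEigenvector
    refine absurd (ht.1 ?_) hx.2
    rw [hBa, hx.apply_eq_smul, sub_self, map_zero]

end Persistence

/-! ### First and second differences in trace norm -/

section FiniteDifference

variable {n : Type*} [Fintype n] [DecidableEq n]

theorem norm_sub_le_of_iteratedDerivWithin {φ : ℝ → ℂ} (hφ : ContDiffOn ℝ 2 φ (Icc 0 1)) {c : ℝ}
    (hc : ∀ s ∈ Icc (0 : ℝ) 1, ‖iteratedDerivWithin 1 φ (Icc 0 1) s‖ ≤ c) {a b : ℝ}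
    (ha : a ∈ Icc (0 : ℝ) 1) (hb : b ∈ Icc (0 : ℝ) 1) : ‖φ b - φ a‖ ≤ c * |b - a| := by
  refine Convex.norm_image_sub_le_of_norm_hasDerivWithin_le
    (fun s hs => (hφ.differentiableOn (by simp) s hs).hasDerivWithinAt)
    (fun s hs => ?_) (convex_Icc 0 1) ha hb
  rw [← iteratedDerivWithin_one]
  exact hc s hs

/-- The mean value inequality is applied to x ↦ φ(x+h) − φ(x), whose derivative is itself a
difference of φ' over a step h. -/
theorem norm_second_difference_le {φ : ℝ → ℂ} (hφ : ContDiffOn ℝ 2 φ (Icc 0 1)) {c : ℝ}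
    (hc : ∀ s ∈ Icc (0 : ℝ) 1, ‖iteratedDerivWithin 2 φ (Icc 0 1) s‖ ≤ c) {a h : ℝ}
    (ha : 0 ≤ a) (hh : 0 ≤ h) (hah : a + h + h ≤ 1) :
    ‖φ (a + h + h) - φ (a + h) - (φ (a + h) - φ a)‖ ≤ c * h ^ 2 := by
  set ψ := derivWithin φ (Icc 0 1) with hψ
  have hd : ∀ s ∈ Icc (0 : ℝ) 1, HasDerivWithinAt φ (ψ s) (Icc 0 1) s := fun s hs =>
    (hφ.differentiableOn (by simp) s hs).hasDerivWithinAt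
  have hψs : ContDiffOn ℝ 1 ψ (Icc 0 1) :=
    hφ.derivWithin (uniqueDiffOn_Icc zero_lt_one) (by norm_num)
  have hψd : ∀ x ∈ Icc (0 : ℝ) 1, ∀ y ∈ Icc (0 : ℝ) 1, ‖ψ y - ψ x‖ ≤ c * |y - x| := by
    intro x hx y hy
    refine Convex.norm_image_sub_le_of_norm_hasDerivWithin_le
      (fun s hs => (hψs.differentiableOn (by simp) s hs).hasDerivWithinAt)
      (fun s hs => ?_) (convex_Icc 0 1) hx hy
    have := hc s hs
    rwa [iteratedDerivWithin_succ', iteratedDerivWithin_one] at this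
  have hsub : Icc a (a + h) ⊆ Icc (0 : ℝ) 1 := fun x hx => ⟨by linarith [hx.1], by linarith [hx.2]⟩
  have hmaps : MapsTo (fun x => x + h) (Icc a (a + h)) (Icc (0 : ℝ) 1) := fun x hx =>
    ⟨by linarith [hx.1], by linarith [hx.2]⟩
  have hg : ∀ x ∈ Icc a (a + h), HasDerivWithinAt (fun x => φ (x + h) - φ x) (ψ (x + h) - ψ x)
      (Icc a (a + h)) x := by
    intro x hx
    refine HasDerivWithinAt.sub ?_ ((hd x (hsub hx)).mono hsub)
    have h1 := (hd (x + h) (hmaps hx)).scomp x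
      ((hasDerivAt_id x).add_const h).hasDerivWithinAt hmaps
    simpa [Function.comp_def] using h1
  have h2 := Convex.norm_image_sub_le_of_norm_hasDerivWithin_le (C := c * h) hg
    (fun x hx => ?_) (convex_Icc _ _) (x := a) (y := a + h) ⟨le_rfl, by linarith⟩
    ⟨by linarith, le_rfl⟩
  · rw [add_sub_cancel_left, Real.norm_of_nonneg hh] at h2
    rw [pow_two, ← mul_assoc]
    exact h2
  · have := hψd x (hsub hx) (x + h) (hmaps hx)
    rwa [add_sub_cancel_left, abs_of_nonneg hh] at this

/-- Pairing with a fixed contraction commutes with differentiation, so the scalar difference bounds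
lift to the trace norm by duality. -/
theorem norm_iteratedDerivWithin_trace_mul_le {f : ℝ → Matrix n n ℂ}
    (hf : ContDiffOn ℝ 2 f (Icc 0 1)) {W : Matrix n n ℂ} (hW : ‖W‖ ≤ 1) {c : ℝ} {α : ℕ}
    (hα : α ≤ 2) {s : ℝ} (hs : s ∈ Icc (0 : ℝ) 1)
    (hc : traceNorm (iteratedDerivWithin α f (Icc 0 1) s) ≤ c) :
    ContDiffOn ℝ 2 (fun t => (W * f t).trace) (Icc 0 1) ∧
    ‖iteratedDerivWithin α (fun t => (W * f t).trace) (Icc 0 1) s‖ ≤ c := by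
  refine ⟨contDiff_trace.comp_contDiffOn (contDiffOn_const.mul hf), ?_⟩
  have h1 := iteratedDerivWithin_clm_comp (LinearMap.toContinuousLinearMap
    (((Matrix.traceLinearMap n ℂ ℂ).comp (LinearMap.mulLeft ℂ W)).restrictScalars ℝ)) hf hs hα
  have h2 : iteratedDerivWithin α (fun t => (W * f t).trace) (Icc 0 1) s =
      (W * iteratedDerivWithin α f (Icc 0 1) s).trace := h1
  rw [h2]
  exact (norm_trace_mul_le_of_norm_le_one hW _).trans hc

theorem traceNorm_sub_le_of_iteratedDerivWithin {f : ℝ → Matrix n n ℂ}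
    (hf : ContDiffOn ℝ 2 f (Icc 0 1)) {c : ℝ}
    (hc : ∀ s ∈ Icc (0 : ℝ) 1, traceNorm (iteratedDerivWithin 1 f (Icc 0 1) s) ≤ c) {a b : ℝ}
    (ha : a ∈ Icc (0 : ℝ) 1) (hb : b ∈ Icc (0 : ℝ) 1) :
    traceNorm (f b - f a) ≤ c * |b - a| :=
  traceNorm_le_of_forall fun W hW => by
    rw [mul_sub, Matrix.trace_sub]
    exact norm_sub_le_of_iteratedDerivWithin (φ := fun t => (W * f t).trace)
      (norm_iteratedDerivWithin_trace_mul_le hf hW one_le_two ha (hc a ha)).1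
      (fun s hs => (norm_iteratedDerivWithin_trace_mul_le hf hW one_le_two hs (hc s hs)).2) ha hb

theorem traceNorm_second_difference_le {f : ℝ → Matrix n n ℂ}
    (hf : ContDiffOn ℝ 2 f (Icc 0 1)) {c : ℝ}
    (hc : ∀ s ∈ Icc (0 : ℝ) 1, traceNorm (iteratedDerivWithin 2 f (Icc 0 1) s) ≤ c) {a h : ℝ}
    (ha : 0 ≤ a) (hh : 0 ≤ h) (hah : a + h + h ≤ 1) :
    traceNorm (f (a + h + h) - f (a + h) - (f (a + h) - f a)) ≤ c * h ^ 2 :=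
  traceNorm_le_of_forall fun W hW => by
    have ha1 : a ∈ Icc (0 : ℝ) 1 := ⟨ha, by linarith⟩
    simp only [mul_sub, Matrix.trace_sub]
    exact norm_second_difference_le (φ := fun t => (W * f t).trace)
      (norm_iteratedDerivWithin_trace_mul_le hf hW le_rfl ha1 (hc a ha1)).1
      (fun s hs => (norm_iteratedDerivWithin_trace_mul_le hf hW le_rfl hs (hc s hs)).2) ha hh hah

end FiniteDifference

/-! ### Discrete Gronwall estimates -/

section Recursion

theorem le_of_linear_recursion {W b : ℕ → ℝ} {x : ℝ} {T : ℕ} (hx : 0 ≤ x) (hb : ∀ k, 0 ≤ b k)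
    (h : ∀ k, k + 1 < T → W (k + 1) ≤ (1 + x) * W k + b k) {k : ℕ} (hk : k < T) :
    W k ≤ (1 + x) ^ k * (W 0 + ∑ j ∈ Finset.range k, b j) := by
  induction k with
  | zero => simp
  | succ k ih =>
    have h1 := ih (by omega)
    have h2 : b k ≤ (1 + x) ^ (k + 1) * b k :=
      le_mul_of_one_le_left (hb k) (one_le_pow₀ (by linarith))
    calc W (k + 1) ≤ (1 + x) * W k + b k := h k hk
      _ ≤ (1 + x) * ((1 + x) ^ k * (W 0 + ∑ j ∈ Finset.range k, b j)) +
          (1 + x) ^ (k + 1) * b k := add_le_add (mul_le_mul_of_nonneg_left h1 (by linarith)) h2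
      _ = _ := by
        rw [Finset.sum_range_succ]
        ring

theorem le_of_contraction {Y : ℕ → ℝ} {ℓ p : ℝ} {T : ℕ} (h0 : 0 ≤ ℓ) (h1 : ℓ < 1) (hp : 0 ≤ p)
    (h : ∀ k, k < T → Y (k + 1) ≤ ℓ * (Y k + p)) {k : ℕ} (hk : k ≤ T) :
    Y k ≤ Y 0 * ℓ ^ k + p * (1 - ℓ)⁻¹ := by
  have hpos : 0 < 1 - ℓ := sub_pos.2 h1
  induction k with
  | zero =>
    have : 0 ≤ p * (1 - ℓ)⁻¹ := by positivity
    simpa using this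
  | succ k ih =>
    have h2 := ih (by omega)
    have h3 : ℓ * (p * (1 - ℓ)⁻¹ + p) ≤ p * (1 - ℓ)⁻¹ := by
      have h4 : p * (1 - ℓ)⁻¹ - ℓ * (p * (1 - ℓ)⁻¹ + p) = p * (1 - ℓ) := by
        field_simp
        ring
      have h5 : 0 ≤ p * (1 - ℓ) := by positivity
      linarith
    calc Y (k + 1) ≤ ℓ * (Y k + p) := h k hk
      _ ≤ ℓ * (Y 0 * ℓ ^ k + p * (1 - ℓ)⁻¹ + p) := by gcongr
      _ = Y 0 * ℓ ^ (k + 1) + ℓ * (p * (1 - ℓ)⁻¹ + p) := by ring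
      _ ≤ _ := by gcongr

/-- The constant of the adiabatic estimate, for dimension `d`. -/
def adiabaticConst (c : ℝ) (d : ℕ) : ℝ :=
  Real.exp ((d ^ 2 : ℕ) * c) * ((d ^ 2 : ℕ) * (d ^ 2).factorial * c + 2 * ((d ^ 2 : ℕ) * c) +
    (d ^ 2 : ℕ) * c * ((d ^ 2 : ℕ) * (d ^ 2).factorial * c) +
    (d ^ 2 : ℕ) * c * ((d ^ 2 : ℕ) * c) + (d ^ 2 : ℕ) * (d ^ 2).factorial * (c + c ^ 2)) +
    (d ^ 2 : ℕ) * (d ^ 2).factorial * c + (d ^ 2 : ℕ) * c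

theorem adiabaticConst_nonneg {c : ℝ} (hc : 0 ≤ c) (d : ℕ) : 0 ≤ adiabaticConst c d := by
  unfold adiabaticConst
  positivity

/-- Y is the contracting part, W the sum of the corrected oscillating components, and d the total
deviation. Inserting the bound for Y into that for d, and then into the recursion for W, leaves a
linear recursion for W alone. -/
theorem adiabatic_recursion {W Y d : ℕ → ℝ} {c ℓ : ℝ} {T n : ℕ} (hT : 0 < T) (hc : 0 ≤ c)
    (hℓ0 : 0 ≤ ℓ) (hℓ1 : ℓ < 1) (hY2 : Y 0 ≤ 2) (hY0 : 0 ≤ Y 0)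
    (hY : ∀ k, k < T → Y (k + 1) ≤ ℓ * (Y k + (n ^ 2 : ℕ) * c * (T : ℝ)⁻¹))
    (hW0 : W 0 ≤ (n ^ 2 : ℕ) * (n ^ 2).factorial * c * (T : ℝ)⁻¹)
    (hW : ∀ k, k + 1 < T → W (k + 1) ≤ W k + (n ^ 2 : ℕ) * (c * (T : ℝ)⁻¹ * d k +
      (n ^ 2).factorial * (c + c ^ 2) * (T : ℝ)⁻¹ ^ 2))
    (hd : ∀ k, k < T → d k ≤ W k + (n ^ 2 : ℕ) * (n ^ 2).factorial * c * (T : ℝ)⁻¹ + Y k)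
    {k : ℕ} (hk : k < T) :
    d k ≤ Y 0 * ℓ ^ k + adiabaticConst c n * ((T : ℝ) * (1 - ℓ))⁻¹ := by
  have hT' : (0 : ℝ) < T := by exact_mod_cast hT
  have hpos : 0 < 1 - ℓ := sub_pos.2 hℓ1
  rw [mul_inv]
  unfold adiabaticConst
  set M : ℝ := ((n ^ 2 : ℕ) : ℝ)
  set N : ℝ := ((n ^ 2).factorial : ℝ)
  have hM : 0 ≤ M := Nat.cast_nonneg _
  have hN : 0 ≤ N := Nat.cast_nonneg _
  set p := (T : ℝ)⁻¹ with hp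
  have hp0 : 0 < p := inv_pos.2 hT'
  set L := (1 - ℓ)⁻¹ with hL
  have hL1 : 1 ≤ L := (one_le_inv₀ hpos).2 (by linarith)
  have hL0 : 0 ≤ L := by linarith
  have hYk : ∀ k, k ≤ T → Y k ≤ Y 0 * ℓ ^ k + M * c * p * L := fun k hk =>
    le_of_contraction hℓ0 hℓ1 (by positivity) hY hk
  set b : ℕ → ℝ := fun k => M * c * p * (M * N * c * p + (Y 0 * ℓ ^ k + M * c * p * L)) +
    M * N * (c + c ^ 2) * p ^ 2 with hb
  have hb0 : ∀ k, 0 ≤ b k := fun k => by simp only [hb]; positivity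
  have hrec : ∀ k, k + 1 < T → W (k + 1) ≤ (1 + M * c * p) * W k + b k := by
    intro k hk
    have h1 : d k ≤ W k + M * N * c * p + (Y 0 * ℓ ^ k + M * c * p * L) :=
      (hd k (by omega)).trans (add_le_add_right (hYk k (by omega)) _)
    calc W (k + 1) ≤ W k + M * (c * p * d k + N * (c + c ^ 2) * p ^ 2) := hW k hk
      _ ≤ W k + M * (c * p * (W k + M * N * c * p + (Y 0 * ℓ ^ k + M * c * p * L)) +
          N * (c + c ^ 2) * p ^ 2) := by gcongr
      _ = _ := by simp only [hb]; ring
  have hWk := le_of_linear_recursion (by positivity) hb0 hrec hk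
  have hkp : k * p ≤ 1 := by
    rw [hp, ← div_eq_mul_inv, div_le_one hT']
    exact_mod_cast hk.le
  have hgeom : ∑ j ∈ Finset.range k, ℓ ^ j ≤ L := by
    have := (summable_geometric_of_lt_one hℓ0 hℓ1).sum_le_tsum (Finset.range k)
      (fun j _ => pow_nonneg hℓ0 j)
    rwa [tsum_geometric_of_lt_one hℓ0 hℓ1] at this
  have hsum : ∑ j ∈ Finset.range k, b j ≤ (2 * (M * c) + M * c * (M * N * c) +
      M * c * (M * c) + M * N * (c + c ^ 2)) * (p * L) := by
    have h1 : ∑ j ∈ Finset.range k, b j = M * c * p * (Y 0 * ∑ j ∈ Finset.range k, ℓ ^ j) +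
        (k * p) * ((M * c * (M * N * c) + M * N * (c + c ^ 2)) * p + M * c * (M * c) * (p * L)) := by
      simp only [hb, Finset.sum_add_distrib, ← Finset.mul_sum, Finset.sum_const, Finset.card_range,
        nsmul_eq_mul]
      ring
    -- The bound Y 0 ≤ 2 frees this constant from the initial state, and the geometric sum turns the
    -- transient into order 1/(T(1−ℓ)).
    have h2 : M * c * p * (Y 0 * ∑ j ∈ Finset.range k, ℓ ^ j) ≤ M * c * p * (2 * L) := by gcongr
    have h3 : (k * p) * ((M * c * (M * N * c) + M * N * (c + c ^ 2)) * p +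
        M * c * (M * c) * (p * L)) ≤ 1 * ((M * c * (M * N * c) + M * N * (c + c ^ 2)) * (p * L) +
        M * c * (M * c) * (p * L)) := by
      gcongr
      exact le_mul_of_one_le_right hp0.le hL1
    rw [h1]
    linarith
  have hexp : (1 + M * c * p) ^ k ≤ Real.exp (M * c) := by
    calc (1 + M * c * p) ^ k ≤ Real.exp (M * c * p) ^ k := by
          gcongr
          linarith [Real.add_one_le_exp (M * c * p)]
      _ = Real.exp (M * c * (k * p)) := by
          rw [← Real.exp_nat_mul]
          ring_nf
      _ ≤ _ := Real.exp_le_exp.2 (mul_le_of_le_one_right (by positivity) hkp)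
  have hpL : M * N * c * p ≤ M * N * c * (p * L) := by
    gcongr
    exact le_mul_of_one_le_right hp0.le hL1
  set Z := (2 * (M * c) + M * c * (M * N * c) + M * c * (M * c) + M * N * (c + c ^ 2)) with hZ
  have hZ0 : 0 ≤ Z := by positivity
  have hW1 : W k ≤ Real.exp (M * c) * (M * N * c * (p * L) + Z * (p * L)) := by
    refine hWk.trans ?_
    calc _ ≤ (1 + M * c * p) ^ k * (M * N * c * (p * L) + Z * (p * L)) := by
          gcongr
          exact hW0.trans hpL
      _ ≤ _ := by gcongr
  have h1 := hd k hk
  have h2 := hYk k hk.le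
  calc d k ≤ Real.exp (M * c) * (M * N * c * (p * L) + Z * (p * L)) + M * N * c * (p * L) +
        (Y 0 * ℓ ^ k + M * c * p * L) := by linarith
    _ = _ := by
      rw [hZ]
      ring

end Recursion

/-! ### Adiabatic following of the invariant state -/

section Adiabatic

variable {n ι : Type*} [Fintype n] [DecidableEq n] [Nonempty n] [Fintype ι] {Φ : ℝ → SuperOp n}

theorem IsIrredFamily.exists_peripheral (h : IsIrredFamily ι Φ) {ℓ : ℝ} (H : H4 Φ ℓ) :
    ∃ Λ : Finset ℂ, (∀ s ∈ Icc (0 : ℝ) 1, ∀ μ, μ ∈ Λ ↔ (Φ s).HasEigenvalue μ ∧ ‖μ‖ = 1) ∧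
      Λ.card ≤ Fintype.card n ^ 2 := by
  obtain ⟨Λ, hΛ, hcard⟩ := exists_finset_peripheral (Φ 0)
  refine ⟨Λ, fun s hs μ => ?_, hcard⟩
  rw [hΛ]
  exact and_congr_left fun hμ => h.hasEigenvalue_iff H hμ (by simp) hs

theorem isPeriBranch_const {e : ℂ} (he : ∀ s ∈ Icc (0 : ℝ) 1, (Φ s).HasEigenvalue e ∧ ‖e‖ = 1) :
    IsPeriBranch Φ fun _ => e :=
  ⟨continuousOn_const, he⟩

theorem IsIrredFamily.periBound_nonneg (h : IsIrredFamily ι Φ) {c : ℝ} (hc : IsPeriBound Φ c) :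
    0 ≤ c := by
  have h1 : ∀ s ∈ Icc (0 : ℝ) 1, (Φ s).HasEigenvalue 1 ∧ ‖(1 : ℂ)‖ = 1 := fun s hs => by
    obtain ⟨K, hK⟩ := h.kraus s hs
    exact ⟨hK.hasEigenvalue_one, by simp⟩
  exact (norm_nonneg _).trans ((hc _ (isPeriBranch_const h1)).2.2 0 (by simp) 1 (Or.inl rfl)).1

theorem IsPeriBound.traceNorm_sub_le {c : ℝ} (hc : IsPeriBound Φ c) {e : ℂ}
    (he : ∀ s ∈ Icc (0 : ℝ) 1, (Φ s).HasEigenvalue e ∧ ‖e‖ = 1) {a b : ℝ}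
    (ha : a ∈ Icc (0 : ℝ) 1) (hb : b ∈ Icc (0 : ℝ) 1) (A : Matrix n n ℂ) :
    traceNorm (specProj (Φ b) {e} A - specProj (Φ a) {e} A) ≤ c * |b - a| * traceNorm A := by
  obtain ⟨-, h2, h3⟩ := hc _ (isPeriBranch_const he)
  rw [mul_right_comm]
  exact traceNorm_sub_le_of_iteratedDerivWithin (h2 A)
    (fun s hs => (h3 s hs 1 (Or.inl rfl)).2 A) ha hb

theorem IsPeriBound.traceNorm_second_difference_le {c : ℝ} (hc : IsPeriBound Φ c) {e : ℂ}
    (he : ∀ s ∈ Icc (0 : ℝ) 1, (Φ s).HasEigenvalue e ∧ ‖e‖ = 1) {a h : ℝ}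
    (ha : 0 ≤ a) (hh : 0 ≤ h) (hah : a + h + h ≤ 1) (A : Matrix n n ℂ) :
    traceNorm (specProj (Φ (a + h + h)) {e} A - specProj (Φ (a + h)) {e} A -
      (specProj (Φ (a + h)) {e} A - specProj (Φ a) {e} A)) ≤ c * h ^ 2 * traceNorm A := by
  obtain ⟨-, h2, h3⟩ := hc _ (isPeriBranch_const he)
  rw [mul_right_comm]
  exact RIS.traceNorm_second_difference_le (h2 A)
    (fun s hs => (h3 s hs 2 (Or.inr rfl)).2 A) ha hh hah

theorem IsIrredFamily.traceNorm_invariant_sub_le (h : IsIrredFamily ι Φ) {c : ℝ}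
    (hc : IsPeriBound Φ c) {a b : ℝ} (ha : a ∈ Icc (0 : ℝ) 1) (hb : b ∈ Icc (0 : ℝ) 1)
    {r r' : Matrix n n ℂ} (hr : IsState r) (hra : Φ a r = r) (hr' : IsState r')
    (hrb : Φ b r' = r') : traceNorm (r' - r) ≤ c * |b - a| := by
  have h1 : ∀ s ∈ Icc (0 : ℝ) 1, (Φ s).HasEigenvalue 1 ∧ ‖(1 : ℂ)‖ = 1 := fun s hs => by
    obtain ⟨K, hK⟩ := h.kraus s hs
    exact ⟨hK.hasEigenvalue_one, by simp⟩
  have h2 := hc.traceNorm_sub_le h1 ha hb r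
  obtain ⟨K, hK⟩ := h.kraus a ha
  obtain ⟨K', hK'⟩ := h.kraus b hb
  rwa [hK.specProj_one_apply (h.irred a ha) hr hra, hK'.specProj_one_apply (h.irred b hb) hr' hrb,
    hr.2, one_smul, one_smul, traceNorm_of_isState hr, mul_one] at h2

theorem natCast_div_mem_Icc {k T : ℕ} (hk : k ≤ T) : (k : ℝ) / T ∈ Icc (0 : ℝ) 1 :=
  ⟨by positivity, div_le_one_of_le₀ (by exact_mod_cast hk) (Nat.cast_nonneg _)⟩

theorem natCast_succ_div (k T : ℕ) : ((k + 1 : ℕ) : ℝ) / T = (k : ℝ) / T + (T : ℝ)⁻¹ := by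
  push_cast
  ring

theorem abs_natCast_succ_div_sub (k T : ℕ) :
    |((k + 1 : ℕ) : ℝ) / T - (k : ℝ) / T| = (T : ℝ)⁻¹ := by
  rw [natCast_succ_div, add_sub_cancel_left, abs_of_nonneg (by positivity)]

/-- Q commutes with Φ at the new parameter, so the step contracts Q_{k+1}ρ_k; passing from Q_{k+1}
to Q_k costs one first difference for each peripheral projector. -/
theorem traceNorm_contrProj_succ_le {ℓ : ℝ} (H : H4 Φ ℓ) {c : ℝ} (hc0 : 0 ≤ c)
    (hc : IsPeriBound Φ c) {Λ : Finset ℂ}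
    (hΛ : ∀ s ∈ Icc (0 : ℝ) 1, ∀ μ, μ ∈ Λ ↔ (Φ s).HasEigenvalue μ ∧ ‖μ‖ = 1)
    (hcard : Λ.card ≤ Fintype.card n ^ 2) {T k : ℕ} (hk : k < T) {ρ : Matrix n n ℂ}
    (hρ : IsState ρ) :
    traceNorm (contrProj (Φ ((k + 1 : ℕ) / T)) (Φ ((k + 1 : ℕ) / T) ρ)) ≤
      ℓ * (traceNorm (contrProj (Φ (k / T)) ρ) + (Fintype.card n ^ 2 : ℕ) * c * (T : ℝ)⁻¹) := by
  have hs : ((k + 1 : ℕ) : ℝ) / T ∈ Icc (0 : ℝ) 1 := natCast_div_mem_Icc hk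
  have hs0 : (k : ℝ) / T ∈ Icc (0 : ℝ) 1 := natCast_div_mem_Icc hk.le
  rw [contrProj_map, ← contrProj_contrProj]
  refine (H.traceNorm_le hs _).trans (mul_le_mul_of_nonneg_left ?_ H.nonneg)
  have h1 := eq_sum_specProj_add (Φ ((k + 1 : ℕ) / T)) (hΛ _ hs) ρ
  have h2 := eq_sum_specProj_add (Φ (k / T)) (hΛ _ hs0) ρ
  have h3 : contrProj (Φ ((k + 1 : ℕ) / T)) ρ = contrProj (Φ (k / T)) ρ -
      ∑ μ ∈ Λ, (specProj (Φ ((k + 1 : ℕ) / T)) {μ} ρ - specProj (Φ (k / T)) {μ} ρ) := by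
    rw [eq_sub_of_add_eq' h1.symm, eq_sub_of_add_eq' h2.symm, Finset.sum_sub_distrib]
    abel
  rw [h3]
  refine (traceNorm_sub_le _ _).trans (add_le_add_right ((traceNorm_sum_le _ _).trans ?_) _)
  calc _ ≤ ∑ μ ∈ Λ, c * (T : ℝ)⁻¹ := Finset.sum_le_sum fun μ hμ => by
        have := hc.traceNorm_sub_le (fun s hs => (hΛ s hs μ).1 hμ) hs0 hs ρ
        rwa [abs_natCast_succ_div_sub, traceNorm_of_isState hρ, mul_one] at this
    _ ≤ _ := by
      rw [Finset.sum_const, nsmul_eq_mul, mul_assoc]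
      gcongr

/-- Deviation of the `e`-component of `ρ` from its adiabatic prediction. -/
def adiabaticDefect (Φ : ℝ → SuperOp n) (T : ℕ) (e : ℂ) (r ρ : ℕ → Matrix n n ℂ) (k : ℕ) :
    Matrix n n ℂ :=
  specProj (Φ (k / T)) {e} (ρ k) - (e / (1 - e)) •
    (specProj (Φ ((k + 1 : ℕ) / T)) {e} (r k) - specProj (Φ (k / T)) {e} (r k))

theorem norm_div_one_sub_le {e : ℂ} {N : ℕ} (hN : 0 < N) (he : ‖e‖ = 1) (heN : e ^ N = 1)
    (he1 : e ≠ 1) : ‖e / (1 - e)‖ ≤ N := by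
  have h1 := one_le_mul_norm_one_sub hN heN he1 he
  have h2 : 0 < ‖1 - e‖ := norm_pos_iff.2 (sub_ne_zero.2 he1.symm)
  rwa [norm_div, he, div_le_iff₀ h2]

/-- The correction absorbs the O(1/T) source acting on the invariant state. The strict bound k + 1 <
T keeps the third sampling point (k + 2)/T inside [0,1]. -/
theorem IsIrredFamily.traceNorm_adiabaticDefect_succ_le (h : IsIrredFamily ι Φ) {c : ℝ}
    (hc : IsPeriBound Φ c) {e : ℂ} (he : ∀ s ∈ Icc (0 : ℝ) 1, (Φ s).HasEigenvalue e ∧ ‖e‖ = 1)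
    (he1 : e ≠ 1) {T k : ℕ} (hk : k + 1 < T) {r ρ : ℕ → Matrix n n ℂ}
    (hr : ∀ k, k ≤ T → IsState (r k) ∧ Φ (k / T) (r k) = r k)
    (hρ : ρ (k + 1) = Φ ((k + 1 : ℕ) / T) (ρ k)) :
    traceNorm (adiabaticDefect Φ T e r ρ (k + 1)) ≤ traceNorm (adiabaticDefect Φ T e r ρ k) +
      (c * (T : ℝ)⁻¹ * traceNorm (ρ k - r k) +
        (Fintype.card n ^ 2).factorial * (c + c ^ 2) * (T : ℝ)⁻¹ ^ 2) := by
  have hs0 : (k : ℝ) / T ∈ Icc (0 : ℝ) 1 := natCast_div_mem_Icc (by omega)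
  have hs1 : ((k + 1 : ℕ) : ℝ) / T ∈ Icc (0 : ℝ) 1 := natCast_div_mem_Icc hk.le
  obtain ⟨hev, hn⟩ := he _ hs1
  obtain ⟨K, hK⟩ := h.kraus _ hs1
  have hc0 := h.periBound_nonneg hc
  have hκN := norm_div_one_sub_le (Nat.factorial_pos _) hn
    (hK.pow_factorial_eq_one (h.irred _ hs1) hev hn) he1
  have hmap := hK.specProj_map (h.irred _ hs1) hev hn (ρ k)
  have hsec := hc.traceNorm_second_difference_le he hs0.1 (h := (T : ℝ)⁻¹) (by positivity) (by
    rw [← natCast_succ_div, ← natCast_succ_div]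
    exact (natCast_div_mem_Icc (k := k + 1 + 1) hk).2) (r (k + 1))
  rw [← natCast_succ_div, ← natCast_succ_div, traceNorm_of_isState (hr (k + 1) hk.le).1,
    mul_one] at hsec
  have hd := hc.traceNorm_sub_le he hs0 hs1 (ρ k - r k)
  rw [abs_natCast_succ_div_sub] at hd
  have hinv := h.traceNorm_invariant_sub_le hc hs0 hs1 (hr k (by omega)).1 (hr k (by omega)).2
    (hr (k + 1) hk.le).1 (hr (k + 1) hk.le).2
  rw [abs_natCast_succ_div_sub] at hinv
  have hrr := hc.traceNorm_sub_le he hs0 hs1 (r (k + 1) - r k)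
  rw [abs_natCast_succ_div_sub] at hrr
  set κ := e / (1 - e) with hκ
  set p := (T : ℝ)⁻¹
  have hp : 0 ≤ p := by positivity
  -- This fixed-point equation determines κ: the source e (P₁ − P₀) r_k joins the rotated old
  -- correction to form κ (P₁ − P₀) r_k, so only the change of the correction survives.
  have hκe : κ = e + e * κ := by
    have : 1 - e ≠ 0 := sub_ne_zero.2 he1.symm
    rw [hκ]
    field_simp
    ring
  set P0 := specProj (Φ (k / T)) {e}
  set P1 := specProj (Φ ((k + 1 : ℕ) / T)) {e}
  set P2 := specProj (Φ ((k + 1 + 1 : ℕ) / T)) {e}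
  have hkey : adiabaticDefect Φ T e r ρ (k + 1) = e • adiabaticDefect Φ T e r ρ k +
      e • (P1 (ρ k - r k) - P0 (ρ k - r k)) - κ • ((P2 (r (k + 1)) - P1 (r (k + 1)) -
        (P1 (r (k + 1)) - P0 (r (k + 1)))) + (P1 (r (k + 1) - r k) - P0 (r (k + 1) - r k))) := by
    change P1 (ρ (k + 1)) - κ • (P2 (r (k + 1)) - P1 (r (k + 1))) =
      e • (P0 (ρ k) - κ • (P1 (r k) - P0 (r k))) + _ - _
    rw [hρ, hmap]
    simp only [map_sub]
    have h1 : κ • (P1 (r k) - P0 (r k)) =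
        e • (P1 (r k) - P0 (r k)) + (e * κ) • (P1 (r k) - P0 (r k)) := by
      rw [← add_smul, ← hκe]
    linear_combination (norm := module) (-1 : ℂ) • h1
  rw [hkey]
  have hX := traceNorm_nonneg (r (k + 1) - r k)
  have h2 : traceNorm ((P2 (r (k + 1)) - P1 (r (k + 1)) - (P1 (r (k + 1)) - P0 (r (k + 1)))) +
      (P1 (r (k + 1) - r k) - P0 (r (k + 1) - r k))) ≤ (c + c ^ 2) * p ^ 2 := by
    refine (traceNorm_add_le _ _).trans ?_
    have h3 : c * p * traceNorm (r (k + 1) - r k) ≤ c * p * (c * p) := by gcongr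
    calc _ ≤ c * p ^ 2 + c * p * (c * p) := add_le_add hsec (hrr.trans h3)
      _ = _ := by ring
  refine (traceNorm_sub_le _ _).trans ?_
  refine (add_le_add (traceNorm_add_le _ _) le_rfl).trans ?_
  rw [traceNorm_smul, traceNorm_smul, traceNorm_smul, hn, one_mul, one_mul, add_assoc]
  refine add_le_add_right (add_le_add hd ?_) _
  rw [mul_assoc]
  exact mul_le_mul hκN h2 (traceNorm_nonneg _) (Nat.cast_nonneg _)

/-- The evolved state follows the invariant state up to `O(T⁻¹)`. -/
theorem IsIrredFamily.traceNorm_sub_invariant_le (h : IsIrredFamily ι Φ) {ℓ : ℝ} (H : H4 Φ ℓ)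
    {c : ℝ} (hc : IsPeriBound Φ c) {ρ : ℕ → Matrix n n ℂ} {T : ℕ} (h0 : IsState (ρ 0))
    (hρi : (specProj (Φ 0) {1} + contrProj (Φ 0)) (ρ 0) = ρ 0)
    (hstep : ∀ k, ρ (k + 1) = Φ ((k + 1 : ℕ) / T) (ρ k)) {k : ℕ} (hk : k < T) {r : Matrix n n ℂ}
    (hr : IsState r) (hinv : Φ (k / T) r = r) :
    traceNorm (ρ k - r) ≤ traceNorm (contrProj (Φ 0) (ρ 0)) * ℓ ^ k +
      adiabaticConst c (Fintype.card n) * ((T : ℝ) * (1 - ℓ))⁻¹ := by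
  obtain ⟨Λ, hΛ, hcard⟩ := h.exists_peripheral H
  have hc0 := h.periBound_nonneg hc
  have hT : 0 < T := by omega
  have hmem0 : (0 : ℝ) ∈ Icc (0 : ℝ) 1 := by simp
  have hex : ∀ k : ℕ, ∃ r : Matrix n n ℂ, k ≤ T → IsState r ∧ Φ (k / T) r = r := fun k => by
    by_cases hkT : k ≤ T
    · obtain ⟨r, hr, -⟩ := h.existsUnique_invariant (natCast_div_mem_Icc hkT)
      exact ⟨r, fun _ => hr⟩
    · exact ⟨0, fun h => absurd h hkT⟩
  choose s hs using hex
  have hrs : r = s k :=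
    (h.existsUnique_invariant (natCast_div_mem_Icc hk.le)).unique ⟨hr, hinv⟩ (hs k hk.le)
  have hst : ∀ k, k ≤ T → IsState (ρ k) := by
    intro k hkT
    induction k with
    | zero => exact h0
    | succ k ih =>
      rw [hstep]
      obtain ⟨K, hK⟩ := h.kraus _ (natCast_div_mem_Icc hkT)
      exact hK.isState (ih (by omega))
  have hΛ' : ∀ e ∈ Λ, ∀ s ∈ Icc (0 : ℝ) 1, (Φ s).HasEigenvalue e ∧ ‖e‖ = 1 := fun e he s hs =>
    (hΛ s hs e).1 he
  have hcard' : ((Λ.erase 1).card : ℝ) ≤ (Fintype.card n ^ 2 : ℕ) := by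
    exact_mod_cast (Finset.card_erase_le).trans hcard
  have hone : ∀ k, k ≤ T → specProj (Φ (k / T)) {1} (ρ k) = s k := fun k hkT => by
    obtain ⟨K, hK⟩ := h.kraus _ (natCast_div_mem_Icc hkT)
    rw [hK.specProj_one_apply (h.irred _ (natCast_div_mem_Icc hkT)) (hs k hkT).1 (hs k hkT).2,
      (hst k hkT).2, one_smul]
  have h1Λ : (1 : ℂ) ∈ Λ := by
    obtain ⟨K, hK⟩ := h.kraus 0 hmem0
    exact (hΛ 0 hmem0 1).2 ⟨hK.hasEigenvalue_one, by simp⟩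
  have hκ : ∀ e ∈ Λ.erase 1, ∀ j, j < T → traceNorm ((e / (1 - e)) •
      (specProj (Φ ((j + 1 : ℕ) / T)) {e} (s j) - specProj (Φ (j / T)) {e} (s j))) ≤
      (Fintype.card n ^ 2).factorial * (c * (T : ℝ)⁻¹) := by
    intro e he j hj
    obtain ⟨he1, heΛ⟩ := Finset.mem_erase.1 he
    obtain ⟨K, hK⟩ := h.kraus 0 hmem0
    obtain ⟨hev, hn⟩ := hΛ' e heΛ 0 hmem0
    rw [traceNorm_smul]
    refine mul_le_mul (norm_div_one_sub_le (Nat.factorial_pos _) hn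
      (hK.pow_factorial_eq_one (h.irred _ hmem0) hev hn) he1) ?_ (traceNorm_nonneg _)
      (Nat.cast_nonneg _)
    have := hc.traceNorm_sub_le (hΛ' e heΛ) (natCast_div_mem_Icc hj.le)
      (natCast_div_mem_Icc (k := j + 1) hj) (s j)
    rwa [abs_natCast_succ_div_sub, traceNorm_of_isState (hs j hj.le).1, mul_one] at this
  have hsumN : ∑ e ∈ Λ.erase 1, ((Fintype.card n ^ 2).factorial * (c * (T : ℝ)⁻¹)) ≤
      (Fintype.card n ^ 2 : ℕ) * (Fintype.card n ^ 2).factorial * c * (T : ℝ)⁻¹ := by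
    rw [Finset.sum_const, nsmul_eq_mul, mul_assoc, mul_assoc]
    gcongr
  rw [hrs]
  have hzero : ((0 : ℕ) : ℝ) / T = 0 := by simp
  have hdec0 : contrProj (Φ 0) (ρ 0) = ρ 0 - s 0 := by
    have h1 := hone 0 (Nat.zero_le _)
    rw [hzero] at h1
    rw [LinearMap.add_apply, h1] at hρi
    exact eq_sub_of_add_eq' hρi
  -- The initial state lies in the range of P¹ + Q, so it has no component at e ≠ 1 and the initial
  -- defect is only the O(1/T) correction.
  have hx0 : ∀ e ∈ Λ.erase 1, specProj (Φ 0) {e} (ρ 0) = 0 := by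
    intro e he
    obtain ⟨he1, heΛ⟩ := Finset.mem_erase.1 he
    have h1 := LinearMap.congr_fun (specProj_mul_of_disjoint (Φ 0) (M := {e}) (N := {1})
      (by simpa using he1)) (ρ 0)
    have h3 : specProj (Φ 0) {e} (periProj (Φ 0) (ρ 0)) = specProj (Φ 0) {e} (ρ 0) :=
      LinearMap.congr_fun (specProj_mul_of_subset (Φ 0) (M := {e}) (N := {z | ‖z‖ = 1})
        (by simpa using (hΛ' e heΛ 0 hmem0).2)) (ρ 0)
    rw [Module.End.mul_apply, LinearMap.zero_apply] at h1
    rw [← hρi, LinearMap.add_apply, map_add, h1, contrProj, LinearMap.sub_apply, map_sub, h3,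
      Module.End.one_apply, sub_self, zero_add]
  have main := adiabatic_recursion (n := Fintype.card n)
    (W := fun k => ∑ e ∈ Λ.erase 1, traceNorm (adiabaticDefect Φ T e s ρ k))
    (Y := fun k => traceNorm (contrProj (Φ (k / T)) (ρ k)))
    (d := fun k => traceNorm (ρ k - s k)) hT hc0 H.nonneg H.2 ?_ (traceNorm_nonneg _) ?_ ?_ ?_ ?_ hk
  · simpa only [hzero] using main
  · simp only [hzero]
    rw [hdec0]
    refine (traceNorm_sub_le _ _).trans ?_
    rw [traceNorm_of_isState h0, traceNorm_of_isState (hs 0 (Nat.zero_le _)).1]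
    norm_num
  · intro k hk
    simp only [hstep k]
    exact traceNorm_contrProj_succ_le H hc0 hc hΛ hcard hk (hst k hk.le)
  · refine (Finset.sum_le_sum fun e he => ?_).trans hsumN
    have := hκ e he 0 hT
    rw [adiabaticDefect, hzero, hx0 e he, zero_sub, traceNorm_neg]
    rwa [hzero] at this
  · intro k hk
    refine (Finset.sum_le_sum fun e he => h.traceNorm_adiabaticDefect_succ_le hc
      (hΛ' e (Finset.mem_erase.1 he).2) (Finset.mem_erase.1 he).1 hk hs (hstep k)).trans ?_
    rw [Finset.sum_add_distrib, Finset.sum_const, nsmul_eq_mul]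
    have := traceNorm_nonneg (ρ k - s k)
    gcongr
  · intro k hk
    have h1 := eq_sum_specProj_add (Φ (k / T)) (hΛ _ (natCast_div_mem_Icc hk.le)) (ρ k)
    rw [← Finset.add_sum_erase _ _ h1Λ, hone k hk.le] at h1
    -- The component at eigenvalue 1 of any state is exactly the invariant state.
    have h2 : ρ k - s k = ∑ e ∈ Λ.erase 1, specProj (Φ (k / T)) {e} (ρ k) +
        contrProj (Φ (k / T)) (ρ k) := by
      rw [sub_eq_iff_eq_add']
      rwa [add_assoc] at h1
    rw [h2]
    refine (traceNorm_add_le _ _).trans (add_le_add_left ((traceNorm_sum_le _ _).trans ?_) _)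
    refine le_trans ?_ (add_le_add_right hsumN _)
    rw [← Finset.sum_add_distrib]
    refine Finset.sum_le_sum fun e he => ?_
    refine le_trans ?_ (add_le_add_right (hκ e he k hk) _)
    refine le_trans (le_of_eq ?_) (traceNorm_add_le _ _)
    rw [adiabaticDefect, sub_add_cancel]

end Adiabatic

/-! ### Entropy production near the invariant state -/

section Entropy

variable {S E : Type*} [Fintype S] [DecidableEq S] [Fintype E] [DecidableEq E] [Nonempty S]
  [Nonempty E]

theorem sub_kronecker (A B : Matrix S S ℂ) (C : Matrix E E ℂ) :
    (A - B) ⊗ₖ C = A ⊗ₖ C - B ⊗ₖ C := by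
  ext
  simp [sub_mul]

/-- The constant in the third order expansion of the relative entropy. -/
def expansionConst (m : ℝ) : ℝ := (32 + 8 * m⁻¹ * (1 + 5 * m⁻¹)) * m⁻¹ ^ 3

theorem expansionConst_nonneg {m : ℝ} (hm : 0 ≤ m) : 0 ≤ expansionConst m := by
  unfold expansionConst
  positivity

/-- Within distance m/2 of η the spectra stay above m/2 and the cubic expansion applies. Beyond it
both quantities are bounded by a function of m, and (2x/m)³ ≥ 1 absorbs them. -/
theorem norm_relEntropy_ptrace_sub_entropyForm_le {ω : Matrix (S × E) (S × E) ℂ}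
    (hω : IsState ω) {r : Matrix S S ℂ} (hr : IsState r) (hrd : r.PosDef) {ξ : Matrix E E ℂ}
    (hξ : IsState ξ) (hξd : ξ.PosDef) {x : ℝ} (hx1 : ‖ω - r ⊗ₖ ξ‖ ≤ x)
    (hx2 : ‖ptrace ω ⊗ₖ ξ - r ⊗ₖ ξ‖ ≤ x) :
    ‖(relEntropy ω (ptrace ω ⊗ₖ ξ) : ℂ) - entropyForm (r ⊗ₖ ξ) (ω - ptrace ω ⊗ₖ ξ)‖ ≤
      expansionConst (infSpec (r ⊗ₖ ξ)) * x ^ 3 := by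
  have hηd : (r ⊗ₖ ξ).PosDef := hrd.kronecker hξd
  have hη := kronecker_isState hr hξ
  have hν := kronecker_isState (ptrace_isState hω) hξ
  have hm := infSpec_pos hηd
  have hξm : ∀ y ∈ spectrum ℝ ξ, infSpec (r ⊗ₖ ξ) ≤ y := fun y hy => infSpec_kronecker_le hr hξ hy
  have hηm : ∀ y ∈ spectrum ℝ (r ⊗ₖ ξ), infSpec (r ⊗ₖ ξ) ≤ y := fun y hy => infSpec_le hy
  have hcard := card_mul_infSpec_le hη
  set η := r ⊗ₖ ξ
  set m := infSpec η
  set ν := ptrace ω ⊗ₖ ξ with hνdef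
  have hcard' : (Fintype.card (S × E) : ℝ) ≤ m⁻¹ := by
    rwa [le_inv_comm₀ (by exact_mod_cast Fintype.card_pos) hm, inv_eq_one_div,
      le_div_iff₀ (by exact_mod_cast Fintype.card_pos), mul_comm]
  have hx0 : 0 ≤ x := (norm_nonneg _).trans hx1
  unfold expansionConst
  by_cases hsmall : x ≤ m / 2
  · have hηm2 : ∀ y ∈ spectrum ℝ η, 2 * (m / 2) ≤ y := fun y hy => by
      rw [mul_div_cancel₀ m two_ne_zero]
      exact hηm y hy
    have hωm := le_spectrum_of_norm_sub_le hη.1.isHermitian hηm2 (hx1.trans hsmall)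
    have hνm := le_spectrum_of_norm_sub_le hη.1.isHermitian hηm2 (hx2.trans hsmall)
    have hm2 : 0 < m / 2 := by positivity
    have h1 := norm_relEntropy_sub_entropyForm_le
      (posDef_of_spectrum_pos hω.1.isHermitian fun y hy => hm2.trans_le (hωm y hy))
      (posDef_of_spectrum_pos hν.1.isHermitian fun y hy => hm2.trans_le (hνm y hy)) hηd
      (hω.2.trans hν.2.symm) hm2 hωm hνm (fun y hy => (half_le_self hm.le).trans (hηm y hy))
    have h2 : ‖ω - ν‖ ≤ 2 * x := by
      calc ‖ω - ν‖ = ‖(ω - η) - (ν - η)‖ := by rw [sub_sub_sub_cancel_right]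
        _ ≤ ‖ω - η‖ + ‖ν - η‖ := norm_sub_le _ _
        _ ≤ _ := by linarith
    calc _ ≤ _ := h1
      -- This gives the 32 of `expansionConst`; the dimension is replaced by m⁻¹.
      _ ≤ m⁻¹ * (2 * x) ^ 2 * (3 * x + x) * (2 * (m / 2) ^ 2)⁻¹ := by gcongr
      _ = 32 * m⁻¹ ^ 3 * x ^ 3 := by
        field_simp
        ring
      _ ≤ _ := by
        gcongr
        have : 0 ≤ 8 * m⁻¹ * (1 + 5 * m⁻¹) := by positivity
        linarith
  · have hY : (ω - ν).IsHermitian := hω.1.isHermitian.sub hν.1.isHermitian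
    have h1 := norm_entropyForm_le hηd hY hm hηm
    have h2 := abs_relEntropy_ptrace_le hω hξ hm hξm
    have h3 : ‖ω - ν‖ ≤ 2 := by
      have := norm_sub_le ω ν
      linarith [norm_le_one_of_isState hω, norm_le_one_of_isState hν]
    have h4 : 1 ≤ (2 * m⁻¹ * x) ^ 3 := by
      refine one_le_pow₀ ?_
      rw [mul_assoc, mul_comm, mul_assoc, ← div_le_iff₀' (by positivity)]
      have : 1 / m⁻¹ = m := by simp
      linarith
    have h5 : (0 : ℝ) ≤ m⁻¹ * (1 + 5 * m⁻¹) := by positivity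
    calc _ ≤ ‖(relEntropy ω ν : ℂ)‖ + ‖entropyForm η (ω - ν)‖ := norm_sub_le _ _
      _ ≤ Fintype.card (S × E) * (1 + m⁻¹) + Fintype.card (S × E) * ‖ω - ν‖ ^ 2 * m⁻¹ := by
        rw [Complex.norm_real]
        exact add_le_add h2 h1
      -- Two states differ by at most 2 in norm, which gives the second term and hence the
      -- coefficient 5.
      _ ≤ m⁻¹ * (1 + m⁻¹) + m⁻¹ * 2 ^ 2 * m⁻¹ := by gcongr
      _ = m⁻¹ * (1 + 5 * m⁻¹) * 1 := by ring
      _ ≤ m⁻¹ * (1 + 5 * m⁻¹) * (2 * m⁻¹ * x) ^ 3 := by gcongr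
      _ = 8 * m⁻¹ * (1 + 5 * m⁻¹) * m⁻¹ ^ 3 * x ^ 3 := by ring
      _ ≤ _ := by
        gcongr
        linarith

/-- A bound of the adiabatic constant in terms of the smallest eigenvalue of `η`. -/
def distanceConst (c m : ℝ) : ℝ :=
  (2 + ∑ d ∈ Finset.range (⌊m⁻¹⌋₊ + 1), adiabaticConst |c| d + |c|) * (1 + |m⁻¹|)

theorem distanceConst_nonneg (c m : ℝ) : 0 ≤ distanceConst c m := by
  have : 0 ≤ ∑ d ∈ Finset.range (⌊m⁻¹⌋₊ + 1), adiabaticConst |c| d :=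
    Finset.sum_nonneg fun d _ => adiabaticConst_nonneg (abs_nonneg c) d
  unfold distanceConst
  positivity

namespace ADRIS

variable (R : ADRIS S E)

theorem norm_sub_invariant_le {s : ℝ} (hs : s ∈ Icc (0 : ℝ) 1) {r : Matrix S S ℂ}
    (hinv : R.L s r = r) (ρ : Matrix S S ℂ) {x t : ℝ} (hX : ‖R.X s r‖ ≤ x)
    (ht : ‖ρ - r‖ ≤ t) :
    ‖R.U s * (ρ ⊗ₖ R.ξ s) * (R.U s)ᴴ - r ⊗ₖ R.ξ s‖ ≤ (x + t) * (1 + Fintype.card (S × E)) ∧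
    ‖R.L s ρ ⊗ₖ R.ξ s - r ⊗ₖ R.ξ s‖ ≤ (x + t) * (1 + Fintype.card (S × E)) := by
  have hx0 : 0 ≤ x := (norm_nonneg _).trans hX
  have ht0 : 0 ≤ t := (norm_nonneg _).trans ht
  have hξ1 := norm_le_one_of_isState (R.ξ_isState hs)
  have hkr : ∀ A : Matrix S S ℂ, ‖A ⊗ₖ R.ξ s‖ ≤ ‖A‖ := fun A =>
    (norm_kronecker_le A (R.ξ s)).trans (mul_le_of_le_one_right (norm_nonneg _) hξ1)
  have hconj : ‖R.U s * ((ρ - r) ⊗ₖ R.ξ s) * (R.U s)ᴴ‖ ≤ t :=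
    (norm_conj_unitary_le (R.U_unitary hs) _).trans ((hkr _).trans ht)
  have hN : (0 : ℝ) ≤ Fintype.card (S × E) := Nat.cast_nonneg _
  have hxt : 0 ≤ (x + t) * Fintype.card (S × E) := by positivity
  constructor
  · have h1 : R.U s * (ρ ⊗ₖ R.ξ s) * (R.U s)ᴴ - r ⊗ₖ R.ξ s =
        R.X s r + R.U s * ((ρ - r) ⊗ₖ R.ξ s) * (R.U s)ᴴ := by
      rw [X, RIS.sub_kronecker, mul_sub, sub_mul]
      abel
    rw [h1]
    refine (norm_add_le _ _).trans ?_
    linarith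
  · have h1 : R.L s ρ ⊗ₖ R.ξ s - r ⊗ₖ R.ξ s = R.L s (ρ - r) ⊗ₖ R.ξ s := by
      rw [map_sub, hinv, RIS.sub_kronecker]
    rw [h1]
    refine (hkr _).trans ((norm_ptrace_le _).trans ?_)
    have h2 : Fintype.card (S × E) * ‖R.U s * ((ρ - r) ⊗ₖ R.ξ s) * (R.U s)ᴴ‖ ≤
        Fintype.card (S × E) * t := mul_le_mul_of_nonneg_left hconj hN
    have h3 : 0 ≤ Fintype.card (S × E) * x := by positivity
    linarith

/-- The two terms containing η cancel by invariance, leaving the difference of the two arguments of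
the relative entropy. -/
theorem X_sub_D {s : ℝ} {r : Matrix S S ℂ} (hinv : R.L s r = r) (ρ : Matrix S S ℂ) :
    R.X s r - R.D s ρ r = R.U s * (ρ ⊗ₖ R.ξ s) * (R.U s)ᴴ - R.L s ρ ⊗ₖ R.ξ s := by
  rw [X, D, map_sub, hinv, RIS.sub_kronecker, RIS.sub_kronecker, mul_sub, sub_mul]
  abel

theorem norm_entropy_sub_le {ℓ c : ℝ} (hI : ∀ s ∈ Icc (0 : ℝ) 1, Irred (R.L s)) (H : H4 R.L ℓ)
    (hc : IsPeriBound R.L c) {ρi : Matrix S S ℂ} (hρi : IsState ρi)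
    (hdec : (specProj (R.L 0) {1} + contrProj (R.L 0)) ρi = ρi) {T k : ℕ} (hk : k < T)
    {r : Matrix S S ℂ} (hr : IsState r) (hinv : R.L ((k + 1 : ℕ) / T) r = r) :
    ‖(R.stepEntropy ((k + 1 : ℕ) / T) (R.state ρi T k) : ℂ) -
      entropyForm (r ⊗ₖ R.ξ ((k + 1 : ℕ) / T))
        (R.X ((k + 1 : ℕ) / T) r - R.D ((k + 1 : ℕ) / T) (R.state ρi T k) r)‖ ≤
      expansionConst (infSpec (r ⊗ₖ R.ξ ((k + 1 : ℕ) / T))) *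
        (distanceConst c (infSpec (r ⊗ₖ R.ξ ((k + 1 : ℕ) / T))) *
          (traceNorm (R.X ((k + 1 : ℕ) / T) r) + traceNorm (contrProj (R.L 0) ρi) * ℓ ^ k +
            ((T : ℝ) * (1 - ℓ))⁻¹)) ^ 3 := by
  have h := R.isIrredFamily hI
  have hs0 : (k : ℝ) / T ∈ Icc (0 : ℝ) 1 := natCast_div_mem_Icc hk.le
  have hs : ((k + 1 : ℕ) : ℝ) / T ∈ Icc (0 : ℝ) 1 := natCast_div_mem_Icc hk
  have hc0 := h.periBound_nonneg hc
  have hT : (0 : ℝ) < T := by exact_mod_cast (by omega : 0 < T)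
  have hℓ : 0 < 1 - ℓ := sub_pos.2 H.2
  -- The adiabatic estimate compares the incoming state with the invariant state at k/T, whereas η
  -- uses the one at (k+1)/T; the two differ by at most c/T.
  obtain ⟨r₀, ⟨hr₀, hr₀inv⟩, -⟩ := h.existsUnique_invariant hs0
  have hd := h.traceNorm_sub_invariant_le H hc (ρ := R.state ρi T) hρi hdec (fun _ => rfl) hk
    hr₀ hr₀inv
  have hd' := h.traceNorm_invariant_sub_le hc hs hs0 hr hinv hr₀ hr₀inv
  rw [abs_sub_comm, abs_natCast_succ_div_sub] at hd'
  change _ ≤ traceNorm (contrProj (R.L 0) ρi) * ℓ ^ k + _ at hd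
  have hst : ∀ j, j ≤ k → IsState (R.state ρi T j) := by
    intro j hj
    induction j with
    | zero => exact hρi
    | succ j ih =>
      obtain ⟨K, hK⟩ := h.kraus _ (natCast_div_mem_Icc (k := j + 1) (T := T) (by omega))
      exact hK.isState (ih (by omega))
  obtain ⟨K, hK⟩ := h.kraus _ hs
  have hrd := hK.posDef_of_isState (hI _ hs) hr hinv
  have hξ := R.ξ_isState hs
  have hξd := R.ξ_posDef hs
  have hm := infSpec_pos (hrd.kronecker hξd)
  have hcard := card_mul_infSpec_le (kronecker_isState hr hξ)
  rw [R.X_sub_D hinv]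
  set s := ((k + 1 : ℕ) : ℝ) / T
  set ρ := R.state ρi T k
  set m := infSpec (r ⊗ₖ R.ξ s)
  set q := traceNorm (contrProj (R.L 0) ρi) * ℓ ^ k
  have hq : 0 ≤ q := mul_nonneg (traceNorm_nonneg _) (pow_nonneg H.nonneg k)
  set τ := ((T : ℝ) * (1 - ℓ))⁻¹ with hτ
  have hTτ : (T : ℝ)⁻¹ ≤ τ := by
    rw [hτ]
    refine inv_anti₀ (by positivity) (mul_le_of_le_one_right hT.le ?_)
    linarith [H.nonneg]
  have hτ0 : 0 ≤ τ := (inv_nonneg.2 hT.le).trans hTτ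
  have hcard' : (Fintype.card (S × E) : ℝ) ≤ m⁻¹ := by
    rwa [le_inv_comm₀ (by exact_mod_cast Fintype.card_pos) hm, inv_eq_one_div,
      le_div_iff₀ (by exact_mod_cast Fintype.card_pos), mul_comm]
  -- The dimension is at most m⁻¹, so summing the adiabatic constants over all d ≤ m⁻¹ gives a bound
  -- depending only on c and m.
  have hmem : Fintype.card S ∈ Finset.range (⌊m⁻¹⌋₊ + 1) := by
    refine Finset.mem_range_succ_iff.2 (Nat.le_floor (le_trans ?_ hcard'))
    rw [Fintype.card_prod]
    exact_mod_cast Nat.le_mul_of_pos_right _ Fintype.card_pos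
  have hK0 : adiabaticConst c (Fintype.card S) ≤
      ∑ d ∈ Finset.range (⌊m⁻¹⌋₊ + 1), adiabaticConst |c| d := by
    rw [abs_of_nonneg hc0]
    exact Finset.single_le_sum (f := fun d => adiabaticConst c d)
      (fun d _ => adiabaticConst_nonneg hc0 d) hmem
  set Z := ∑ d ∈ Finset.range (⌊m⁻¹⌋₊ + 1), adiabaticConst |c| d with hZ
  have hZ0 : 0 ≤ Z := (adiabaticConst_nonneg hc0 _).trans hK0
  have hX := norm_le_traceNorm (R.X s r)
  set x := traceNorm (R.X s r)
  have hx0 : 0 ≤ x := traceNorm_nonneg _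
  have ht : ‖ρ - r‖ ≤ (1 + Z + c) * (x + q + τ) := by
    have h1 : ρ - r = (ρ - r₀) + (r₀ - r) := by abel
    refine (norm_le_traceNorm _).trans ?_
    rw [h1]
    refine (traceNorm_add_le _ _).trans ((add_le_add hd hd').trans ?_)
    have h2 : adiabaticConst c (Fintype.card S) * τ ≤ Z * (x + q + τ) := by
      gcongr
      linarith
    have h3 : c * (T : ℝ)⁻¹ ≤ c * (x + q + τ) := by
      gcongr
      linarith
    linarith
  obtain ⟨h1, h2⟩ := R.norm_sub_invariant_le hs hinv ρ (hX.trans (by linarith :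
    x ≤ x + q + τ)) ht
  have hle : (x + q + τ + (1 + Z + c) * (x + q + τ)) * (1 + Fintype.card (S × E)) ≤
      distanceConst c m * (x + q + τ) := by
    have h3 : distanceConst c m = (2 + Z + c) * (1 + m⁻¹) := by
      rw [distanceConst, ← hZ, abs_of_nonneg hc0, abs_of_nonneg (inv_nonneg.2 hm.le)]
    rw [h3]
    calc _ = (2 + Z + c) * (x + q + τ) * (1 + Fintype.card (S × E)) := by ring
      _ ≤ (2 + Z + c) * (x + q + τ) * (1 + m⁻¹) := by gcongr
      _ = _ := by ring
  exact norm_relEntropy_ptrace_sub_entropyForm_le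
    (conj_isState (R.U_unitary hs) (kronecker_isState (hst k le_rfl) hξ)) hr hrd hξ hξd
    (h1.trans hle) (h2.trans hle)

end ADRIS

end Entropy

end RIS

end

/-! ### The main theorem with explicit constants -/

theorem proposition6p2 :
    ∃ (T₀ CP : ℝ → ℝ) (C : ℝ → ℝ → ℝ),
      (∀ c, 0 < T₀ c) ∧ (∀ c, 0 < CP c) ∧ (∀ c m, 0 < C c m) ∧
      ∀ (S : Type*) (E : Type*) [Fintype S] [DecidableEq S] [Nonempty S]
        [Fintype E] [DecidableEq E] [Nonempty E] (R : RIS.ADRIS S E) (ℓ : ℝ),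
        (∀ s ∈ Set.Icc (0 : ℝ) 1, RIS.Irred (R.L s)) → RIS.H4 R.L ℓ →
        (∀ s ∈ Set.Icc (0 : ℝ) 1, ∃! ρ : Matrix S S ℂ, RIS.IsState ρ ∧ R.L s ρ = ρ) ∧
        (∃ c, RIS.IsPeriBound R.L c) ∧
        ∀ c, RIS.IsPeriBound R.L c →
        ∀ ρi : Matrix S S ℂ, RIS.IsState ρi →
          (RIS.specProj (R.L 0) {1} + RIS.contrProj (R.L 0)) ρi = ρi →
        ∀ T k : ℕ, 1 ≤ k → k ≤ T →
        ∀ ρinv : Matrix S S ℂ, RIS.IsState ρinv → R.L ((k : ℝ) / T) ρinv = ρinv →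
        ∀ (η X D : Matrix (S × E) (S × E) ℂ) (δ q : ℝ),
          η = ρinv ⊗ₖ R.ξ ((k : ℝ) / T) →
          X = R.X ((k : ℝ) / T) ρinv →
          D = R.D ((k : ℝ) / T) (R.state ρi T (k - 1)) ρinv →
          δ = RIS.infSpec η / 16 →
          q = RIS.traceNorm (RIS.contrProj (R.L 0) ρi) →
          max (T₀ c) (CP c * (δ * (1 - ℓ))⁻¹) ≤ (T : ℝ) →
          q * ℓ ^ k ≤ δ →
          ‖X‖ ≤ δ →
          ‖(R.σ ρi T k : ℂ) - RIS.entropyForm η (X - D)‖ ≤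
            C c (RIS.infSpec η) *
              (RIS.traceNorm X + q * ℓ ^ (k - 1) + ((T : ℝ) * (1 - ℓ))⁻¹) ^ 3 := by
  -- The absolute value and the added 1 make the last constant positive for all real c and m.
  refine ⟨fun _ => 1, fun _ => 1,
    fun c m => RIS.expansionConst |m| * RIS.distanceConst c m ^ 3 + 1, fun _ => one_pos,
    fun _ => one_pos, fun c m => ?_, ?_⟩
  · have h1 := RIS.expansionConst_nonneg (abs_nonneg m)
    have h2 := RIS.distanceConst_nonneg c m
    positivity
  · intro S E _ _ _ _ _ _ R ℓ hI H
    have h := R.isIrredFamily hI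
    refine ⟨fun s hs => h.existsUnique_invariant hs, h.exists_isPeriBound, ?_⟩
    rintro c hc ρi hρi hdec T k hk1 hkT r hr hinv η X D δ q rfl rfl rfl - rfl - - -
    -- After this shift step k + 1 starts from the state reached after k interactions, which
    -- explains the power ℓ^(k-1) in the claim.
    obtain ⟨k, rfl⟩ := Nat.exists_eq_add_of_le' hk1
    have hs : ((k + 1 : ℕ) : ℝ) / T ∈ Set.Icc (0 : ℝ) 1 := RIS.natCast_div_mem_Icc hkT
    obtain ⟨K, hK⟩ := h.kraus _ hs
    have hm := RIS.infSpec_pos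
      ((hK.posDef_of_isState (hI _ hs) hr hinv).kronecker (R.ξ_posDef hs))
    have main := R.norm_entropy_sub_le hI H hc hρi hdec hkT hr hinv
    rw [mul_pow, ← mul_assoc] at main
    rw [Nat.add_sub_cancel]
    refine le_trans main ?_
    have hℓ : 0 < 1 - ℓ := sub_pos.2 H.2
    have hnn : 0 ≤ RIS.traceNorm (R.X ((k + 1 : ℕ) / T) r) +
        RIS.traceNorm (RIS.contrProj (R.L 0) ρi) * ℓ ^ k + ((T : ℝ) * (1 - ℓ))⁻¹ :=
      add_nonneg (add_nonneg (RIS.traceNorm_nonneg _)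
        (mul_nonneg (RIS.traceNorm_nonneg _) (pow_nonneg H.nonneg k)))
        (inv_nonneg.2 (mul_nonneg (Nat.cast_nonneg _) hℓ.le))
    refine mul_le_mul_of_nonneg_right ?_ (pow_nonneg hnn 3)
    dsimp only
    rw [abs_of_pos hm]
    exact le_add_of_nonneg_right zero_le_one
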